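/- Let $\mathbf{k}$ be an algebraically closed field. A *finite abelian category* is a $\mathbf{k}$-linear abelian category that is $\mathbf{k}$-linearly equivalent to the category of finite-dimensional left modules over a finite-dimensional $\mathbf{k}$-algebra. A *finite multi-tensor category* is a rigid monoidal category that is a finite abelian category and whose tensor product is $\mathbf{k}$-bilinear; it is a *finite tensor category* if moreover its unit object is simple. Write $X^*$ for a dual of $X$ with evaluation $X^*\otimes X\to\mathbf 1$ and coevaluation $\mathbf 1\to X\otimes X^*$. A *pivotal structure* on a rigid monoidal category is an isomorphism of monoidal functors $\mathrm{id}\to(-)^{**}$. Let $\mathcal C$ be a finite tensor category with pivotal structure $\mathfrak p$, and let $\mathcal M$ be an exact left $\mathcal C$-module category, i.e. a left $\mathcal C$-module category which is a finite abelian category, on which the action $\triangleright$ is $\mathbf{k}$-bilinear and right exact in each variable, and such that $P\triangleright M$ is projective whenever $P\in\mathcal C$ is projective and $M\in\mathcal M$. Let $\underline{\mathrm{Hom}}(M,-)$ be a right adjoint of $-\triangleright M:\mathcal C\to\mathcal M$ (internal Hom). A *relative Serre functor* of $\mathcal M$ is a functor $\mathsf S:\mathcal M\to\mathcal M$ with a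 natural isomorphism $$\phi_{M,N}:\underline{\mathrm{Hom}}(M,N)^*\to\underline{\mathrm{Hom}}(N,\mathsf S(M)),$$ together with the twisted module structure $\xi_{X,M}:X^{**}\triangleright\mathsf S(M)\to\mathsf S(X\triangleright M)$ for which $\phi$ is an isomorphism of $\mathcal C$-bimodule functors. A *pivotal structure* on $\mathcal M$ is an isomorphism $\widetilde{\mathfrak p}:\mathrm{id}_{\mathcal M}\to\mathsf S$ of functors with $\widetilde{\mathfrak p}_{X\triangleright M}=\xi_{X,M}\circ(\mathfrak p_X\triangleright\widetilde{\mathfrak p}_M)$ for all $X\in\mathcal C$, $M\in\mathcal M$. Let $\mathcal C^*_{\mathcal M}$ be the category of $\mathbf{k}$-linear right exact left $\mathcal C$-module endofunctors of $\mathcal M$ and their module natural transformations, with tensor product $F\otimes G=G\circ F$. **Theorem.** Suppose that $\mathcal M$ has a pivotal structure $\widetilde{\mathfrak p}$. Then $\mathcal C^*_{\mathcal M}$ is a finite multi-tensor category and has a pivotal structure. More precisely, choose for each $F\in\mathcal C^*_{\mathcal M}$ a dual $F^*$ in $\mathcal C^*_{\mathcal M}$; the coevaluation and evaluation make it a right adjoint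 $F^{\mathrm r}:=F^*$ of $F$; put $F^{\mathrm{rr}}:=F^{**}$. Then there are a pivotal structure $\mathfrak q$ on $\mathcal C^*_{\mathcal M}$ and, for each $F$, an isomorphism of functors $\theta_F:\mathsf S\circ F\to F^{\mathrm{rr}}\circ\mathsf S$ such that $\underline{\mathrm{Hom}}(N,\theta_F(M))$ is, for all $M,N\in\mathcal M$, the composition of the canonical isomorphisms $$\underline{\mathrm{Hom}}(N,\mathsf SF(M))\cong\underline{\mathrm{Hom}}(F(M),N)^*\cong\underline{\mathrm{Hom}}(M,F^{\mathrm r}(N))^*\cong\underline{\mathrm{Hom}}(F^{\mathrm r}(N),\mathsf S(M))\cong\underline{\mathrm{Hom}}(N,F^{\mathrm{rr}}\mathsf S(M))$$ (given by $\phi$ and by the adjunctions $F\dashv F^{\mathrm r}$ and $F^{\mathrm r}\dashv F^{\mathrm{rr}}$), and $$\mathfrak q_F=\Big(F\xrightarrow{\ \widetilde{\mathfrak p}\circ F\ }\mathsf S\circ F\xrightarrow{\ \theta_F\ }F^{\mathrm{rr}}\circ\mathsf S\xrightarrow{\ F^{\mathrm{rr}}\circ\widetilde{\mathfrak p}^{-1}\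 }F^{\mathrm{rr}}\Big)\qquad(F\in\mathcal C^*_{\mathcal M}).$$ -/

import Mathlib

open CategoryTheory CategoryTheory.Limits CategoryTheory.MonoidalCategory
open scoped CategoryTheory.MonoidalCategory.MonoidalLeftAction

universe w v u v₁ u₁ v₂ u₂

noncomputable section

namespace TensorCat

/-! ### Finite abelian categories, finite (multi-)tensor categories -/

/-- A `k`-linear category is a finite abelian category if it is abelian and equivalent, as a
`k`-linear category, to the category of finite-dimensional (equivalently, finitely generated) left
modules over a finite-dimensional `k`-algebra. -/
structure IsFiniteAbelian (k : Type w) [Field k] (A : Type u) [Category.{v} A] [Preadditive A]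
    [Linear k A] : Prop where
  abelian : ∃ h : Abelian A, h.toPreadditive = (inferInstance : Preadditive A)
  equiv_modules : ∃ (B : Type w) (_ : Ring B) (_ : Algebra k B) (_ : Module.Finite k B)
    (e : A ≌ FGModuleCat.{w} B), e.functor.Additive ∧ e.functor.Linear k

/-- A finite multi-tensor category over `k`: a rigid monoidal category that is a finite abelian
category and whose tensor product is `k`-bilinear. -/
class IsFiniteMultiTensorCategory (k : Type w) [Field k] (C : Type u) [Category.{v} C]
    [Preadditive C] [Linear k C] [MonoidalCategory C] : Prop where
  finiteAbelian : IsFiniteAbelian k C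
  rigid : Nonempty (RigidCategory C)
  [monoidalPreadditive : MonoidalPreadditive C]
  [monoidalLinear : MonoidalLinear k C]

/-- A finite tensor category: a finite multi-tensor category with simple unit object. -/
class IsFiniteTensorCategory (k : Type w) [Field k] (C : Type u) [Category.{v} C]
    [Preadditive C] [Linear k C] [MonoidalCategory C] : Prop extends
    IsFiniteMultiTensorCategory k C where
  simple_unit : Simple (𝟙_ C)

/-! ### Duals and pivotal structures

For `X` in a rigid monoidal category, `dualObj X` is the dual `X^*` with evaluation
`X^* ⊗ X ⟶ 𝟙_ C` and coevaluation `𝟙_ C ⟶ X ⊗ X^*` (called the *left* dual by Etingof, Gelaki,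
Nikshych and Ostrik, and the *right* dual `Xᘁ` in Mathlib). -/

section Duals

variable {C : Type u} [Category.{v} C] [MonoidalCategory C] [RightRigidCategory C]

/-- The dual object `X^*`. -/
abbrev dualObj (X : C) : C := Xᘁ

/-- The dual morphism `f^* : Y^* ⟶ X^*` of `f : X ⟶ Y`. -/
abbrev dualMap {X Y : C} (f : X ⟶ Y) : dualObj Y ⟶ dualObj X := fᘁ

/-- The coevaluation `𝟙_ C ⟶ X ⊗ X^*`. -/
abbrev coevDual (X : C) : 𝟙_ C ⟶ X ⊗ dualObj X := η_ X Xᘁ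

/-- The evaluation `X^* ⊗ X ⟶ 𝟙_ C`. -/
abbrev evDual (X : C) : dualObj X ⊗ X ⟶ 𝟙_ C := ε_ X Xᘁ

/-- The canonical isomorphism `(X ⊗ Y)^* ≅ Y^* ⊗ X^*`. -/
abbrev dualTensor (X Y : C) : dualObj (X ⊗ Y) ≅ dualObj Y ⊗ dualObj X :=
  rightDualTensorIso X Y

/-- The canonical isomorphism `𝟙^* ≅ 𝟙`. -/
def dualUnit (C : Type u) [Category.{v} C] [MonoidalCategory C] [R : RightRigidCategory C] :
    dualObj (𝟙_ C) ≅ 𝟙_ C :=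
  rightDualIso (R.rightDual (𝟙_ C)).exact exactPairingUnit

/-- The canonical morphism `(X ⊗ Y)^** ⟶ X^** ⊗ Y^**`, that is, the inverse of the monoidal
structure of the double dual functor. -/
def ddTensor (X Y : C) :
    dualObj (dualObj (X ⊗ Y)) ⟶ dualObj (dualObj X) ⊗ dualObj (dualObj Y) :=
  dualMap (dualTensor X Y).inv ≫ (dualTensor (dualObj Y) (dualObj X)).hom

/-- The canonical morphism `𝟙^** ⟶ 𝟙`. -/
def ddUnit (C : Type u) [Category.{v} C] [MonoidalCategory C] [RightRigidCategory C] :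
    dualObj (dualObj (𝟙_ C)) ⟶ 𝟙_ C :=
  dualMap (dualUnit C).inv ≫ (dualUnit C).hom

/-- A pivotal structure: an isomorphism of monoidal functors from the identity functor to the
double dual functor `(-)^**`. -/
structure PivotalStructure (C : Type u) [Category.{v} C] [MonoidalCategory C]
    [RightRigidCategory C] where
  iso (X : C) : X ≅ dualObj (dualObj X)
  naturality {X Y : C} (f : X ⟶ Y) : f ≫ (iso Y).hom = (iso X).hom ≫ dualMap (dualMap f)
  tensor (X Y : C) : (iso (X ⊗ Y)).hom ≫ ddTensor X Y = (iso X).hom ⊗ₘ (iso Y).hom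
  unit : (iso (𝟙_ C)).hom ≫ ddUnit C = 𝟙 (𝟙_ C)

end Duals

/-! ### Finite and exact module categories -/

section ModuleCategories

variable (k : Type w) [Field k] (C : Type u₁) [Category.{v₁} C] [Preadditive C] [Linear k C]
  [MonoidalCategory C] (M : Type u₂) [Category.{v₂} M] [Preadditive M] [Linear k M]
  [MonoidalLeftAction C M]

/-- The action `C × M ⟶ M` is `k`-bilinear on morphisms. -/
class IsBilinearAction : Prop where
  action_add (X : C) {m n : M} (f g : m ⟶ n) : X ⊴ₗ (f + g) = X ⊴ₗ f + X ⊴ₗ g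
  action_smul (X : C) {m n : M} (r : k) (f : m ⟶ n) : X ⊴ₗ (r • f) = r • (X ⊴ₗ f)
  add_action {X Y : C} (f g : X ⟶ Y) (m : M) : (f + g) ⊵ₗ m = f ⊵ₗ m + g ⊵ₗ m
  smul_action {X Y : C} (r : k) (f : X ⟶ Y) (m : M) : (r • f) ⊵ₗ m = r • (f ⊵ₗ m)

/-- A finite left `C`-module category: a left `C`-module category which is a finite abelian
category and on which the action is `k`-bilinear and right exact in each variable. -/
class IsFiniteModuleCategory : Prop extends IsBilinearAction k C M where
  finiteAbelian : IsFiniteAbelian k M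
  rightExact_left (m : M) : PreservesFiniteColimits (MonoidalLeftAction.actionRight C m)
  rightExact_right (X : C) : PreservesFiniteColimits (MonoidalLeftAction.actionLeft M X)

/-- An exact left `C`-module category: a finite one such that `P ⊙ₗ m` is projective for every
object `m` and every projective object `P` of `C`. -/
class IsExactModuleCategory : Prop extends IsFiniteModuleCategory k C M where
  projective_action (P : C) (m : M) : Projective P → Projective (P ⊙ₗ m)

end ModuleCategories

/-! ### Internal Hom functors -/

/-- A choice of internal Hom functors `iHom(m, -)`: right adjoints of the functors `- ⊙ₗ m`. -/
structure InternalHom (C : Type u₁) [Category.{v₁} C] [MonoidalCategory C]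
    (M : Type u₂) [Category.{v₂} M] [MonoidalLeftAction C M] where
  functor (m : M) : M ⥤ C
  adj (m : M) : MonoidalLeftAction.actionRight C m ⊣ functor m

namespace InternalHom

variable {C : Type u₁} [Category.{v₁} C] [MonoidalCategory C]
  {M : Type u₂} [Category.{v₂} M] [MonoidalLeftAction C M] (H : InternalHom C M)

/-- The object `iHom(m, n)`. -/
abbrev hom (m n : M) : C := (H.functor m).obj n

/-- The evaluation `iHom(m, n) ⊙ₗ m ⟶ n`. -/
def ev (m n : M) : H.hom m n ⊙ₗ m ⟶ n := (H.adj m).counit.app n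

/-- The morphism `X ⟶ iHom(m, n)` corresponding to `X ⊙ₗ m ⟶ n`. -/
def curry {X : C} {m n : M} (f : X ⊙ₗ m ⟶ n) : X ⟶ H.hom m n := (H.adj m).homEquiv X n f

/-- `iHom(m, f) : iHom(m, n) ⟶ iHom(m, n')`. -/
def post (m : M) {n n' : M} (f : n ⟶ n') : H.hom m n ⟶ H.hom m n' := (H.functor m).map f

/-- `iHom(f, n) : iHom(m', n) ⟶ iHom(m, n)`. -/
def pre {m m' : M} (f : m ⟶ m') (n : M) : H.hom m' n ⟶ H.hom m n :=
  H.curry (H.hom m' n ⊴ₗ f ≫ H.ev m' n)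

/-- The left module structure `X ⊗ iHom(m, n) ⟶ iHom(m, X ⊙ₗ n)` of the internal Hom functor. -/
def leftStr (X : C) (m n : M) : X ⊗ H.hom m n ⟶ H.hom m (X ⊙ₗ n) :=
  H.curry ((αₗ X (H.hom m n) m).hom ≫ X ⊴ₗ H.ev m n)

/-- The right module structure `iHom(m, n) ⊗ Y ⟶ iHom(^*Y ⊙ₗ m, n)` of the internal Hom functor,
written for `Y = X^*`, `^*Y = X` (every object is of the form `X^*` up to isomorphism). -/
def rightStr [RightRigidCategory C] (m n : M) (X : C) :
    H.hom m n ⊗ dualObj X ⟶ H.hom (X ⊙ₗ m) n :=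
  H.curry ((αₗ (H.hom m n) (dualObj X) (X ⊙ₗ m)).hom ≫
    H.hom m n ⊴ₗ ((αₗ (dualObj X) X m).inv ≫ evDual X ⊵ₗ m ≫ (λₗ m).hom) ≫ H.ev m n)

/-- The morphism `iHom(m, n) ⟶ iHom(F m, F n)` induced by a `C`-module functor `F`. -/
def mapFunctor (F : M ⥤ M) [F.LeftLinear C] (m n : M) :
    H.hom m n ⟶ H.hom (F.obj m) (F.obj n) :=
  H.curry (Functor.LaxLeftLinear.μₗ F (H.hom m n) m ≫ F.map (H.ev m n))

end InternalHom

/-! ### Relative Serre functors -/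

section Serre

variable {C : Type u₁} [Category.{v₁} C] [MonoidalCategory C] [RightRigidCategory C]
  {M : Type u₂} [Category.{v₂} M] [MonoidalLeftAction C M]

/-- A relative Serre functor of `M`: a functor `Ser : M ⥤ M` with an isomorphism
`φ : iHom(m, n)^* ≅ iHom(n, Ser m)`, natural in `m` and `n`. -/
structure RelativeSerreFunctor (H : InternalHom C M) where
  functor : M ⥤ M
  φ (m n : M) : dualObj (H.hom m n) ≅ H.hom n (functor.obj m)
  φ_naturality_left {m m' : M} (f : m ⟶ m') (n : M) :
    dualMap (H.pre f n) ≫ (φ m' n).hom = (φ m n).hom ≫ H.post n (functor.map f)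
  φ_naturality_right (m : M) {n n' : M} (f : n ⟶ n') :
    dualMap (H.post m f) ≫ (φ m n).hom = (φ m n').hom ≫ H.pre f (functor.obj m)

/-- The twisted `C`-module structure `ξ : X^** ⊙ₗ Ser m ≅ Ser (X ⊙ₗ m)` of a relative Serre
functor: the structure of a `C`-module functor from `M` to `M` with the action twisted by `(-)^**`
for which `φ` is an isomorphism of `C`-bimodule functors. -/
structure RelativeSerreFunctor.TwistedStructure {H : InternalHom C M}
    (S : RelativeSerreFunctor H) where
  ξ (X : C) (m : M) : dualObj (dualObj X) ⊙ₗ S.functor.obj m ≅ S.functor.obj (X ⊙ₗ m)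
  naturality_left {X Y : C} (f : X ⟶ Y) (m : M) :
    dualMap (dualMap f) ⊵ₗ S.functor.obj m ≫ (ξ Y m).hom =
      (ξ X m).hom ≫ S.functor.map (f ⊵ₗ m)
  naturality_right (X : C) {m n : M} (f : m ⟶ n) :
    dualObj (dualObj X) ⊴ₗ S.functor.map f ≫ (ξ X n).hom =
      (ξ X m).hom ≫ S.functor.map (X ⊴ₗ f)
  associativity (X Y : C) (m : M) :
    (ξ (X ⊗ Y) m).hom ≫ S.functor.map (αₗ X Y m).hom =
      ddTensor X Y ⊵ₗ S.functor.obj m ≫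
        (αₗ (dualObj (dualObj X)) (dualObj (dualObj Y)) (S.functor.obj m)).hom ≫
        dualObj (dualObj X) ⊴ₗ (ξ Y m).hom ≫ (ξ X (Y ⊙ₗ m)).hom
  unitality (m : M) :
    (ξ (𝟙_ C) m).hom ≫ S.functor.map (λₗ m).hom =
      ddUnit C ⊵ₗ S.functor.obj m ≫ (λₗ (S.functor.obj m)).hom
  /-- `φ` is a morphism of left `C`-module functors. -/
  φ_left (X : C) (m n : M) :
    dualMap (H.rightStr m n X) ≫ (dualTensor (H.hom m n) (dualObj X)).hom ≫
        dualObj (dualObj X) ◁ (S.φ m n).hom ≫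
        H.leftStr (dualObj (dualObj X)) n (S.functor.obj m) ≫ H.post n (ξ X m).hom =
      (S.φ (X ⊙ₗ m) n).hom
  /-- `φ` is a morphism of right `C`-module functors. -/
  φ_right (X : C) (m n : M) :
    dualMap (H.leftStr X m n) ≫ (dualTensor X (H.hom m n)).hom ≫
        (S.φ m n).hom ▷ dualObj X ≫ H.rightStr n (S.functor.obj m) X =
      (S.φ m (X ⊙ₗ n)).hom

/-- A pivotal structure of the module category `M` with relative Serre functor `S`, whose twisted
module structure is `T`, respecting the pivotal structure `p` of `C`. -/
structure ModulePivotalStructure (p : PivotalStructure C) {H : InternalHom C M}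
    {S : RelativeSerreFunctor H} (T : S.TwistedStructure) where
  iso : 𝟭 M ≅ S.functor
  comm (X : C) (m : M) :
    iso.hom.app (X ⊙ₗ m) = ((p.iso X).hom ⊙ₗₘ iso.hom.app m) ≫ (T.ξ X m).hom

end Serre

/-! ### The dual category -/

/-- An object of the dual category `C^*_M`: a `k`-linear right exact left `C`-module endofunctor
of `M`. -/
structure DualCategory (k : Type w) [Field k] (C : Type u₁) [Category.{v₁} C]
    [MonoidalCategory C] (M : Type u₂) [Category.{v₂} M] [Preadditive M] [Linear k M]
    [MonoidalLeftAction C M] where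
  toFunctor : M ⥤ M
  [leftLinear : toFunctor.LeftLinear C]
  [additive : toFunctor.Additive]
  [linear : toFunctor.Linear k]
  [rightExact : PreservesFiniteColimits toFunctor]

namespace DualCategory

open Functor.LaxLeftLinear Functor.OplaxLeftLinear Functor.LeftLinear

attribute [instance] leftLinear additive linear rightExact

variable {k : Type w} [Field k] {C : Type u₁} [Category.{v₁} C]
  [MonoidalCategory C] {M : Type u₂} [Category.{v₂} M] [Preadditive M] [Linear k M]
  [MonoidalLeftAction C M]

/-- Morphisms of `C^*_M`: natural transformations of `C`-module functors. -/
@[ext]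
structure Hom (F G : DualCategory k C M) where
  natTrans : F.toFunctor ⟶ G.toFunctor
  comm (X : C) (m : M) : X ⊴ₗ natTrans.app m ≫ μₗ G.toFunctor X m =
    μₗ F.toFunctor X m ≫ natTrans.app (X ⊙ₗ m)

instance : Category (DualCategory k C M) where
  Hom := Hom
  id F := { natTrans := 𝟙 _, comm := by simp }
  comp f g :=
    { natTrans := f.natTrans ≫ g.natTrans
      comm := fun X m => by
        have hf := f.comm X m
        have hg := g.comm X m
        simp only [NatTrans.comp_app, MonoidalLeftAction.actionHomRight_comp, Category.assoc]
        rw [hg, ← Category.assoc, hf, Category.assoc] }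

@[ext]
lemma hom_ext {F G : DualCategory k C M} {f g : F ⟶ G} (h : f.natTrans = g.natTrans) : f = g :=
  Hom.ext h

@[simp] lemma id_natTrans (F : DualCategory k C M) : Hom.natTrans (𝟙 F) = 𝟙 F.toFunctor := rfl

@[simp] lemma comp_natTrans {F G K : DualCategory k C M} (f : F ⟶ G) (g : G ⟶ K) :
    Hom.natTrans (f ≫ g) = f.natTrans ≫ g.natTrans := rfl

/-- An isomorphism of functors compatible with the module structures is an isomorphism in the
dual category. -/
def mkIso {F G : DualCategory k C M} (e : F.toFunctor ≅ G.toFunctor)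
    (h : ∀ (X : C) (m : M), X ⊴ₗ e.hom.app m ≫ μₗ G.toFunctor X m =
      μₗ F.toFunctor X m ≫ e.hom.app (X ⊙ₗ m)) : F ≅ G where
  hom := ⟨e.hom, h⟩
  inv := ⟨e.inv, fun X m => by
    rw [← cancel_epi (X ⊴ₗ e.hom.app m), ← Category.assoc, ← Category.assoc, h]
    simp [← MonoidalLeftAction.actionHomRight_comp]⟩
  hom_inv_id := by ext : 1; exact e.hom_inv_id
  inv_hom_id := by ext : 1; exact e.inv_hom_id

/-- The identity functor as a module functor. -/
instance : (𝟭 M).LeftLinear C where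
  μₗ _ _ := 𝟙 _
  δₗ _ _ := 𝟙 _
  μₗ_comp_δₗ _ _ := by simp
  δₗ_comp_μₗ _ _ := by simp

/-- The composition of module functors as a module functor. -/
instance (F G : M ⥤ M) [F.LeftLinear C] [G.LeftLinear C] : (F ⋙ G).LeftLinear C where
  μₗ X m := μₗ G X (F.obj m) ≫ G.map (μₗ F X m)
  δₗ X m := G.map (δₗ F X m) ≫ δₗ G X (F.obj m)
  μₗ_naturality_left f m := by simp [← Functor.map_comp]
  μₗ_naturality_right X f := by simp [← Functor.map_comp]
  δₗ_naturality_left f m := by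
    simp [← Functor.map_comp_assoc]
  δₗ_naturality_right X f := by
    simp [← Functor.map_comp_assoc]
  μₗ_associativity X Y m := by
    have hF := μₗ_associativity F X Y m
    have hG := μₗ_associativity G X Y (F.obj m)
    have hn := μₗ_naturality_right G X (μₗ F Y m)
    simp only [Functor.comp_map, Functor.comp_obj, Category.assoc,
      MonoidalLeftAction.actionHomRight_comp]
    rw [← Functor.map_comp, hF, reassoc_of% hn, Functor.map_comp, Functor.map_comp,
      reassoc_of% hG]
  δₗ_associativity X Y m := by
    have hF := δₗ_associativity F X Y m
    have hG := δₗ_associativity G X Y (F.obj m)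
    have hn := δₗ_naturality_right G X (δₗ F Y m)
    simp only [Functor.comp_map, Functor.comp_obj, Category.assoc,
      MonoidalLeftAction.actionHomRight_comp]
    rw [hG, ← reassoc_of% hn, ← Functor.map_comp_assoc, hF]
    simp only [Functor.map_comp, Category.assoc]
  μₗ_unitality m := by
    simp [← Functor.map_comp]
  δₗ_unitality_inv m := by
    have hF := δₗ_unitality_inv (C := C) F m
    have hG := δₗ_unitality_inv (C := C) G (F.obj m)
    simp only [Functor.comp_map, Functor.comp_obj]
    rw [hG, hF, Functor.map_comp, Category.assoc]
  μₗ_comp_δₗ X m := by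
    simp [← Functor.map_comp_assoc]
  δₗ_comp_μₗ X m := by
    simp [← Functor.map_comp]

/-- The unit object of the dual category: the identity functor. -/
def unit : DualCategory k C M where
  toFunctor := 𝟭 M

/-- The tensor product `F ⊗ G = G ∘ F` of the dual category. -/
def tensor (F G : DualCategory k C M) : DualCategory k C M where
  toFunctor := F.toFunctor ⋙ G.toFunctor
  rightExact := comp_preservesFiniteColimits _ _

instance : MonoidalCategoryStruct (DualCategory k C M) where
  tensorObj F G := tensor F G
  tensorUnit := unit
  whiskerLeft F {G G'} g :=
    { natTrans := Functor.whiskerLeft F.toFunctor g.natTrans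
      comm := fun X m => by
        change X ⊴ₗ g.natTrans.app (F.toFunctor.obj m) ≫ μₗ G'.toFunctor X (F.toFunctor.obj m) ≫
            G'.toFunctor.map (μₗ F.toFunctor X m) =
          (μₗ G.toFunctor X (F.toFunctor.obj m) ≫ G.toFunctor.map (μₗ F.toFunctor X m)) ≫
            g.natTrans.app (F.toFunctor.obj (X ⊙ₗ m))
        rw [reassoc_of% (g.comm X (F.toFunctor.obj m)), Category.assoc, NatTrans.naturality] }
  whiskerRight {F F'} f G :=
    { natTrans := Functor.whiskerRight f.natTrans G.toFunctor
      comm := fun X m => by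
        change X ⊴ₗ G.toFunctor.map (f.natTrans.app m) ≫ μₗ G.toFunctor X (F'.toFunctor.obj m) ≫
            G.toFunctor.map (μₗ F'.toFunctor X m) =
          (μₗ G.toFunctor X (F.toFunctor.obj m) ≫ G.toFunctor.map (μₗ F.toFunctor X m)) ≫
            G.toFunctor.map (f.natTrans.app (X ⊙ₗ m))
        rw [μₗ_naturality_right_assoc, Category.assoc, ← Functor.map_comp, ← Functor.map_comp,
          f.comm] }
  associator F G K := mkIso (Functor.associator F.toFunctor G.toFunctor K.toFunctor)
    (fun X m => by
      change X ⊴ₗ 𝟙 _ ≫ (μₗ K.toFunctor X _ ≫ K.toFunctor.map (μₗ G.toFunctor X _)) ≫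
          K.toFunctor.map (G.toFunctor.map (μₗ F.toFunctor X m)) =
        (μₗ K.toFunctor X _ ≫ K.toFunctor.map (μₗ G.toFunctor X _ ≫
          G.toFunctor.map (μₗ F.toFunctor X m))) ≫ 𝟙 _
      simp)
  leftUnitor F := mkIso (Functor.leftUnitor F.toFunctor) (fun X m => by
    change X ⊴ₗ 𝟙 _ ≫ μₗ F.toFunctor X m =
      (μₗ F.toFunctor X m ≫ F.toFunctor.map (𝟙 _)) ≫ 𝟙 _
    simp)
  rightUnitor F := mkIso (Functor.rightUnitor F.toFunctor) (fun X m => by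
    change X ⊴ₗ 𝟙 _ ≫ μₗ F.toFunctor X m = (𝟙 _ ≫ μₗ F.toFunctor X m) ≫ 𝟙 _
    simp)

lemma hom_ext_app {F G : DualCategory k C M} {f g : F ⟶ G}
    (h : ∀ m : M, f.natTrans.app m = g.natTrans.app m) : f = g :=
  hom_ext (NatTrans.ext (funext h))

instance : MonoidalCategory (DualCategory k C M) where
  tensorHom_def _ _ := rfl
  id_tensorHom_id F G := hom_ext_app fun m => by
    change G.toFunctor.map (𝟙 _) ≫ 𝟙 _ = 𝟙 _
    simp
  tensorHom_comp_tensorHom {F₁ F₂ F₃ G₁ G₂ G₃} f₁ f₂ g₁ g₂ := hom_ext_app fun m => by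
    change (G₁.toFunctor.map (f₁.natTrans.app m) ≫ f₂.natTrans.app _) ≫
        (G₂.toFunctor.map (g₁.natTrans.app m) ≫ g₂.natTrans.app _) =
      G₁.toFunctor.map (f₁.natTrans.app m ≫ g₁.natTrans.app m) ≫
        f₂.natTrans.app _ ≫ g₂.natTrans.app _
    simp
  whiskerLeft_id F G := rfl
  id_whiskerRight F G := hom_ext_app fun m => by
    change G.toFunctor.map (𝟙 _) = 𝟙 _
    simp
  associator_naturality {F₁ F₂ F₃ G₁ G₂ G₃} f₁ f₂ f₃ := hom_ext_app fun m => by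
    change (F₃.toFunctor.map (F₂.toFunctor.map (f₁.natTrans.app m) ≫ f₂.natTrans.app _) ≫
        f₃.natTrans.app _) ≫ 𝟙 _ =
      𝟙 _ ≫ F₃.toFunctor.map (F₂.toFunctor.map (f₁.natTrans.app m)) ≫
        F₃.toFunctor.map (f₂.natTrans.app _) ≫ f₃.natTrans.app _
    rw [Category.comp_id, Category.id_comp, Functor.map_comp, Category.assoc]
  leftUnitor_naturality {F G} f := hom_ext_app fun m => by
    change f.natTrans.app m ≫ 𝟙 _ = 𝟙 _ ≫ f.natTrans.app m
    simp
  rightUnitor_naturality {F G} f := hom_ext_app fun m => by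
    change f.natTrans.app m ≫ 𝟙 _ = 𝟙 _ ≫ f.natTrans.app m
    simp
  pentagon F G K L := hom_ext_app fun m => by
    change L.toFunctor.map (𝟙 _) ≫ 𝟙 _ ≫ 𝟙 _ = 𝟙 _ ≫ 𝟙 _
    simp
  triangle F G := hom_ext_app fun m => by
    change 𝟙 _ ≫ 𝟙 _ = G.toFunctor.map (𝟙 _)
    simp

/-! The `k`-linear structure of the dual category is the pointwise one. -/

section Linear

variable [Preadditive C] [Linear k C] [IsBilinearAction k C M]

/-- The morphisms of the dual category as a subspace of the natural transformations. -/
def homSubmodule (F G : DualCategory k C M) : Submodule k (F.toFunctor ⟶ G.toFunctor) where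
  carrier := {f | ∀ (X : C) (m : M), X ⊴ₗ f.app m ≫ μₗ G.toFunctor X m =
    μₗ F.toFunctor X m ≫ f.app (X ⊙ₗ m)}
  add_mem' {f g} hf hg X m := by
    simp [IsBilinearAction.action_add k, hf X m, hg X m]
  zero_mem' X m := by
    have h := IsBilinearAction.action_smul X (0 : k) (0 : F.toFunctor.obj m ⟶ G.toFunctor.obj m)
    rw [zero_smul, zero_smul] at h
    simp [h]
  smul_mem' r f hf X m := by
    simp [IsBilinearAction.action_smul, hf X m]

/-- The morphisms of the dual category as a subspace of the natural transformations. -/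
def homEquiv (F G : DualCategory k C M) : (F ⟶ G) ≃ homSubmodule F G where
  toFun f := ⟨f.natTrans, f.comm⟩
  invFun f := ⟨f.1, f.2⟩
  left_inv _ := rfl
  right_inv _ := rfl

instance (F G : DualCategory k C M) : AddCommGroup (F ⟶ G) := (homEquiv F G).addCommGroup

instance (F G : DualCategory k C M) : Module k (F ⟶ G) := (homEquiv F G).module k

@[simp] lemma add_natTrans {F G : DualCategory k C M} (f g : F ⟶ G) :
    Hom.natTrans (f + g) = f.natTrans + g.natTrans := rfl

@[simp] lemma smul_natTrans {F G : DualCategory k C M} (r : k) (f : F ⟶ G) :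
    Hom.natTrans (r • f) = r • f.natTrans := rfl

instance : Preadditive (DualCategory k C M) where
  add_comp _ _ _ _ _ _ := by ext : 1; simp
  comp_add _ _ _ _ _ _ := by ext : 1; simp

instance : Linear k (DualCategory k C M) where
  smul_comp _ _ _ _ _ _ := by ext : 1; simp
  comp_smul _ _ _ _ _ _ := by ext : 1; simp

end Linear

/-! ### The comparison of the relative Serre functor with double duals

In the dual category, `F^*` is a right adjoint of `F`, with unit and counit the coevaluation and
the evaluation. -/

section Comparison

variable [RightRigidCategory (DualCategory k C M)] (F : DualCategory k C M)

/-- The unit `m ⟶ F^* (F m)` of the adjunction `F ⊣ F^*`. -/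
def adjUnit (m : M) : m ⟶ (dualObj F).toFunctor.obj (F.toFunctor.obj m) :=
  (coevDual F).natTrans.app m

/-- The counit `F (F^* m) ⟶ m` of the adjunction `F ⊣ F^*`. -/
def adjCounit (m : M) : F.toFunctor.obj ((dualObj F).toFunctor.obj m) ⟶ m :=
  (evDual F).natTrans.app m

variable (H : InternalHom C M)

/-- The internal adjunction morphism `iHom(F m, n) ⟶ iHom(m, F^* n)`. -/
def iHomAdj (m n : M) :
    H.hom (F.toFunctor.obj m) n ⟶ H.hom m ((dualObj F).toFunctor.obj n) :=
  H.mapFunctor (dualObj F).toFunctor (F.toFunctor.obj m) n ≫ H.pre (F.adjUnit m) _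

/-- The inverse `iHom(m, F^* n) ⟶ iHom(F m, n)` of the internal adjunction morphism. -/
def iHomAdjInv (m n : M) :
    H.hom m ((dualObj F).toFunctor.obj n) ⟶ H.hom (F.toFunctor.obj m) n :=
  H.mapFunctor F.toFunctor m ((dualObj F).toFunctor.obj n) ≫ H.post _ (F.adjCounit n)

variable {H} [RightRigidCategory C]

/-- `θ` is the canonical isomorphism `Ser ∘ F ≅ F^** ∘ Ser`: for every `n`, the morphism
`iHom(n, θ_m)` is the composition
`iHom(n, Ser (F m)) ≅ iHom(F m, n)^* ≅ iHom(m, F^* n)^* ≅ iHom(F^* n, Ser m) ≅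
  iHom(n, F^** (Ser m))`. -/
def IsSerreComparison (S : RelativeSerreFunctor H)
    (θ : F.toFunctor ⋙ S.functor ≅ S.functor ⋙ (dualObj (dualObj F)).toFunctor) : Prop :=
  ∀ m n : M, H.post n (θ.hom.app m) =
    (S.φ (F.toFunctor.obj m) n).inv ≫ dualMap (F.iHomAdjInv H m n) ≫
      (S.φ m ((dualObj F).toFunctor.obj n)).hom ≫
      (dualObj F).iHomAdj H n (S.functor.obj m)

end Comparison

end DualCategory

end TensorCat

end

open TensorCat

-- The module pivotal structure composed with `φ` gives isomorphisms iHom(n, m) ≅ iHom(m, n)^*.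
-- Equivalently, morphisms f : X ⊙ n ⟶ m and g : Y ⊙ m ⟶ n have a nondegenerate pairing X ⊗ Y ⟶ 𝟙,
-- which behaves like the trace of the composition of f and g: morphisms of M slide from one
-- argument to the other, and an object Z of C acting on one argument may be rotated to the other at
-- the price of the pivotal isomorphism Z ≅ Z^**. These properties are collected in `ModulePairing`,
-- and `ModulePivotalStructure.pairing` proves them from the bimodule property of `φ` and from the
-- compatibility of the pivotal structure of M with `ξ`.
--
-- For a module functor F with dual F^*, the adjunction gives bijections Hom(Y ⊙ F m, n) ≅ Hom(Y ⊙
-- m, F^* n) (`mate`, `comate`). The isomorphism q : F ≅ F^** is defined by adjointness for the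
-- pairing: ⟨f, mate y⟩ = ⟨mate (f ≫ q), y⟩ (`pair_doubleDualApp`). Nondegeneracy gives existence
-- and uniqueness. Uniqueness in turn gives naturality in F, monoidality and the unit axiom;
-- C-linearity of q follows from the rotation property. Then θ is q conjugated by the isomorphism id
-- ≅ S, and the adjointness of q says exactly that θ is the canonical comparison
-- (`curry_homDual_dualMap`).
--
-- That the dual category is finite multi-tensor rests on two facts. Over a rigid C every lax module
-- functor is strong (`laxIso`), and every additive module functor on an exact module category is
-- exact (`exact_of_leftLinear`). Hence pointwise kernels, pointwise cokernels and right adjoints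
-- stay in the dual category, which is therefore abelian with right duals; the isomorphism F ≅ F^**
-- turns F^* into a left dual as well. For a projective generator P of M, the functor iHom(P, -) ⊙ P
-- represents F ↦ Hom(P, F P), so it is a projective generator of the dual category, and an abelian
-- category with a projective generator and finite-dimensional Hom spaces out of it is a category of
-- modules.

universe v₃ u₃

noncomputable section

namespace TensorCat

open Functor.LaxLeftLinear Functor.OplaxLeftLinear Functor.LeftLinear MonoidalLeftAction

/-! ### Module functors over a rigid category -/

section Action

variable {C : Type u₁} [Category.{v₁} C] [MonoidalCategory C]
  {D : Type u₂} [Category.{v₂} D] [MonoidalLeftAction C D]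
  {D' : Type u₃} [Category.{v₃} D'] [MonoidalLeftAction C D']

lemma tensor_unit_action (X : C) (d : D) :
    (αₗ X (𝟙_ C) d).hom ≫ X ⊴ₗ (λₗ d).hom = (ρ_ X).hom ⊵ₗ d := by simp

/-- The unit `d ⟶ X ⊙ₗ Y ⊙ₗ d` of the adjunction between the actions of dual objects. -/
def actUnit (X Y : C) [ExactPairing X Y] (d : D) : d ⟶ X ⊙ₗ Y ⊙ₗ d :=
  (λₗ d).inv ≫ η_ X Y ⊵ₗ d ≫ (αₗ X Y d).hom

/-- The counit `Y ⊙ₗ X ⊙ₗ d ⟶ d` of the adjunction between the actions of dual objects. -/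
def actCounit (X Y : C) [ExactPairing X Y] (d : D) : Y ⊙ₗ X ⊙ₗ d ⟶ d :=
  (αₗ Y X d).inv ≫ ε_ X Y ⊵ₗ d ≫ (λₗ d).hom

lemma actUnit_naturality (X Y : C) [ExactPairing X Y] {d d' : D} (f : d ⟶ d') :
    f ≫ actUnit X Y d' = actUnit X Y d ≫ X ⊴ₗ Y ⊴ₗ f := by
  have h := action_exchange (η_ X Y) f
  simp only [tensor_actionHomRight, unit_actionHomRight, Category.assoc] at h
  simp only [actUnit, Category.assoc]
  rw [← cancel_epi (λₗ[C] d).hom, ← cancel_mono (αₗ X Y d').inv]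
  simp [h]

lemma actCounit_naturality (X Y : C) [ExactPairing X Y] {d d' : D} (f : d ⟶ d') :
    Y ⊴ₗ X ⊴ₗ f ≫ actCounit X Y d' = actCounit X Y d ≫ f := by
  have h := action_exchange (ε_ X Y) f
  simp only [tensor_actionHomRight, unit_actionHomRight, Category.assoc] at h
  simp only [actCounit, Category.assoc]
  rw [← cancel_epi (αₗ Y X d).hom, ← cancel_mono (λₗ[C] d').inv]
  simp [h]

-- One zigzag identity of the exact pairing, applied to `d`. The coherence of the action replaces
-- the unitors and associators of C by those of the action.
@[simp]
lemma actUnit_actCounit (X Y : C) [ExactPairing X Y] (d : D) :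
    actUnit X Y (X ⊙ₗ d) ≫ X ⊴ₗ actCounit X Y d = 𝟙 _ := by
  have h := congrArg (fun f => f ⊵ₗ d) (ExactPairing.evaluation_coevaluation X Y)
  simp only [comp_actionHomLeft, leftUnitor_actionHom] at h
  have h2 : (ρ_ X).inv ⊵ₗ d = X ⊴ₗ (λₗ d).inv ≫ (αₗ _ _ _).inv := by
    rw [← cancel_mono ((ρ_ X).hom ⊵ₗ d), ← comp_actionHomLeft]
    simp
  have h3 := MonoidalLeftAction.associator_actionHom X Y X d
  rw [h2] at h
  simp only [actUnit, actCounit, actionHomRight_comp, Category.assoc, actionHomLeft_action]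
  rw [← cancel_epi (λₗ[C] (X ⊙ₗ d)).hom, ← cancel_epi (αₗ _ _ _).hom,
    ← cancel_mono (X ⊴ₗ (λₗ[C] d).inv), ← cancel_mono (αₗ _ _ _).inv]
  simp only [Category.assoc, Iso.hom_inv_id_assoc, Category.comp_id, actionHomRight_hom_inv_assoc] at h ⊢
  rw [← h]
  rw [← reassoc_of% h3]
  simp

@[simp]
lemma actUnit_actCounit' (X Y : C) [ExactPairing X Y] (d : D) :
    Y ⊴ₗ actUnit X Y d ≫ actCounit X Y (Y ⊙ₗ d) = 𝟙 _ := by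
  have h := congrArg (fun f => f ⊵ₗ d) (ExactPairing.coevaluation_evaluation X Y)
  simp only [comp_actionHomLeft, rightUnitor_actionHom] at h
  have h2 : (λ_ Y).inv ⊵ₗ d = (λₗ _).inv ≫ (αₗ _ _ _).inv := by
    rw [← cancel_mono ((λ_ Y).hom ⊵ₗ d), ← comp_actionHomLeft]
    simp
  have h3 := MonoidalLeftAction.associator_actionHom Y X Y d
  have h4 : (α_ Y X Y).inv ⊵ₗ d ≫ (αₗ (Y ⊗ X : C) Y d).hom ≫ (αₗ Y X (Y ⊙ₗ d)).hom =
     (αₗ Y (X ⊗ Y) d).hom ≫ Y ⊴ₗ (αₗ X Y d).hom := by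
    rw [← h3, inv_hom_actionHomLeft_assoc]
  rw [h2] at h
  simp only [actUnit, actCounit, actionHomRight_comp, Category.assoc, actionHomLeft_action]
  rw [← cancel_epi (Y ⊴ₗ (λₗ[C] d).hom), ← cancel_epi (αₗ _ _ _).hom,
    ← cancel_mono (λₗ[C] (Y ⊙ₗ d)).inv, ← cancel_mono (αₗ _ _ _).inv]
  simp only [Category.assoc, Category.comp_id, actionHomRight_hom_inv_assoc,
    Iso.hom_inv_id] at h ⊢
  rw [← h]
  have h5 : Y ⊴ₗ (αₗ X Y d).hom ≫ (αₗ Y X (Y ⊙ₗ d)).inv ≫ (αₗ (Y ⊗ X : C) Y d).inv =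
      (αₗ Y (X ⊗ Y) d).inv ≫ (α_ Y X Y).inv ⊵ₗ d := by
    rw [Iso.eq_inv_comp, ← reassoc_of% h4]
    simp
  rw [reassoc_of% h5]
  simp

/-- The inverse `G (X ⊙ₗ d) ⟶ X ⊙ₗ G d` of the structure morphism of a lax module functor. -/
def laxInv (G : D ⥤ D') [G.LaxLeftLinear C] (X Y : C) [ExactPairing X Y] (d : D) :
    G.obj (X ⊙ₗ d) ⟶ X ⊙ₗ G.obj d :=
  actUnit X Y _ ≫ X ⊴ₗ (μₗ G Y (X ⊙ₗ d) ≫ G.map (actCounit X Y d))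

/-- Associativity of the lax structure merges the two actions into that of X ⊗ Y, naturality moves
the coevaluation through, and unitality absorbs what is left. With the counit version below, this
shows that lax structures respect the adjunctions between actions of dual objects. -/
lemma actUnit_lax (G : D ⥤ D') [G.LaxLeftLinear C] (X Y : C) [ExactPairing X Y] (d : D) :
    actUnit X Y (G.obj d) ≫ X ⊴ₗ μₗ G Y d ≫ μₗ G X (Y ⊙ₗ d) = G.map (actUnit X Y d) := by
  have h := μₗ_associativity G X Y d
  simp only [actUnit, Category.assoc, Functor.map_comp]
  rw [← h, μₗ_naturality_left_assoc, μₗ_unitality_inv_assoc]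

lemma lax_actCounit (G : D ⥤ D') [G.LaxLeftLinear C] (X Y : C) [ExactPairing X Y] (d : D) :
    Y ⊴ₗ μₗ G X d ≫ μₗ G Y (X ⊙ₗ d) ≫ G.map (actCounit X Y d) = actCounit X Y (G.obj d) := by
  simp only [actCounit, Functor.map_comp]
  rw [μₗ_associativity_inv_assoc, ← μₗ_naturality_left_assoc, ← μₗ_unitality]

/-- Naturality of `actUnit` carries the structure morphism under X ⊙ Y ⊙ -, where `lax_actCounit`
absorbs it; a zigzag remains. -/
lemma lax_comp_laxInv (G : D ⥤ D') [G.LaxLeftLinear C] (X Y : C) [ExactPairing X Y] (d : D) :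
    μₗ G X d ≫ laxInv G X Y d = 𝟙 _ := by
  rw [laxInv, reassoc_of% @actUnit_naturality, ← actionHomRight_comp, lax_actCounit, actUnit_actCounit]

lemma laxInv_comp_lax (G : D ⥤ D') [G.LaxLeftLinear C] (X Y : C) [ExactPairing X Y] (d : D) :
    laxInv G X Y d ≫ μₗ G X d = 𝟙 _ := by
  rw [laxInv, actionHomRight_comp, Category.assoc, Category.assoc, μₗ_naturality_right,
    reassoc_of% @actUnit_lax, ← G.map_comp, actUnit_actCounit, G.map_id]

/-- The structure morphisms of a lax module functor over a rigid category are isomorphisms. -/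
@[simps]
def laxIso [RightRigidCategory C] (G : D ⥤ D') [G.LaxLeftLinear C] (X : C) (d : D) :
    X ⊙ₗ G.obj d ≅ G.obj (X ⊙ₗ d) where
  hom := μₗ G X d
  inv := laxInv G X (dualObj X) d
  hom_inv_id := lax_comp_laxInv G X _ d
  inv_hom_id := laxInv_comp_lax G X _ d

/-- A lax module functor over a rigid category is a module functor. -/
@[reducible]
def leftLinearOfLax [RightRigidCategory C] (G : D ⥤ D') [G.LaxLeftLinear C] : G.LeftLinear C where
  δₗ X d := (laxIso G X d).inv
  δₗ_naturality_left {X X'} f d := by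
    rw [Iso.comp_inv_eq, Category.assoc, Iso.eq_inv_comp]
    exact (μₗ_naturality_left G f d).symm
  δₗ_naturality_right X {d d'} f := by
    rw [Iso.comp_inv_eq, Category.assoc, Iso.eq_inv_comp]
    exact (μₗ_naturality_right G X f).symm
  δₗ_associativity X X' d := by
    rw [Iso.inv_comp_eq, laxIso_hom, μₗ_associativity_assoc, ← laxIso_hom (C := C) G X,
      Iso.hom_inv_id_assoc, ← actionHomRight_comp, ← laxIso_hom (C := C) G X', Iso.hom_inv_id]
    simp
  δₗ_unitality_inv d := by
    rw [Iso.eq_comp_inv]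
    exact μₗ_unitality_inv G d
  μₗ_comp_δₗ X d := (laxIso G X d).hom_inv_id
  δₗ_comp_μₗ X d := (laxIso G X d).inv_hom_id

/-- A right adjoint of an oplax module functor is a lax module functor. -/
@[reducible]
def rightAdjointLax {F : D ⥤ D'} {G : D' ⥤ D} (adj : F ⊣ G) [F.OplaxLeftLinear C] :
    G.LaxLeftLinear C where
  μₗ X d := adj.homEquiv _ _ (δₗ F X (G.obj d) ≫ X ⊴ₗ adj.counit.app d)
  μₗ_naturality_left f d := by
    rw [← adj.homEquiv_naturality_left, ← adj.homEquiv_naturality_right, δₗ_naturality_left_assoc,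
      Category.assoc, action_exchange]
  μₗ_naturality_right X {d d'} f := by
    rw [← adj.homEquiv_naturality_left, ← adj.homEquiv_naturality_right, δₗ_naturality_right_assoc,
      Category.assoc, ← actionHomRight_comp, ← actionHomRight_comp]
    congr 3
    exact adj.counit_naturality f
  μₗ_associativity X X' d := by
    rw [← adj.homEquiv_naturality_right, ← adj.homEquiv_naturality_left,
      ← adj.homEquiv_naturality_left]
    congr 1
    rw [δₗ_naturality_right_assoc, ← actionHomRight_comp]
    -- Applying F and then the counit undoes transposition, so the structure morphism of G
    -- disappears and the associativity of F applies.
    have h (t : F.obj (X' ⊙ₗ G.obj d) ⟶ X' ⊙ₗ d) :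
        F.map (adj.homEquiv _ _ t) ≫ adj.counit.app (X' ⊙ₗ d) = t :=
      (adj.homEquiv_counit _ _ _).symm.trans (Equiv.symm_apply_apply _ _)
    erw [h]
    rw [Category.assoc, tensor_actionHomRight, Category.assoc, Category.assoc, Iso.inv_hom_id,
      Category.comp_id, δₗ_associativity_assoc, actionHomRight_comp]
  μₗ_unitality d := by
    rw [← adj.homEquiv_naturality_right, ← Equiv.symm_apply_eq, adj.homEquiv_counit,
      Category.assoc, ← actionUnitIso_hom_naturality, δₗ_unitality_hom_assoc]

end Action

/-! ### Calculus of internal Homs in terms of `curry` -/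

namespace InternalHom

variable {C : Type u₁} [Category.{v₁} C] [MonoidalCategory C]
  {M : Type u₂} [Category.{v₂} M] [MonoidalLeftAction C M] (H : InternalHom C M)

lemma comp_curry {X X' : C} (x : X' ⟶ X) {m n : M} (f : X ⊙ₗ m ⟶ n) :
    x ≫ H.curry f = H.curry (x ⊵ₗ m ≫ f) :=
  ((H.adj m).homEquiv_naturality_left x f).symm

lemma curry_post {X : C} {m n n' : M} (f : X ⊙ₗ m ⟶ n) (h : n ⟶ n') :
    H.curry f ≫ H.post m h = H.curry (f ≫ h) :=
  ((H.adj m).homEquiv_naturality_right f h).symm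

lemma curry_injective {X : C} {m n : M} {f g : X ⊙ₗ m ⟶ n} (h : H.curry f = H.curry g) : f = g :=
  ((H.adj m).homEquiv X n).injective h

lemma exists_curry {X : C} {m n : M} (x : X ⟶ H.hom m n) : ∃ f, x = H.curry f :=
  ⟨((H.adj m).homEquiv X n).symm x, (Equiv.apply_symm_apply _ _).symm⟩

@[simp]
lemma curry_ev (m n : M) : H.curry (H.ev m n) = 𝟙 _ :=
  by simp [curry, ev, Adjunction.homEquiv_unit]

@[simp]
lemma curry_action_ev {X : C} {m n : M} (f : X ⊙ₗ m ⟶ n) : H.curry f ⊵ₗ m ≫ H.ev m n = f := by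
  apply H.curry_injective
  rw [← comp_curry, curry_ev, Category.comp_id]

lemma curry_pre {X : C} {m m' n : M} (h : m ⟶ m') (f : X ⊙ₗ m' ⟶ n) :
    H.curry f ≫ H.pre h n = H.curry (X ⊴ₗ h ≫ f) := by
  rw [pre, comp_curry, ← action_exchange_assoc, curry_action_ev]

lemma curry_leftStr (X : C) {Y : C} {m n : M} (f : Y ⊙ₗ m ⟶ n) :
    X ◁ H.curry f ≫ H.leftStr X m n = H.curry ((αₗ X Y m).hom ≫ X ⊴ₗ f) := by
  rw [leftStr, comp_curry, whiskerLeft_actionHomLeft]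
  simp only [Category.assoc, Iso.inv_hom_id_assoc]
  rw [← actionHomRight_comp, curry_action_ev]

lemma curry_mapFunctor (F : M ⥤ M) [F.LeftLinear C] {X : C} {m n : M} (f : X ⊙ₗ m ⟶ n) :
    H.curry f ≫ H.mapFunctor F m n = H.curry (μₗ F X m ≫ F.map f) := by
  rw [mapFunctor, comp_curry, μₗ_naturality_left_assoc, ← F.map_comp, curry_action_ev]

lemma post_comp (m : M) {n n' n'' : M} (f : n ⟶ n') (g : n' ⟶ n'') :
    H.post m (f ≫ g) = H.post m f ≫ H.post m g := (H.functor m).map_comp f g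

instance (m : M) {n n' : M} (f : n ⟶ n') [IsIso f] : IsIso (H.post m f) :=
  inferInstanceAs (IsIso ((H.functor m).map f))

/-- Yoneda: `curry` of the evaluation is the identity, so that single test morphism already
suffices. -/
lemma hom_ext {m n : M} {Z : C} {a b : H.hom m n ⟶ Z}
    (h : ∀ (X : C) (f : X ⊙ₗ m ⟶ n), H.curry f ≫ a = H.curry f ≫ b) : a = b := by
  simpa using h _ (H.ev m n)

lemma pre_post {m m' n n' : M} (f : m ⟶ m') (g : n ⟶ n') :
    H.pre f n ≫ H.post m g = H.post m' g ≫ H.pre f n' :=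
  H.hom_ext fun X t => by
    rw [reassoc_of% @curry_pre, curry_post, reassoc_of% @curry_post, curry_pre, Category.assoc]

lemma leftStr_post (X : C) (m : M) {n n' : M} (f : n ⟶ n') :
    H.leftStr X m n ≫ H.post m (X ⊴ₗ f) = X ◁ H.post m f ≫ H.leftStr X m n' := by
  rw [leftStr, leftStr, curry_post, comp_curry, whiskerLeft_actionHomLeft]
  congr 1
  simp only [Category.assoc, Iso.inv_hom_id_assoc, ← actionHomRight_comp]
  rw [show H.post m f = H.curry (H.ev m n ≫ f) by
    rw [← curry_post, curry_ev, Category.id_comp], curry_action_ev]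

lemma leftStr_post_left {X X' : C} (x : X ⟶ X') (m n : M) :
    H.leftStr X m n ≫ H.post m (x ⊵ₗ n) = x ▷ _ ≫ H.leftStr X' m n := by
  rw [leftStr, leftStr, curry_post, comp_curry]
  simp [action_exchange]

/-- The functor `- ⊙ₗ m` as a module functor. -/
instance (m : M) : (actionRight C m).OplaxLeftLinear C where
  δₗ X Y := (αₗ X Y m).hom
  δₗ_naturality_left f Y := by
    change (f ▷ Y) ⊵ₗ m ≫ _ = _ ≫ f ⊵ₗ (Y ⊙ₗ m)
    simp
  δₗ_naturality_right X _ _ f := by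
    change (X ◁ f) ⊵ₗ m ≫ _ = _ ≫ X ⊴ₗ f ⊵ₗ m
    simp
  δₗ_associativity X Y Z := (associator_actionHom X Y Z m).symm
  δₗ_unitality_inv X := by
    change (λₗ (X ⊙ₗ m)).inv = (λ_ X).inv ⊵ₗ m ≫ _
    rw [← cancel_epi ((λ_ X).hom ⊵ₗ m), hom_inv_actionHomLeft_assoc, leftUnitor_actionHom]
    simp

/-- The internal Hom functor as a lax module functor. -/
instance (m : M) : (H.functor m).LaxLeftLinear C := rightAdjointLax (H.adj m)

variable [RightRigidCategory C]

lemma curry_rightStr (X : C) {Y : C} {m n : M} (f : Y ⊙ₗ m ⟶ n) :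
    H.curry f ▷ dualObj X ≫ H.rightStr m n X =
      H.curry ((αₗ Y (dualObj X) (X ⊙ₗ m)).hom ≫ Y ⊴ₗ actCounit X (dualObj X) m ≫ f) := by
  rw [rightStr, comp_curry]
  simp only [whiskerRight_actionHomLeft, Category.assoc, Iso.inv_hom_id_assoc]
  rw [← action_exchange_assoc, curry_action_ev]
  rfl

lemma rightStr_post (X : C) (m : M) {n n' : M} (f : n ⟶ n') :
    H.rightStr m n X ≫ H.post (X ⊙ₗ m) f = H.post m f ▷ dualObj X ≫ H.rightStr m n' X := by
  have h : H.post m f = H.curry (H.ev m n ≫ f) := by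
    rw [← curry_post, curry_ev, Category.id_comp]
  rw [h, curry_rightStr, rightStr, curry_post, Category.assoc, Category.assoc]
  rfl

/-- A pair Z ⊗ Z^* is created, and `rightStr` evaluates Z^* against Z: a zigzag. Morphisms into
iHom(Z ⊙ m, n) are thus reached through `rightStr`, whose invertibility is never needed. -/
lemma curry_eq_rightStr (Z : C) {Y : C} {m n : M} (g : Y ⊙ₗ (Z ⊙ₗ m) ⟶ n) :
    (ρ_ Y).inv ≫ Y ◁ coevDual Z ≫ (α_ Y Z (dualObj Z)).inv ≫
      H.curry ((αₗ Y Z m).hom ≫ g) ▷ dualObj Z ≫ H.rightStr m n Z = H.curry g := by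
  rw [curry_rightStr, comp_curry, comp_curry, comp_curry]
  congr 1
  have h1 : (ρ_ Y).inv ⊵ₗ (Z ⊙ₗ m) = Y ⊴ₗ (λₗ (Z ⊙ₗ m)).inv ≫ (αₗ _ _ _).inv := by
    rw [← cancel_mono ((ρ_ Y).hom ⊵ₗ (Z ⊙ₗ m)), ← comp_actionHomLeft, ← tensor_unit_action]
    simp only [Category.assoc, Iso.inv_hom_id, Iso.inv_hom_id_assoc, id_actionHomLeft,
      actionHomRight_inv_hom]
  have h2 : (α_ Y Z (dualObj Z)).inv ⊵ₗ (Z ⊙ₗ m) ≫ (αₗ (Y ⊗ Z) (dualObj Z) (Z ⊙ₗ m)).hom ≫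
      (αₗ Y Z _).hom = (αₗ Y _ _).hom ≫ Y ⊴ₗ (αₗ Z (dualObj Z) (Z ⊙ₗ m)).hom := by
    rw [← associator_actionHom, inv_hom_actionHomLeft_assoc]
  rw [tensor_actionHomRight]
  simp only [Category.assoc, Iso.inv_hom_id_assoc]
  rw [reassoc_of% h2, h1, whiskerLeft_actionHomLeft]
  simp only [Category.assoc, Iso.inv_hom_id_assoc]
  have h3 := congrArg (fun t => Y ⊴ₗ t) (actUnit_actCounit Z (dualObj Z) m)
  simp only [actUnit, actionHomRight_comp, actionHomRight_id, Category.assoc] at h3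
  rw [reassoc_of% h3]

/-- `leftStr` is, by definition, the lax structure that iHom(m, -) inherits as a right adjoint of -
⊙ m, and lax structures over a rigid category are invertible. -/
instance (X : C) (m n : M) : IsIso (H.leftStr X m n) :=
  (laxIso (H.functor m) X n).isIso_hom

end InternalHom

/-! ### Evaluations and their rotation in a monoidal category -/

section Monoidal

variable {C : Type u₁} [Category.{v₁} C] [MonoidalCategory C]

/-- The comparison of two right duals is the mate of the identity of X. -/
lemma rightDualIso_comp_evaluation {X Y₁ Y₂ : C} (p₁ : ExactPairing X Y₁)
    (p₂ : ExactPairing X Y₂) :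
    (rightDualIso p₁ p₂).hom ▷ X ≫ p₂.evaluation' = p₁.evaluation' := by
  have h := @rightAdjointMate_comp_evaluation C _ _ X X ⟨Y₂⟩ ⟨Y₁⟩ (𝟙 X)
  rw [whiskerLeft_id, Category.id_comp] at h
  exact h

/-- A form of the triangle identity, for the evaluation of a tensor product. -/
lemma coevaluation_tensor_evaluation {X X' Y W W' : C} [ExactPairing X X'] [ExactPairing W W']
    (a : X ⟶ W') (b : Y ⟶ W) :
    ((ρ_ (𝟙_ C)).inv ≫ 𝟙_ C ◁ η_ X X' ≫ (α_ (𝟙_ C) X X').inv ≫ ((λ_ X).hom ≫ a) ▷ X') ▷ (X ⊗ Y) ≫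
      (W' ⊗ X') ◁ (X ◁ b) ≫ ε_ (X ⊗ W) (W' ⊗ X') =
    (λ_ (X ⊗ Y)).hom ≫ a ▷ Y ≫ W' ◁ b ≫ ε_ W W' := by
  rw [ExactPairing.tensor_evaluation]
  calc
    _ = 𝟙 _ ⊗≫ η_ X X' ▷ X ▷ Y ⊗≫ a ▷ (X' ⊗ X ⊗ Y) ⊗≫
          W' ◁ ((X' ⊗ X) ◁ b ≫ ε_ X X' ▷ W) ⊗≫ ε_ W W' := by monoidal
    _ = 𝟙 _ ⊗≫ η_ X X' ▷ X ▷ Y ⊗≫ (a ▷ (X' ⊗ X) ≫ W' ◁ ε_ X X') ▷ Y ⊗≫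
          W' ◁ b ⊗≫ ε_ W W' := by rw [whisker_exchange]; monoidal
    -- Moving `a` past the evaluation of X lets that evaluation meet the coevaluation in a zigzag.
    _ = 𝟙 _ ⊗≫ (η_ X X' ▷ X ⊗≫ X ◁ ε_ X X') ▷ Y ⊗≫ a ▷ Y ⊗≫ W' ◁ b ⊗≫ ε_ W W' := by
          rw [← whisker_exchange]; monoidal
    _ = _ := by rw [ExactPairing.evaluation_coevaluation'']; monoidal

lemma tensor_evaluation_eq (X X' Y Y' : C) [ExactPairing X X'] [ExactPairing Y Y'] :
    ε_ (X ⊗ Y) (Y' ⊗ X') = (α_ Y' X' (X ⊗ Y)).hom ≫ Y' ◁ (α_ X' X Y).inv ≫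
      Y' ◁ (ε_ X X' ▷ Y) ≫ Y' ◁ (λ_ Y).hom ≫ ε_ Y Y' := by
  rw [ExactPairing.tensor_evaluation]
  monoidal

/-- The morphism obtained from `X ⊗ Y ⊗ Z ⟶ 𝟙` by rotating the last factor to the front. -/
def rotate {X Y Z : C} (Z' : C) {Z'' : C} [ExactPairing Z Z'] [ExactPairing Z' Z''] (i : Z ⟶ Z'')
    (t : X ⊗ (Y ⊗ Z) ⟶ 𝟙_ C) : (Z ⊗ X) ⊗ Y ⟶ 𝟙_ C :=
  𝟙 _ ⊗≫ i ▷ (X ⊗ Y) ⊗≫ (Z'' ⊗ X ⊗ Y) ◁ η_ Z Z' ⊗≫ Z'' ◁ t ▷ Z' ⊗≫ ε_ Z' Z''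

/-- The evaluation of W ⊗ Z' is nested: W is evaluated inside, Z' against Z'' outside. The inner
part is the pairing being rotated, and the outer part closes the strand of Z after `i` has carried
it to Z''. -/
lemma tensor_evaluation_eq_rotate {X Y Z Z' Z'' W W' : C} [ExactPairing Z Z']
    [ExactPairing Z' Z''] [ExactPairing W W'] (i : Z ⟶ Z'') (a : X ⟶ W') (b : Y ⊗ Z ⟶ W) :
    (Z ◁ a ≫ i ▷ W') ▷ Y ≫
      (Z'' ⊗ W') ◁ ((ρ_ Y).inv ≫ Y ◁ η_ Z Z' ≫ (α_ Y Z Z').inv ≫ b ▷ Z') ≫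
        ε_ (W ⊗ Z') (Z'' ⊗ W') =
    rotate Z' i (a ▷ (Y ⊗ Z) ≫ W' ◁ b ≫ ε_ W W') := by
  rw [ExactPairing.tensor_evaluation, rotate]
  calc
    _ = 𝟙 _ ⊗≫ (Z ◁ a ≫ i ▷ W') ▷ Y ⊗≫ (Z'' ⊗ W' ⊗ Y) ◁ η_ Z Z' ⊗≫
          Z'' ◁ W' ◁ b ▷ Z' ⊗≫ Z'' ◁ ε_ W W' ▷ Z' ⊗≫ ε_ Z' Z'' := by monoidal
    _ = 𝟙 _ ⊗≫ i ▷ (X ⊗ Y) ⊗≫ (Z'' ◁ (a ▷ (Y ⊗ 𝟙_ C) ≫ W' ◁ (Y ◁ η_ Z Z'))) ⊗≫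
          Z'' ◁ W' ◁ b ▷ Z' ⊗≫ Z'' ◁ ε_ W W' ▷ Z' ⊗≫ ε_ Z' Z'' := by
      rw [whisker_exchange]; monoidal
    _ = _ := by rw [← whisker_exchange]; monoidal

/-- Up to unitors this is the bijection of the adjunction - ⊗ W ⊣ - ⊗ W'. All nondegeneracy of the
module pairing comes from it. -/
lemma exists_unique_evaluation {X W W' : C} [ExactPairing W W'] (c : X ⊗ W ⟶ 𝟙_ C) :
    ∃! a : X ⟶ W', a ▷ W ≫ ε_ W W' = c := by
  have key (a : X ⟶ W') : (tensorRightHomEquiv X W W' (𝟙_ C)).symm (a ≫ (λ_ W').inv) =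
      a ▷ W ≫ ε_ W W' := by
    change (a ≫ (λ_ W').inv) ▷ W ≫ (α_ _ _ _).hom ≫ 𝟙_ C ◁ ε_ W W' ≫ (ρ_ _).hom = _
    monoidal
  refine ⟨(tensorRightHomEquiv X W W' (𝟙_ C)) c ≫ (λ_ W').hom, ?_, fun a ha => ?_⟩
  · change _ ▷ W ≫ _ = c
    rw [← key]
    simp
  · rw [← ha, ← key]
    simp

end Monoidal

variable {C : Type u₁} [Category.{v₁} C] [MonoidalCategory C] [RightRigidCategory C]

lemma dualMap_comp_evDual {V W : C} (f : V ⟶ W) :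
    dualMap f ▷ V ≫ evDual V = dualObj W ◁ f ≫ evDual W :=
  rightAdjointMate_comp_evaluation f

/-- Dinaturality of the evaluation, in the form that moves a morphism from the second argument of a
pairing to the first. -/
lemma dualMap_evDual {X Y V W : C} (a : X ⟶ dualObj W) (b : Y ⟶ V) (f : V ⟶ W) :
    a ▷ Y ≫ dualObj W ◁ (b ≫ f) ≫ evDual W =
      (a ≫ dualMap f) ▷ Y ≫ dualObj V ◁ b ≫ evDual V := by
  rw [whiskerLeft_comp, Category.assoc, ← dualMap_comp_evDual, whisker_exchange_assoc, ← comp_whiskerRight_assoc]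

lemma dualTensor_evDual {X Y V W : C} (a : X ⟶ dualObj (V ⊗ W)) (b : Y ⟶ V ⊗ W) :
    a ▷ Y ≫ dualObj (V ⊗ W) ◁ b ≫ evDual (V ⊗ W) =
      (a ≫ (dualTensor V W).hom) ▷ Y ≫ (dualObj W ⊗ dualObj V) ◁ b ≫
        ε_ (V ⊗ W) (dualObj W ⊗ dualObj V) := by
  have h : (dualTensor V W).hom ▷ (V ⊗ W) ≫ ε_ (V ⊗ W) (dualObj W ⊗ dualObj V) =
    evDual (V ⊗ W) := rightDualIso_comp_evaluation HasRightDual.exact ExactPairing.tensor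
  rw [← h, whisker_exchange_assoc, ← comp_whiskerRight_assoc]

/-- A nondegenerate pairing `X ⊗ Y ⟶ 𝟙` of morphisms `X ⊙ₗ n ⟶ m` and `Y ⊙ₗ m ⟶ n` of a
module category over a pivotal category, with the properties of a trace of the composition. -/
structure ModulePairing (p : PivotalStructure C) (M : Type u₂) [Category.{v₂} M]
    [MonoidalLeftAction C M] where
  pair {X Y : C} {m n : M} (f : X ⊙ₗ n ⟶ m) (g : Y ⊙ₗ m ⟶ n) : X ⊗ Y ⟶ 𝟙_ C
  comp_right {X Y Y' : C} {m n : M} (y : Y' ⟶ Y) (f : X ⊙ₗ n ⟶ m) (g : Y ⊙ₗ m ⟶ n) :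
    pair f (y ⊵ₗ m ≫ g) = X ◁ y ≫ pair f g
  slide_right {X Y : C} {m n n' : M} (h : n ⟶ n') (f : X ⊙ₗ n' ⟶ m) (g : Y ⊙ₗ m ⟶ n) :
    pair (X ⊴ₗ h ≫ f) g = pair f (g ≫ h)
  slide_left {X Y : C} {m m' n : M} (h : m ⟶ m') (f : X ⊙ₗ n ⟶ m) (g : Y ⊙ₗ m' ⟶ n) :
    pair (f ≫ h) g = pair f (Y ⊴ₗ h ≫ g)
  -- The pairing depends only on the composite of f with X ⊙ g: the object X may be absorbed into
  -- the module argument, which reduces statements about f to the case X = 𝟙.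
  unit_pair {X Y : C} {m n : M} (f : X ⊙ₗ n ⟶ m) (g : Y ⊙ₗ m ⟶ n) :
    pair ((λₗ (X ⊙ₗ n)).hom ≫ f) ((αₗ X Y m).hom ≫ X ⊴ₗ g) = (λ_ _).hom ≫ pair f g
  -- Cyclicity of the trace. This is the only property that involves the pivotal structure of C.
  rotate_pair {X Y Z : C} {m n : M} (f : X ⊙ₗ n ⟶ m) (g : Y ⊙ₗ (Z ⊙ₗ m) ⟶ n) :
    pair ((αₗ Z X n).hom ≫ Z ⊴ₗ f) g = rotate (dualObj Z) (p.iso Z).hom (pair f ((αₗ Y Z m).hom ≫ g))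
  ext {X : C} {m n : M} {f f' : X ⊙ₗ n ⟶ m}
    (h : ∀ (Y : C) (g : Y ⊙ₗ m ⟶ n), pair f g = pair f' g) : f = f'
  exists_pair {X : C} {m n : M} (t : ∀ {Y : C}, (Y ⊙ₗ m ⟶ n) → (X ⊗ Y ⟶ 𝟙_ C))
    (ht : ∀ {Y Y' : C} (y : Y' ⟶ Y) (g : Y ⊙ₗ m ⟶ n), t (y ⊵ₗ m ≫ g) = X ◁ y ≫ t g) :
    ∃ f : X ⊙ₗ n ⟶ m, ∀ (Y : C) (g : Y ⊙ₗ m ⟶ n), pair f g = t g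

/-! ### The pairing defined by a module pivotal structure -/

namespace ModulePivotalStructure

variable {p : PivotalStructure C} {M : Type u₂} [Category.{v₂} M] [MonoidalLeftAction C M]
  {H : InternalHom C M} {S : RelativeSerreFunctor H} {T : S.TwistedStructure}
  (pM : ModulePivotalStructure p T)

/-- The components of the isomorphism from the identity functor to the relative Serre functor. -/
def serreIso (m : M) : m ≅ S.functor.obj m := pM.iso.app m

lemma serreIso_naturality {m m' : M} (h : m ⟶ m') :
    h ≫ (pM.serreIso m').hom = (pM.serreIso m).hom ≫ S.functor.map h :=
  pM.iso.hom.naturality h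

lemma serreIso_action (X : C) (m : M) :
    (pM.serreIso (X ⊙ₗ m)).hom =
      X ⊴ₗ (pM.serreIso m).hom ≫ (p.iso X).hom ⊵ₗ S.functor.obj m ≫ (T.ξ X m).hom := by
  rw [← actionHom_def'_assoc]
  exact pM.comm X m

/-- The isomorphism `iHom(n, m) ≅ iHom(m, n)^*` of a pivotal module category. -/
def homDual (m n : M) : H.hom n m ≅ dualObj (H.hom m n) :=
  (H.functor n).mapIso (pM.serreIso m) ≪≫ (S.φ m n).symm

lemma homDual_hom (m n : M) :
    (pM.homDual m n).hom = H.post n (pM.serreIso m).hom ≫ (S.φ m n).inv := rfl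

@[simp]
lemma homDual_φ (m n : M) :
    (pM.homDual m n).hom ≫ (S.φ m n).hom = H.post n (pM.serreIso m).hom := by
  simp [homDual_hom]

lemma homDual_inv (m n : M) :
    (pM.homDual m n).inv = (S.φ m n).hom ≫ H.post n (pM.serreIso m).inv := rfl

lemma pre_homDual (m : M) {n n' : M} (h : n ⟶ n') :
    H.pre h m ≫ (pM.homDual m n).hom = (pM.homDual m n').hom ≫ dualMap (H.post m h) := by
  rw [← cancel_mono (S.φ m n).hom, Category.assoc, Category.assoc, homDual_φ,
    S.φ_naturality_right, reassoc_of% @homDual_φ, InternalHom.pre_post]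

lemma post_homDual {m m' : M} (h : m ⟶ m') (n : M) :
    H.post n h ≫ (pM.homDual m' n).hom = (pM.homDual m n).hom ≫ dualMap (H.pre h n) := by
  rw [← cancel_mono (S.φ m' n).hom, Category.assoc, Category.assoc, homDual_φ,
    S.φ_naturality_left, reassoc_of% @homDual_φ, ← InternalHom.post_comp, ← InternalHom.post_comp,
    serreIso_naturality]

/-- The property `φ_right` carried through the isomorphism id ≅ S, which commutes with `rightStr`.
Since `φ_right` concerns the inverse direction, the inverse of `homDual` is computed first;
invertibility of `leftStr` allows cancellation. -/
lemma rightStr_homDual (X : C) (m n : M) :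
    H.rightStr n m X ≫ (pM.homDual m (X ⊙ₗ n)).hom ≫ dualMap (H.leftStr X m n) ≫
      (dualTensor X (H.hom m n)).hom = (pM.homDual m n).hom ▷ dualObj X := by
  have h := T.φ_right X m n
  have e : IsIso (dualMap (H.leftStr X m n)) :=
    ⟨dualMap (inv (H.leftStr X m n)), by simp [← comp_rightAdjointMate],
      by simp [← comp_rightAdjointMate]⟩
  have h2 : (dualMap (H.leftStr X m n) ≫ (dualTensor X (H.hom m n)).hom ≫
      (pM.homDual m n).inv ▷ dualObj X) ≫ H.rightStr n m X = (pM.homDual m (X ⊙ₗ n)).inv := by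
    rw [homDual_inv, homDual_inv, ← h, comp_whiskerRight]
    simp only [Category.assoc]
    rw [InternalHom.rightStr_post]
  rw [← cancel_epi (dualMap (H.leftStr X m n) ≫ (dualTensor X (H.hom m n)).hom ≫
      (pM.homDual m n).inv ▷ dualObj X), ← Category.assoc (_ ≫ _), h2, Iso.inv_hom_id_assoc]
  simp

/-- In `φ_left` the twisted structure `ξ` appears, and it appears again when the isomorphism id ≅ S
is evaluated at Z ⊙ m. The two occurrences cancel, and the pivotal isomorphism of Z is what remains.
-/
lemma leftStr_homDual (Z : C) (m n : M) :
    H.leftStr Z n m ≫ (pM.homDual (Z ⊙ₗ m) n).hom ≫ dualMap (H.rightStr m n Z) ≫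
      (dualTensor (H.hom m n) (dualObj Z)).hom =
    Z ◁ (pM.homDual m n).hom ≫ (p.iso Z).hom ▷ _ := by
  rw [← cancel_mono (dualObj (dualObj Z) ◁ (S.φ m n).hom), ← cancel_mono
    (H.leftStr (dualObj (dualObj Z)) n (S.functor.obj m)), ← cancel_mono (H.post n (T.ξ Z m).hom)]
  have h := T.φ_left Z m n
  simp only [Category.assoc]
  rw [h, homDual_hom, homDual_hom]
  simp only [Category.assoc, Iso.inv_hom_id, Category.comp_id]
  rw [serreIso_action, InternalHom.post_comp, InternalHom.post_comp,
    reassoc_of% @InternalHom.leftStr_post, reassoc_of% @InternalHom.leftStr_post_left,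
    ← whisker_exchange_assoc, ← homDual_hom, ← homDual_φ, MonoidalCategory.whiskerLeft_comp,
    Category.assoc]

/-- The pairing of a pivotal module category. -/
def pairing : ModulePairing p M where
  pair {X Y m n} f g := (H.curry f ≫ (pM.homDual m n).hom) ▷ Y ≫ _ ◁ H.curry g ≫ evDual _
  comp_right y f g := by
    rw [← InternalHom.comp_curry, whisker_exchange_assoc]
    simp
  slide_right h f g := by
    rw [← InternalHom.curry_pre, Category.assoc, pre_homDual, ← InternalHom.curry_post]
    rw [dualMap_evDual, Category.assoc]
  slide_left h f g := by
    rw [← InternalHom.curry_post, Category.assoc, post_homDual, ← InternalHom.curry_pre]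
    rw [dualMap_evDual, Category.assoc]
  -- The second argument contributes a `leftStr`. Moved across the evaluation it absorbs the
  -- `rightStr` of the first argument, and an identity of evaluations in C is left.
  unit_pair {X Y m n} f g := by
    rw [← InternalHom.curry_leftStr, ← InternalHom.curry_eq_rightStr H X,
      ← leftUnitor_actionHom_assoc, ← InternalHom.comp_curry, dualMap_evDual, dualTensor_evDual]
    simp only [Category.assoc]
    rw [rightStr_homDual, ← comp_whiskerRight, Category.assoc]
    exact coevaluation_tensor_evaluation _ _
  rotate_pair {X Y Z m n} f g := by
    have e : H.curry g = ((ρ_ Y).inv ≫ Y ◁ coevDual Z ≫ (α_ Y Z (dualObj Z)).inv ≫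
        H.curry ((αₗ Y Z m).hom ≫ g) ▷ dualObj Z) ≫ H.rightStr m n Z := by
      simp only [Category.assoc]
      exact (InternalHom.curry_eq_rightStr H Z g).symm
    rw [← InternalHom.curry_leftStr, e, dualMap_evDual, dualTensor_evDual]
    simp only [Category.assoc]
    rw [leftStr_homDual, ← whiskerLeft_comp_assoc]
    exact tensor_evaluation_eq_rotate _ _ _
  ext {X m n f f'} h := by
    -- The universal g is the evaluation of iHom(m, n): pairing with it is the evaluation of a dual
    -- object.
    have h1 := h _ (H.ev m n)
    simp only [InternalHom.curry_ev, whiskerLeft_id, Category.id_comp] at h1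
    have h2 := (exists_unique_evaluation _).unique h1 rfl
    exact H.curry_injective ((cancel_mono _).1 h2)
  exists_pair {X m n} t ht := by
    -- By naturality `t` is determined by its value at the universal g, and that value is
    -- represented by a morphism into iHom(m, n)^*.
    obtain ⟨a, ha, -⟩ := exists_unique_evaluation (t (H.ev m n)) (W' := dualObj (H.hom m n))
    obtain ⟨f, hf⟩ := H.exists_curry (a ≫ (pM.homDual m n).inv)
    refine ⟨f, fun Y g => ?_⟩
    rw [← hf, Category.assoc, Iso.inv_hom_id, Category.comp_id, ← whisker_exchange_assoc, ha, ← ht,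
      InternalHom.curry_action_ev]

end ModulePivotalStructure

namespace DualCategory

variable {k : Type w} [Field k] {C : Type u₁} [Category.{v₁} C]
  [MonoidalCategory C] {M : Type u₂} [Category.{v₂} M] [Preadditive M] [Linear k M]
  [MonoidalLeftAction C M]

/-! ### Exact pairings in the dual category as adjunctions -/

lemma natTrans_naturality {F G : DualCategory k C M} (f : F ⟶ G) {m n : M} (h : m ⟶ n) :
    F.toFunctor.map h ≫ f.natTrans.app n = f.natTrans.app m ≫ G.toFunctor.map h :=
  f.natTrans.naturality h

lemma hom_comp_app {F G K : DualCategory k C M} (f : F ⟶ G) (g : G ⟶ K) (m : M) :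
    (f ≫ g).natTrans.app m = f.natTrans.app m ≫ g.natTrans.app m := rfl

section Mate

variable (F F' : DualCategory k C M) [ExactPairing F F']

/-- The unit of the adjunction between the functors of an exact pairing. -/
def pairUnit (m : M) : m ⟶ F'.toFunctor.obj (F.toFunctor.obj m) := (η_ F F').natTrans.app m

/-- The counit of the adjunction between the functors of an exact pairing. -/
def pairCounit (m : M) : F.toFunctor.obj (F'.toFunctor.obj m) ⟶ m := (ε_ F F').natTrans.app m

lemma pairUnit_naturality {m n : M} (h : m ⟶ n) :
    h ≫ pairUnit F F' n = pairUnit F F' m ≫ F'.toFunctor.map (F.toFunctor.map h) :=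
  (η_ F F').natTrans.naturality h

lemma pairCounit_naturality {m n : M} (h : m ⟶ n) :
    F.toFunctor.map (F'.toFunctor.map h) ≫ pairCounit F F' n = pairCounit F F' m ≫ h :=
  (ε_ F F').natTrans.naturality h

lemma pairUnit_action (X : C) (m : M) :
    X ⊴ₗ pairUnit F F' m ≫ μₗ F'.toFunctor X (F.toFunctor.obj m) ≫
      F'.toFunctor.map (μₗ F.toFunctor X m) = pairUnit F F' (X ⊙ₗ m) :=
  ((η_ F F').comm X m).trans (Category.id_comp _)

lemma pairCounit_action (X : C) (m : M) :
    μₗ F.toFunctor X (F'.toFunctor.obj m) ≫ F.toFunctor.map (μₗ F'.toFunctor X m) ≫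
      pairCounit F F' (X ⊙ₗ m) = X ⊴ₗ pairCounit F F' m :=
  (Category.assoc _ _ _).symm.trans
    (((ε_ F F').comm X m).symm.trans (Category.comp_id _))

@[simp]
lemma pairUnit_pairCounit (m : M) :
    F.toFunctor.map (pairUnit F F' m) ≫ pairCounit F F' (F.toFunctor.obj m) = 𝟙 _ := by
  have h := congrArg (fun t => t.natTrans.app m) (ExactPairing.evaluation_coevaluation F F')
  have h' : F.toFunctor.map (pairUnit F F' m) ≫ 𝟙 _ ≫ pairCounit F F' (F.toFunctor.obj m) =
    𝟙 _ ≫ 𝟙 _ := h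
  simpa using h'

@[simp]
lemma pairUnit_pairCounit' (m : M) :
    pairUnit F F' (F'.toFunctor.obj m) ≫ F'.toFunctor.map (pairCounit F F' m) = 𝟙 _ := by
  have h := congrArg (fun t => t.natTrans.app m) (ExactPairing.coevaluation_evaluation F F')
  have h' : pairUnit F F' (F'.toFunctor.obj m) ≫ 𝟙 _ ≫ F'.toFunctor.map (pairCounit F F' m) =
    𝟙 _ ≫ 𝟙 _ := h
  simpa using h'

/-- The morphism `Y ⊙ₗ F m ⟶ n` corresponding to `Y ⊙ₗ m ⟶ F' n`. -/
def mate {Y : C} {m n : M} (y : Y ⊙ₗ m ⟶ F'.toFunctor.obj n) : Y ⊙ₗ F.toFunctor.obj m ⟶ n :=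
  μₗ F.toFunctor Y m ≫ F.toFunctor.map y ≫ pairCounit F F' n

/-- The morphism `Y ⊙ₗ m ⟶ F' n` corresponding to `Y ⊙ₗ F m ⟶ n`. -/
def comate {Y : C} {m n : M} (z : Y ⊙ₗ F.toFunctor.obj m ⟶ n) : Y ⊙ₗ m ⟶ F'.toFunctor.obj n :=
  Y ⊴ₗ pairUnit F F' m ≫ μₗ F'.toFunctor Y (F.toFunctor.obj m) ≫ F'.toFunctor.map z

-- The C-linearity of the counit removes both structure morphisms, and the triangle identity for F
-- finishes.
@[simp]
lemma mate_comate {Y : C} {m n : M} (z : Y ⊙ₗ F.toFunctor.obj m ⟶ n) :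
    mate F F' (comate F F' z) = z := by
  simp only [mate, comate, Functor.map_comp, Category.assoc]
  rw [pairCounit_naturality, ← μₗ_naturality_right_assoc, reassoc_of% @pairCounit_action,
    ← actionHomRight_comp_assoc, pairUnit_pairCounit, actionHomRight_id, Category.id_comp]

@[simp]
lemma comate_mate {Y : C} {m n : M} (y : Y ⊙ₗ m ⟶ F'.toFunctor.obj n) :
    comate F F' (mate F F' y) = y := by
  simp only [mate, comate, Functor.map_comp]
  rw [reassoc_of% @pairUnit_action, ← reassoc_of% @pairUnit_naturality, pairUnit_pairCounit', Category.comp_id]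

variable {F F'} in
lemma mate_injective {Y : C} {m n : M} {y y' : Y ⊙ₗ m ⟶ F'.toFunctor.obj n}
    (h : mate F F' y = mate F F' y') : y = y' := by
  rw [← comate_mate F F' y, h, comate_mate]

lemma mate_comp_left {X Y : C} (x : X ⟶ Y) {m n : M} (y : Y ⊙ₗ m ⟶ F'.toFunctor.obj n) :
    mate F F' (x ⊵ₗ m ≫ y) = x ⊵ₗ F.toFunctor.obj m ≫ mate F F' y := by
  simp only [mate, Functor.map_comp, Category.assoc, μₗ_naturality_left_assoc]

variable {F F'} in
lemma comate_comp_left {X Y : C} (x : X ⟶ Y) {m n : M} (z : Y ⊙ₗ F.toFunctor.obj m ⟶ n) :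
    comate F F' (x ⊵ₗ F.toFunctor.obj m ≫ z) = x ⊵ₗ m ≫ comate F F' z :=
  mate_injective (F := F) (by rw [mate_comp_left, mate_comate, mate_comate])

lemma mate_comp_right {Y : C} {m m' n : M} (h : m ⟶ m') (y : Y ⊙ₗ m' ⟶ F'.toFunctor.obj n) :
    mate F F' (Y ⊴ₗ h ≫ y) = Y ⊴ₗ F.toFunctor.map h ≫ mate F F' y := by
  simp only [mate, Functor.map_comp, Category.assoc, μₗ_naturality_right_assoc]

lemma mate_map {Y : C} {m n n' : M} (h : n ⟶ n') (y : Y ⊙ₗ m ⟶ F'.toFunctor.obj n) :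
    mate F F' (y ≫ F'.toFunctor.map h) = mate F F' y ≫ h := by
  simp only [mate, Functor.map_comp, Category.assoc, pairCounit_naturality]

lemma mate_assoc {X Y : C} {m n : M} (y : X ⊙ₗ (Y ⊙ₗ m) ⟶ F'.toFunctor.obj n) :
    mate F F' ((αₗ X Y m).hom ≫ y) =
      (αₗ X Y _).hom ≫ X ⊴ₗ μₗ F.toFunctor Y m ≫ mate F F' y := by
  simp only [mate, Functor.map_comp, Category.assoc, μₗ_associativity_assoc]

/-- Compares the mate for Y acting on m with the mate for 𝟙 acting on Y ⊙ m, as needed when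
`unit_pair` absorbs an acting object. -/
lemma mate_unit {Y : C} {m n : M} (y : Y ⊙ₗ m ⟶ F'.toFunctor.obj n) :
    𝟙_ C ⊴ₗ μₗ F.toFunctor Y m ≫ mate F F' ((λₗ (Y ⊙ₗ m)).hom ≫ y) =
      (λₗ (Y ⊙ₗ F.toFunctor.obj m)).hom ≫ mate F F' y := by
  simp only [mate, Functor.map_comp, Category.assoc]
  rw [← μₗ_unitality_assoc, ← actionUnitIso_hom_naturality_assoc]

lemma mate_action (Z : C) {Y : C} {m n : M} (y : Y ⊙ₗ m ⟶ F'.toFunctor.obj n) :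
    mate F F' ((αₗ Z Y m).hom ≫ Z ⊴ₗ y ≫ μₗ F'.toFunctor Z n) =
      (αₗ Z Y _).hom ≫ Z ⊴ₗ mate F F' y := by
  rw [mate_assoc]
  simp only [mate, Functor.map_comp, Category.assoc, actionHomRight_comp]
  rw [← pairCounit_action, ← μₗ_naturality_right_assoc]

-- The hypothesis `h` says that `a'` is the mate of `a`. It covers dual morphisms and comparisons
-- between two choices of a dual at once.
variable {F F'} in
lemma mate_naturality {G G' : DualCategory k C M} [ExactPairing G G'] (a : F ⟶ G) (a' : G' ⟶ F')
    (h : a' ▷ F ≫ ε_ F F' = G' ◁ a ≫ ε_ G G') {Y : C} {m n : M}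
    (y : Y ⊙ₗ m ⟶ G'.toFunctor.obj n) :
    mate F F' (y ≫ a'.natTrans.app n) = Y ⊴ₗ a.natTrans.app m ≫ mate G G' y := by
  have h' : F.toFunctor.map (a'.natTrans.app n) ≫ pairCounit F F' n =
    a.natTrans.app (G'.toFunctor.obj n) ≫ pairCounit G G' n :=
    congrArg (fun t => t.natTrans.app n) h
  simp only [mate, Functor.map_comp, Category.assoc]
  rw [h', reassoc_of% a.comm, reassoc_of% @natTrans_naturality]

end Mate

lemma mate_tensorUnit {Y : C} {m n : M} (y : Y ⊙ₗ m ⟶ n) :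
    mate (𝟙_ (DualCategory k C M)) (𝟙_ (DualCategory k C M)) (m := m) (n := n) y = y := by
  change 𝟙 _ ≫ y ≫ 𝟙 _ = y
  simp

/-- The tensor product is composition in reverse order, so the evaluation of F ⊗ G nests that of F
inside G; the remaining structure morphisms are identities. -/
lemma pairCounit_tensor (F F' G G' : DualCategory k C M) [ExactPairing F F'] [ExactPairing G G']
    (n : M) : pairCounit (F ⊗ G) (G' ⊗ F') n =
      G.toFunctor.map (pairCounit F F' (G'.toFunctor.obj n)) ≫ pairCounit G G' n := by
  have h : pairCounit (F ⊗ G) (G' ⊗ F') n = 𝟙 _ ≫ 𝟙 _ ≫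
      G.toFunctor.map (pairCounit F F' (G'.toFunctor.obj n)) ≫ 𝟙 _ ≫ pairCounit G G' n := by
    refine (congrArg (fun t => t.natTrans.app n) (tensor_evaluation_eq F F' G G')).trans ?_
    rfl
  simpa using h

lemma mate_tensor (F F' G G' : DualCategory k C M) [ExactPairing F F'] [ExactPairing G G']
    {Y : C} {m n : M} (y : Y ⊙ₗ m ⟶ F'.toFunctor.obj (G'.toFunctor.obj n)) :
    mate (F ⊗ G) (G' ⊗ F') (m := m) (n := n) y = mate G G' (mate F F' y) := by
  refine (congrArg (fun t => _ ≫ _ ≫ t) (pairCounit_tensor F F' G G' n)).trans ?_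
  change (μₗ G.toFunctor Y _ ≫ G.toFunctor.map (μₗ F.toFunctor Y m)) ≫
    G.toFunctor.map (F.toFunctor.map y) ≫ G.toFunctor.map _ ≫ _ = _
  simp only [mate, Functor.map_comp, Category.assoc]

section InternalAdjunction

variable [RightRigidCategory (DualCategory k C M)] (F : DualCategory k C M) {H : InternalHom C M}

/-- Under `curry` the internal adjunction becomes the ordinary bijection `mate`, through which the
Serre comparison is later computed. -/
lemma curry_iHomAdjInv {X : C} {m n : M} (y : X ⊙ₗ m ⟶ (dualObj F).toFunctor.obj n) :
    H.curry y ≫ F.iHomAdjInv H m n = H.curry (mate F (dualObj F) y) := by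
  rw [iHomAdjInv, reassoc_of% @InternalHom.curry_mapFunctor, InternalHom.curry_post, Category.assoc]
  rfl

lemma curry_iHomAdj {X : C} {m n : M} (z : X ⊙ₗ F.toFunctor.obj m ⟶ n) :
    H.curry z ≫ F.iHomAdj H m n = H.curry (comate F (dualObj F) z) := by
  rw [iHomAdj, reassoc_of% @InternalHom.curry_mapFunctor, InternalHom.curry_pre]
  rfl

end InternalAdjunction

/-! ### The isomorphism to the double dual -/

variable [RightRigidCategory C] {p : PivotalStructure C} (P : ModulePairing p M)

/-- The defining property of the isomorphism from `F` to its double dual. -/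
def IsDoubleDual (F F' F'' : DualCategory k C M) [ExactPairing F F'] [ExactPairing F' F'']
    (q : F ⟶ F'') : Prop :=
  ∀ ⦃X Y : C⦄ ⦃m n : M⦄ (f : X ⊙ₗ n ⟶ F.toFunctor.obj m) (y : Y ⊙ₗ m ⟶ F'.toFunctor.obj n),
    P.pair f (mate F F' y) = P.pair (mate F' F'' (f ≫ q.natTrans.app m)) y

variable {F F' F'' : DualCategory k C M} [ExactPairing F F'] [ExactPairing F' F'']

/-- The uniqueness principle behind all later identities: the pairing is nondegenerate and `mate` is
injective. -/
lemma eq_of_pair_mate {X : C} {m n : M} {z z' : X ⊙ₗ n ⟶ F''.toFunctor.obj m}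
    (h : ∀ (Y : C) (y : Y ⊙ₗ m ⟶ F'.toFunctor.obj n),
      P.pair (mate F' F'' z) y = P.pair (mate F' F'' z') y) : z = z' :=
  mate_injective (P.ext h)

/-- The functional y ↦ ⟨f, mate y⟩ is natural in Y, hence represented by nondegeneracy. -/
lemma exists_pair_mate {X : C} {m n : M} (f : X ⊙ₗ n ⟶ F.toFunctor.obj m) :
    ∃ z : X ⊙ₗ n ⟶ F''.toFunctor.obj m, ∀ (Y : C) (y : Y ⊙ₗ m ⟶ F'.toFunctor.obj n),
      P.pair f (mate F F' y) = P.pair (mate F' F'' z) y := by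
  obtain ⟨z, hz⟩ := P.exists_pair (n := F'.toFunctor.obj n) (m := m) (X := X)
    (fun y => P.pair f (mate F F' y))
    (fun y g => by rw [mate_comp_left, P.comp_right])
  exact ⟨comate F' F'' z, fun Y y => by rw [mate_comate, hz]⟩

lemma exists_mate_pair {X : C} {m n : M} (z : X ⊙ₗ n ⟶ F''.toFunctor.obj m) :
    ∃ f : X ⊙ₗ n ⟶ F.toFunctor.obj m, ∀ (Y : C) (y : Y ⊙ₗ m ⟶ F'.toFunctor.obj n),
      P.pair f (mate F F' y) = P.pair (mate F' F'' z) y := by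
  obtain ⟨f, hf⟩ := P.exists_pair (n := n) (m := F.toFunctor.obj m) (X := X)
    (fun y => P.pair (mate F' F'' z) (comate F F' y))
    (fun y g => by rw [comate_comp_left, P.comp_right])
  exact ⟨f, fun Y y => by rw [hf, comate_mate]⟩

variable (F F' F'')

/-- The components of the isomorphism from `F` to its double dual. -/
def doubleDualApp (m : M) : F.toFunctor.obj m ⟶ F''.toFunctor.obj m :=
  -- The representing morphism is taken for the unitor 𝟙 ⊙ F m ⟶ F m, which plays the role of the
  -- identity of F m.
  (λₗ[C] _).inv ≫ (exists_pair_mate P (F' := F') (F'' := F'') (λₗ[C] (F.toFunctor.obj m)).hom).choose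

variable {F F' F''}

lemma unit_doubleDualApp (m : M) {Y : C} (y : Y ⊙ₗ m ⟶ F'.toFunctor.obj (F.toFunctor.obj m)) :
    P.pair (λₗ[C] (F.toFunctor.obj m)).hom (mate F F' y) =
      P.pair (mate F' F'' ((λₗ[C] _).hom ≫ doubleDualApp P F F' F'' m)) y := by
  rw [doubleDualApp, Iso.hom_inv_id_assoc]
  exact (exists_pair_mate P (F' := F') (F'' := F'') (λₗ[C] (F.toFunctor.obj m)).hom).choose_spec Y y

/-- A morphism f of M slides to the other argument, where the defining case applies, and then slides
back. -/
lemma unit_comp_doubleDualApp {m n : M} (f : n ⟶ F.toFunctor.obj m) {Y : C}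
    (y : Y ⊙ₗ m ⟶ F'.toFunctor.obj n) :
    P.pair ((λₗ[C] n).hom ≫ f) (mate F F' y) =
      P.pair (mate F' F'' ((λₗ[C] n).hom ≫ f ≫ doubleDualApp P F F' F'' m)) y := by
  rw [actionUnitIso_hom_naturality, P.slide_right, ← mate_map,
    unit_doubleDualApp (F'' := F''), ← P.slide_right, ← mate_comp_right,
    ← actionUnitIso_hom_naturality_assoc]

/-- By `unit_pair` the object X is absorbed into the module argument, and f becomes a plain morphism
of M, to which the preceding case applies. -/
lemma pair_doubleDualApp {X Y : C} {m n : M} (f : X ⊙ₗ n ⟶ F.toFunctor.obj m)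
    (y : Y ⊙ₗ m ⟶ F'.toFunctor.obj n) :
    P.pair f (mate F F' y) = P.pair (mate F' F'' (f ≫ doubleDualApp P F F' F'' m)) y := by
  rw [← cancel_epi (λ_ (X ⊗ Y)).hom, ← P.unit_pair, ← P.unit_pair, ← mate_action,
    unit_comp_doubleDualApp (F'' := F''), ← mate_unit, P.slide_right, Category.assoc]

lemma doubleDualApp_naturality {m m' : M} (h : m ⟶ m') :
    F.toFunctor.map h ≫ doubleDualApp P F F' F'' m' =
      doubleDualApp P F F' F'' m ≫ F''.toFunctor.map h := by
  rw [← cancel_epi (λₗ[C] _).hom]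
  apply eq_of_pair_mate P (F' := F')
  intro Y y
  rw [← Category.assoc, ← pair_doubleDualApp, P.slide_left, ← mate_comp_right,
    pair_doubleDualApp (F'' := F''), ← P.slide_left, ← mate_map, Category.assoc]

/-- Rotation takes X off the first argument, adjointness passes from F to its double dual, and the
reverse rotation restores X. The two rotations involve the same pivotal isomorphism of X, so it
drops out. -/
lemma doubleDualApp_action (X : C) (m : M) :
    X ⊴ₗ doubleDualApp P F F' F'' m ≫ μₗ F''.toFunctor X m =
      μₗ F.toFunctor X m ≫ doubleDualApp P F F' F'' (X ⊙ₗ m) := by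
  rw [← cancel_epi (X ⊴ₗ (λₗ[C] _).hom), ← cancel_epi (αₗ X (𝟙_ C) _).hom]
  apply eq_of_pair_mate P (F' := F')
  intro Y y
  have h : (αₗ X (𝟙_ C) _).hom ≫ X ⊴ₗ (λₗ[C] _).hom ≫ μₗ F.toFunctor X m ≫
      doubleDualApp P F F' F'' (X ⊙ₗ m) = (((αₗ X (𝟙_ C) _).hom ≫ X ⊴ₗ (λₗ[C] _).hom) ≫
      μₗ F.toFunctor X m) ≫ doubleDualApp P F F' F'' (X ⊙ₗ m) := by
    simp only [Category.assoc]
  rw [h, ← pair_doubleDualApp, P.slide_left, P.rotate_pair, ← mate_assoc,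
    pair_doubleDualApp (F'' := F''), ← P.rotate_pair, ← mate_action, actionHomRight_comp_assoc]

instance isIso_doubleDualApp (m : M) : IsIso (doubleDualApp P F F' F'' m) := by
  -- Representability in the opposite direction lets every morphism into F'' m factor, so a section
  -- exists; `ext` makes the component monic.
  have h1 (n : M) (z : n ⟶ F''.toFunctor.obj m) :
      ∃ f : n ⟶ F.toFunctor.obj m, f ≫ doubleDualApp P F F' F'' m = z := by
    obtain ⟨f, hf⟩ := exists_mate_pair P (F := F) (F' := F') ((λₗ[C] n).hom ≫ z)
    refine ⟨(λₗ[C] n).inv ≫ f, ?_⟩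
    rw [← cancel_epi (λₗ[C] n).hom, Category.assoc, Iso.hom_inv_id_assoc]
    apply eq_of_pair_mate P (F' := F')
    intro Y y
    rw [← pair_doubleDualApp, hf]
  have h2 : Mono (doubleDualApp P F F' F'' m) := ⟨fun {n} f f' h => by
    rw [← cancel_epi (λₗ[C] n).hom]
    refine P.ext fun Y g => ?_
    rw [← mate_comate F F' g, pair_doubleDualApp (F'' := F''), pair_doubleDualApp (F'' := F''),
      Category.assoc, Category.assoc, h]⟩
  obtain ⟨s, hs⟩ := h1 _ (𝟙 _)
  exact ⟨s, by rw [← cancel_mono (doubleDualApp P F F' F'' m), Category.assoc, hs]; simp, hs⟩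

variable (F F' F'')

/-- The canonical isomorphism from `F` to its double dual. -/
def doubleDualIso : F ≅ F'' :=
  mkIso (NatIso.ofComponents (fun m => asIso (doubleDualApp P F F' F'' m))
    (doubleDualApp_naturality P)) (doubleDualApp_action P)

lemma isDoubleDual_doubleDualIso :
    IsDoubleDual P F F' F'' (doubleDualIso P F F' F'').hom :=
  fun _ _ _ _ f y => pair_doubleDualApp P f y

variable {F F' F''}

/-- Both composites have the same pairing with every y. For `a` = 𝟙 the statement compares two
choices of duals; monoidality and the unit axiom are obtained that way. -/
lemma IsDoubleDual.naturality {G G' G'' : DualCategory k C M} [ExactPairing G G']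
    [ExactPairing G' G''] {q : F ⟶ F''} {r : G ⟶ G''} (hq : IsDoubleDual P F F' F'' q)
    (hr : IsDoubleDual P G G' G'' r) (a : F ⟶ G) (a' : G' ⟶ F') (a'' : F'' ⟶ G'')
    (h : a' ▷ F ≫ ε_ F F' = G' ◁ a ≫ ε_ G G')
    (h' : a'' ▷ G' ≫ ε_ G' G'' = F'' ◁ a' ≫ ε_ F' F'') : a ≫ r = q ≫ a'' := by
  refine hom_ext_app fun m => ?_
  rw [← cancel_epi (λₗ[C] _).hom]
  apply eq_of_pair_mate P (F' := G')
  intro Y y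
  rw [hom_comp_app, hom_comp_app, ← Category.assoc, ← hr, P.slide_left,
    ← mate_naturality a a' h, hq, ← P.slide_right, ← mate_naturality a' a'' h', Category.assoc]

lemma IsDoubleDual.tensor {G G' G'' : DualCategory k C M} [ExactPairing G G']
    [ExactPairing G' G''] {q : F ⟶ F''} {r : G ⟶ G''} (hq : IsDoubleDual P F F' F'' q)
    (hr : IsDoubleDual P G G' G'' r) :
    IsDoubleDual P (F ⊗ G) (G' ⊗ F') (F'' ⊗ G'') (q ⊗ₘ r) := by
  intro X Y m n f y
  have h1 := mate_tensor G' G'' F' F'' (m := n) (n := m) (f ≫ (q ⊗ₘ r).natTrans.app m)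
  -- Interchange puts r first, in the order in which the two mates are peeled off.
  have h2 : (q ⊗ₘ r).natTrans.app m =
      r.natTrans.app (F.toFunctor.obj m) ≫ G''.toFunctor.map (q.natTrans.app m) :=
    natTrans_naturality r (q.natTrans.app m)
  refine (congrArg (P.pair f) (mate_tensor F F' G G' (m := m) (n := n) y)).trans
    (Eq.trans ?_ (congrArg (fun t => P.pair t y) h1.symm))
  refine (hr f (mate F F' y)).trans ((hq _ y).trans (congrArg (fun t => P.pair t y) ?_))
  rw [← mate_map]
  refine congrArg (fun t => mate F' F'' (mate G' G'' t)) ?_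
  rw [h2]
  exact Category.assoc _ _ _

lemma isDoubleDual_id_unit : IsDoubleDual P (𝟙_ (DualCategory k C M)) (𝟙_ _) (𝟙_ _) (𝟙 _) := by
  intro X Y m n f y
  refine (congrArg (P.pair f) (mate_tensorUnit (k := k) (m := m) (n := n) y)).trans
    (congrArg (fun t => P.pair t y) ?_)
  refine Eq.trans ?_ (mate_tensorUnit (k := k) (m := n) (n := m) (f ≫ 𝟙 _)).symm
  exact (Category.comp_id _).symm

variable {P} in
lemma IsDoubleDual.unit {U' U'' : DualCategory k C M} [ExactPairing (𝟙_ _) U']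
    [ExactPairing U' U''] {q : 𝟙_ _ ⟶ U''} (hq : IsDoubleDual P (𝟙_ _) U' U'' q)
    (a : 𝟙_ _ ⟶ U') (b : U'' ⟶ 𝟙_ _) (h : a ▷ 𝟙_ _ ≫ ε_ (𝟙_ _) U' = ε_ (𝟙_ _) (𝟙_ _))
    (h' : b ▷ 𝟙_ _ ≫ ε_ (𝟙_ _) (𝟙_ _) = U'' ◁ a ≫ ε_ U' U'') : q ≫ b = 𝟙 _ :=
  (IsDoubleDual.naturality P hq (isDoubleDual_id_unit P) (𝟙 _) a b
    (by rw [h, MonoidalCategory.whiskerLeft_id, Category.id_comp]) h').symm.trans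
    (Category.id_comp _)

/-- The pivotal structure of the dual category. -/
def pivotalStructure [RightRigidCategory (DualCategory k C M)] :
    PivotalStructure (DualCategory k C M) where
  iso F := doubleDualIso P F (dualObj F) (dualObj (dualObj F))
  naturality {F G} f := IsDoubleDual.naturality P (isDoubleDual_doubleDualIso P _ _ _)
    (isDoubleDual_doubleDualIso P _ _ _) f (dualMap f) (dualMap (dualMap f))
    (rightAdjointMate_comp_evaluation f) (rightAdjointMate_comp_evaluation (dualMap f))
  tensor F G := by
    have h1 : (dualTensor F G).inv ▷ (F ⊗ G) ≫ ε_ (F ⊗ G) (dualObj (F ⊗ G)) =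
        ε_ (F ⊗ G) (dualObj G ⊗ dualObj F) :=
      rightDualIso_comp_evaluation ExactPairing.tensor HasRightDual.exact
    have h2 : (dualTensor (dualObj G) (dualObj F)).hom ▷ (dualObj G ⊗ dualObj F) ≫
        ε_ (dualObj G ⊗ dualObj F) (dualObj (dualObj F) ⊗ dualObj (dualObj G)) =
          ε_ (dualObj G ⊗ dualObj F) (dualObj (dualObj G ⊗ dualObj F)) :=
      rightDualIso_comp_evaluation HasRightDual.exact ExactPairing.tensor
    -- Both q_{F ⊗ G} and q_F ⊗ q_G have the double dual property, relative to different duals of F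
    -- ⊗ G.
    refine (IsDoubleDual.naturality P (isDoubleDual_doubleDualIso P _ _ _)
      (IsDoubleDual.tensor P (isDoubleDual_doubleDualIso P F _ _)
        (isDoubleDual_doubleDualIso P G _ _)) (𝟙 _) (dualTensor F G).inv (ddTensor F G)
      (by rw [h1, MonoidalCategory.whiskerLeft_id, Category.id_comp]) ?_).symm.trans
      (Category.id_comp _)
    rw [ddTensor, comp_whiskerRight, Category.assoc, h2]
    exact rightAdjointMate_comp_evaluation _
  unit := by
    -- The unit object has two duals here, the chosen one and itself; their evaluations have to be
    -- compared.
    have h1 : (dualUnit (DualCategory k C M)).inv ▷ 𝟙_ _ ≫ evDual (𝟙_ _) = ε_ (𝟙_ _) (𝟙_ _) :=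
      rightDualIso_comp_evaluation exactPairingUnit _
    have h2 : (dualUnit (DualCategory k C M)).hom ▷ 𝟙_ _ ≫ ε_ (𝟙_ _) (𝟙_ _) = evDual (𝟙_ _) :=
      rightDualIso_comp_evaluation _ exactPairingUnit
    refine @IsDoubleDual.unit _ _ _ _ _ _ _ _ _ _ _ _ P _ _ _ _ _
      (@isDoubleDual_doubleDualIso _ _ _ _ _ _ _ _ _ _ _ _ P _ _ _ _ _)
      (dualUnit _).inv (ddUnit _) h1 ?_
    rw [ddUnit, comp_whiskerRight, Category.assoc, h2]
    exact dualMap_comp_evDual _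

/-! ### Comparison with the relative Serre functor -/

section Serre

variable [RightRigidCategory (DualCategory k C M)] (F : DualCategory k C M)
  {H : InternalHom C M} {S : RelativeSerreFunctor H} {T : S.TwistedStructure}
  (pM : ModulePivotalStructure p T)

/-- The canonical isomorphism from `Ser ∘ F` to `F^** ∘ Ser`. -/
def serreComparison :
    F.toFunctor ⋙ S.functor ≅ S.functor ⋙ (dualObj (dualObj F)).toFunctor :=
  NatIso.ofComponents (fun m => (pM.serreIso (F.toFunctor.obj m)).symm ≪≫
    asIso (doubleDualApp pM.pairing F (dualObj F) (dualObj (dualObj F)) m) ≪≫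
    (dualObj (dualObj F)).toFunctor.mapIso (pM.serreIso m)) (fun {m m'} f => by
      change S.functor.map (F.toFunctor.map f) ≫ (pM.serreIso _).inv ≫ doubleDualApp _ _ _ _ _ ≫
        (dualObj (dualObj F)).toFunctor.map (pM.serreIso m').hom =
        ((pM.serreIso _).inv ≫ doubleDualApp _ _ _ _ _ ≫
          (dualObj (dualObj F)).toFunctor.map (pM.serreIso m).hom) ≫
        (dualObj (dualObj F)).toFunctor.map (S.functor.map f)
      rw [← cancel_epi (pM.serreIso _).hom, ← reassoc_of% (pM.serreIso_naturality), Iso.hom_inv_id_assoc,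
        reassoc_of% doubleDualApp_naturality]
      simp only [Category.assoc, Iso.hom_inv_id_assoc]
      rw [← Functor.map_comp, ← Functor.map_comp, pM.serreIso_naturality])

lemma serreComparison_hom_app (m : M) : (F.serreComparison pM).hom.app m =
    (pM.serreIso (F.toFunctor.obj m)).inv ≫
      doubleDualApp pM.pairing F (dualObj F) (dualObj (dualObj F)) m ≫
        (dualObj (dualObj F)).toFunctor.map (pM.serreIso m).hom := rfl

/-- This is `pair_doubleDualApp` at the universal y, translated from pairings to morphisms into a
dual by uniqueness in `exists_unique_evaluation`. -/
lemma curry_homDual_dualMap {X : C} {m n : M} (f : X ⊙ₗ n ⟶ F.toFunctor.obj m) :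
    H.curry f ≫ (pM.homDual (F.toFunctor.obj m) n).hom ≫ dualMap (F.iHomAdjInv H m n) =
      H.curry (mate (dualObj F) (dualObj (dualObj F))
        (f ≫ doubleDualApp pM.pairing F (dualObj F) (dualObj (dualObj F)) m)) ≫
        (pM.homDual m ((dualObj F).toFunctor.obj n)).hom := by
  refine (exists_unique_evaluation (W := H.hom m ((dualObj F).toFunctor.obj n)) _).unique ?_ rfl
  have h := pair_doubleDualApp pM.pairing (F' := dualObj F) (F'' := dualObj (dualObj F)) f
    (H.ev m ((dualObj F).toFunctor.obj n))
  have h1 := curry_iHomAdjInv F (H := H) (H.ev m ((dualObj F).toFunctor.obj n))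
  rw [InternalHom.curry_ev, Category.id_comp] at h1
  have h2 := dualMap_evDual (H.curry f ≫ (pM.homDual (F.toFunctor.obj m) n).hom) (𝟙 _)
    (F.iHomAdjInv H m n)
  change _ ▷ _ ≫ _ ◁ H.curry (mate F (dualObj F) _) ≫ evDual _ = _ ▷ _ ≫ _ ◁ H.curry _ ≫ _ at h
  rw [← h1, InternalHom.curry_ev] at h
  simp only [MonoidalCategory.whiskerLeft_id, Category.id_comp, Category.assoc] at h h2
  rw [← h, ← h2]

/-- After precomposition with id ≅ S, the canonical composite sends `curry` of f to the mate of f ≫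
q and then, by the second adjunction, back to f ≫ q. -/
lemma isSerreComparison_serreComparison : F.IsSerreComparison S (F.serreComparison pM) := by
  intro m n
  rw [← cancel_epi (H.post n (pM.serreIso (F.toFunctor.obj m)).hom), ← Category.assoc _ (Iso.inv _),
    ← pM.homDual_hom]
  refine H.hom_ext fun X f => ?_
  have h := curry_homDual_dualMap F pM f
  rw [reassoc_of% h, reassoc_of% (pM.homDual_φ), reassoc_of% (H.curry_post (mate _ _ _)), curry_iHomAdj,
    ← mate_map, comate_mate, reassoc_of% (H.curry_post f), InternalHom.curry_post,
    serreComparison_hom_app]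
  simp only [Category.assoc, Iso.hom_inv_id_assoc]

theorem exists_pivotalStructure : ∃ q : PivotalStructure (DualCategory k C M),
    ∀ F : DualCategory k C M,
      ∃ θ : F.toFunctor ⋙ S.functor ≅ S.functor ⋙ (dualObj (dualObj F)).toFunctor,
        F.IsSerreComparison S θ ∧
        ∀ m : M, (q.iso F).hom.natTrans.app m =
          pM.iso.hom.app (F.toFunctor.obj m) ≫ θ.hom.app m ≫
            (dualObj (dualObj F)).toFunctor.map (pM.iso.inv.app m) := by
  refine ⟨pivotalStructure pM.pairing, fun F => ⟨F.serreComparison pM,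
    isSerreComparison_serreComparison F pM, fun m => ?_⟩⟩
  change doubleDualApp _ _ _ _ _ = (pM.serreIso _).hom ≫ _ ≫
    (dualObj (dualObj F)).toFunctor.map (pM.serreIso m).inv
  rw [serreComparison_hom_app]
  simp only [Category.assoc, Iso.hom_inv_id_assoc]
  rw [← Functor.map_comp, Iso.hom_inv_id, CategoryTheory.Functor.map_id,
    Category.comp_id]

end Serre

end DualCategory

/-! ### Projective generators of finite abelian categories -/

/-- A projective generator with finite-dimensional morphism spaces. -/
structure IsProjectiveGenerator (k : Type w) [Field k] {A : Type u} [Category.{v} A]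
    [Preadditive A] [Linear k A] (P : A) : Prop where
  projective : Projective P
  separator {X Y : A} (f : X ⟶ Y) (h : ∀ g : P ⟶ X, g ≫ f = 0) : f = 0
  finite (X : A) : Module.Finite k (P ⟶ X)

section OfEquivalence

variable {k : Type w} [Field k] {A : Type u} [Category.{v} A] [Preadditive A] [Linear k A]
  {B : Type w} [Ring B]

/-- The morphism `B ⟶ V` of modules sending `1` to `x`. -/
def fgModuleHomOfElem (V : FGModuleCat.{w} B) (x : V) : FGModuleCat.of B B ⟶ V :=
  ObjectProperty.homMk (ModuleCat.ofHom (LinearMap.toSpanSingleton B V x))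

/-- The projection to the quotient by the range vanishes after f, hence vanishes. -/
lemma fgModule_epi_surjective {V W : FGModuleCat.{w} B} (f : V ⟶ W) [Epi f] :
    Function.Surjective f.hom.hom := by
  let q : W ⟶ FGModuleCat.of B (W ⧸ LinearMap.range f.hom.hom) :=
    ObjectProperty.homMk (ModuleCat.ofHom (LinearMap.range f.hom.hom).mkQ)
  have h : f ≫ q = f ≫ 0 := by
    rw [comp_zero]
    ext x
    exact (Submodule.Quotient.mk_eq_zero _).2 ⟨x, rfl⟩
  have hq : q = 0 := (cancel_epi f).1 h
  intro y
  have : q.hom.hom y = 0 := by rw [hq]; rfl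
  exact (Submodule.Quotient.mk_eq_zero _).1 this

lemma fgModule_projective : Projective (FGModuleCat.of B B) where
  factors {V W} f e _ := by
    obtain ⟨x, hx⟩ := fgModule_epi_surjective e (f.hom.hom (1 : B))
    refine ⟨fgModuleHomOfElem V x, ?_⟩
    ext : 1
    refine LinearMap.ext_ring ?_
    change e.hom.hom ((1 : B) • x) = _
    rw [one_smul, hx]

lemma isProjectiveGenerator_of_equivalence [Algebra k B] [Module.Finite k B]
    (e : A ≌ FGModuleCat.{w} B) [e.functor.Additive] [e.functor.Linear k] :
    IsProjectiveGenerator k (e.inverse.obj (FGModuleCat.of B B)) where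
  projective := e.symm.toAdjunction.map_projective _ fgModule_projective
  separator {X Y} f h := by
    apply e.functor.map_injective
    rw [Functor.map_zero]
    ext x
    have hx := h (((e.symm.toAdjunction.homEquiv _ _).symm (fgModuleHomOfElem _ x)))
    have h2 := e.symm.toAdjunction.homEquiv_naturality_right
      ((e.symm.toAdjunction.homEquiv _ _).symm (fgModuleHomOfElem _ x)) f
    rw [hx, Equiv.apply_symm_apply] at h2
    have h3 : (fgModuleHomOfElem (e.functor.obj X) x ≫ e.functor.map f).hom.hom (1 : B) = 0 := by
      rw [← show _ = fgModuleHomOfElem (e.functor.obj X) x ≫ e.functor.map f from h2,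
        Adjunction.homEquiv_apply]
      change (e.symm.unit.app (FGModuleCat.of B B) ≫
        e.functor.map (0 : e.inverse.obj (FGModuleCat.of B B) ⟶ Y)).hom.hom (1 : B) = 0
      rw [Functor.map_zero, comp_zero]
      rfl
    change (e.functor.map f).hom.hom ((1 : B) • x) = 0 at h3
    rwa [one_smul] at h3
  finite X := by
    -- A morphism is determined by the image of 1 in the module of X, which is finite over B and so
    -- finite-dimensional over k.
    let V := e.functor.obj X
    let : Module k V := Module.restrictScalars k B V
    have : IsScalarTower k B V := IsScalarTower.restrictScalars k B V
    have : Module.Finite k V := Module.Finite.trans B V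
    let ℓ : (e.inverse.obj (FGModuleCat.of B B) ⟶ X) →ₗ[k] V :=
      { toFun f := (e.symm.unit.app (FGModuleCat.of B B) ≫ e.functor.map f).hom.hom (1 : B)
        map_add' f g := by
          rw [Functor.map_add, Preadditive.comp_add]
          rfl
        map_smul' r f := by
          rw [Functor.map_smul, Linear.comp_smul]
          rfl }
    refine Module.Finite.of_injective ℓ ?_
    rw [injective_iff_map_eq_zero]
    intro f hf
    apply (e.symm.toAdjunction.homEquiv _ _).injective
    rw [Adjunction.homEquiv_apply, Adjunction.homEquiv_apply]
    change e.symm.unit.app (FGModuleCat.of B B) ≫ e.functor.map f =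
      e.symm.unit.app _ ≫ e.functor.map 0
    rw [Functor.map_zero, comp_zero]
    ext : 1
    exact LinearMap.ext_ring hf

lemma IsFiniteAbelian.exists_isProjectiveGenerator (h : IsFiniteAbelian k A) :
    ∃ P : A, IsProjectiveGenerator k P := by
  obtain ⟨B, _, _, _, e, _, _⟩ := h.equiv_modules
  exact ⟨_, isProjectiveGenerator_of_equivalence e⟩

end OfEquivalence

instance hasFiniteBiproducts_of_abelian (A : Type u) [Category.{v} A] [Abelian A] :
    HasFiniteBiproducts A := Abelian.hasFiniteBiproducts

namespace IsProjectiveGenerator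

variable {k : Type w} [Field k] {A : Type u} [Category.{v} A] [Abelian A] [Linear k A] {P : A}

/-- A finite spanning family of Hom(P, X) assembles to a morphism from a power of P. Whatever kills
it kills all morphisms P ⟶ X, hence is zero. -/
lemma exists_epi (hP : IsProjectiveGenerator k P) (X : A) :
    ∃ (n : ℕ) (π : (⨁ fun _ : Fin n => P) ⟶ X), Epi π := by
  have := hP.finite X
  obtain ⟨n, s, hs⟩ := Module.Finite.exists_fin (R := k) (M := P ⟶ X)
  refine ⟨n, biproduct.desc s, Preadditive.epi_of_cancel_zero _ fun {Y} f hf => ?_⟩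
  refine hP.separator f fun g => ?_
  have hg : g ∈ Submodule.span k (Set.range s) := hs ▸ Submodule.mem_top
  induction hg using Submodule.span_induction with
  | mem x hx =>
    obtain ⟨i, rfl⟩ := hx
    rw [← biproduct.ι_desc s i, Category.assoc, hf, comp_zero]
  | zero => exact zero_comp
  | add x y _ _ hx hy => rw [Preadditive.add_comp, hx, hy, add_zero]
  | smul r x _ hx => rw [Linear.smul_comp, hx, smul_zero]

lemma exists_lift (hP : IsProjectiveGenerator k P) {X Y : A} (e : X ⟶ Y) [Epi e] (f : P ⟶ Y) :
    ∃ g : P ⟶ X, g ≫ e = f :=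
  hP.projective.factors f e

/-- Fullness of Hom(P, -): the morphism is prescribed on a power of P covering X and descends to X,
because P detects that it kills the kernel. -/
lemma exists_map_of_linear (hP : IsProjectiveGenerator k P) {X Y : A}
    (φ : (P ⟶ X) →+ (P ⟶ Y)) (hφ : ∀ (a : P ⟶ P) (h : P ⟶ X), φ (a ≫ h) = a ≫ φ h) :
    ∃ f : X ⟶ Y, ∀ h, φ h = h ≫ f := by
  obtain ⟨n, π, _⟩ := hP.exists_epi X
  let g : (⨁ fun _ : Fin n => P) ⟶ Y := biproduct.desc fun i => φ (biproduct.ι (fun _ : Fin n => P) i ≫ π)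
  have hg (u : P ⟶ ⨁ fun _ : Fin n => P) : u ≫ g = φ (u ≫ π) := by
    have hu : u = ∑ i, (u ≫ biproduct.π (fun _ : Fin n => P) i) ≫
        biproduct.ι (fun _ : Fin n => P) i := by
      simp only [Category.assoc]
      rw [← Preadditive.comp_sum, biproduct.total, Category.comp_id]
    conv_rhs => rw [hu]
    conv_lhs => rw [hu]
    rw [Preadditive.sum_comp, Preadditive.sum_comp, map_sum]
    refine Finset.sum_congr rfl fun i _ => ?_
    rw [Category.assoc _ _ π, hφ, Category.assoc]
    congr 1
    exact biproduct.ι_desc _ _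
  have h0 : kernel.ι π ≫ g = 0 := hP.separator _ fun u => by
    rw [← Category.assoc, hg, Category.assoc, kernel.condition, comp_zero, map_zero]
  refine ⟨Abelian.epiDesc π g h0, fun h => ?_⟩
  obtain ⟨u, rfl⟩ := hP.exists_lift π h
  rw [Category.assoc, Abelian.comp_epiDesc, hg]

end IsProjectiveGenerator

/-! ### Finite abelian categories from projective generators -/

namespace IsProjectiveGenerator

variable {k : Type w} [Field k] {A : Type u} [Category.{v} A] [Abelian A] [Linear k A] {P : A}

/-- Morphism spaces out of a projective generator, in the universe of the field. -/
def HomModule (hP : IsProjectiveGenerator k P) (X : A) : Type w :=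
  have := hP.finite X
  -- A finite-dimensional space has a copy in the universe of k, where `IsFiniteAbelian` requires
  -- its algebra.
  have := Module.Finite.small.{w} k (P ⟶ X)
  Shrink.{w} (P ⟶ X)

variable (hP : IsProjectiveGenerator k P)

instance (X : A) : AddCommGroup (hP.HomModule X) :=
  have := hP.finite X
  have := Module.Finite.small.{w} k (P ⟶ X)
  inferInstanceAs (AddCommGroup (Shrink.{w} (P ⟶ X)))

/-- The opposite endomorphism algebra of a projective generator, in the universe of the field. -/
def EndAlgebra : Type w :=
  have : Module.Finite k (End P) := hP.finite P
  have := Module.Finite.small.{w} k (End P)ᵐᵒᵖ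
  Shrink.{w} (End P)ᵐᵒᵖ

instance : Ring hP.EndAlgebra :=
  have : Module.Finite k (End P) := hP.finite P
  have := Module.Finite.small.{w} k (End P)ᵐᵒᵖ
  inferInstanceAs (Ring (Shrink.{w} (End P)ᵐᵒᵖ))

instance : Algebra k hP.EndAlgebra :=
  have : Module.Finite k (End P) := hP.finite P
  have := Module.Finite.small.{w} k (End P)ᵐᵒᵖ
  inferInstanceAs (Algebra k (Shrink.{w} (End P)ᵐᵒᵖ))

/-- The comparison of `EndAlgebra` with the opposite endomorphism algebra. -/
def endEquiv : hP.EndAlgebra ≃ₐ[k] (End P)ᵐᵒᵖ :=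
  have : Module.Finite k (End P) := hP.finite P
  have := Module.Finite.small.{w} k (End P)ᵐᵒᵖ
  Shrink.algEquiv k (End P)ᵐᵒᵖ

instance : Module.Finite k hP.EndAlgebra :=
  have : Module.Finite k (End P) := hP.finite P
  have : Module.Finite k (End P)ᵐᵒᵖ := inferInstance
  Module.Finite.equiv hP.endEquiv.symm.toLinearEquiv

/-- The endomorphism of `P` given by an element of `EndAlgebra`. -/
def endo (b : hP.EndAlgebra) : P ⟶ P := (hP.endEquiv b).unop

/-- The comparison of `HomModule` with the morphism space. -/
def homAddEquiv (X : A) : hP.HomModule X ≃+ (P ⟶ X) :=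
  have := hP.finite X
  have := Module.Finite.small.{w} k (P ⟶ X)
  Shrink.addEquiv

/-- Precomposition reverses products of endomorphisms, so it is the opposite algebra that acts from
the left. -/
instance (X : A) : Module hP.EndAlgebra (hP.HomModule X) where
  smul b x := (hP.homAddEquiv X).symm (hP.endo b ≫ hP.homAddEquiv X x)
  one_smul x := by
    change (hP.homAddEquiv X).symm (hP.endo 1 ≫ hP.homAddEquiv X x) = x
    simp [endo, End.one_def]
  mul_smul a b x := by
    change (hP.homAddEquiv X).symm (hP.endo (a * b) ≫ hP.homAddEquiv X x) =
      (hP.homAddEquiv X).symm (hP.endo a ≫ hP.homAddEquiv X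
        ((hP.homAddEquiv X).symm (hP.endo b ≫ hP.homAddEquiv X x)))
    simp [endo, End.mul_def]
  smul_zero b := by
    change (hP.homAddEquiv X).symm (hP.endo b ≫ hP.homAddEquiv X 0) = 0
    simp
  smul_add b x y := by
    change (hP.homAddEquiv X).symm (hP.endo b ≫ hP.homAddEquiv X (x + y)) =
      (hP.homAddEquiv X).symm (hP.endo b ≫ hP.homAddEquiv X x) +
      (hP.homAddEquiv X).symm (hP.endo b ≫ hP.homAddEquiv X y)
    simp
  add_smul a b x := by
    change (hP.homAddEquiv X).symm (hP.endo (a + b) ≫ hP.homAddEquiv X x) =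
      (hP.homAddEquiv X).symm (hP.endo a ≫ hP.homAddEquiv X x) +
      (hP.homAddEquiv X).symm (hP.endo b ≫ hP.homAddEquiv X x)
    have : hP.endo (a + b) = hP.endo a + hP.endo b := by
      simp only [endo, map_add]
      rfl
    rw [this, Preadditive.add_comp, map_add]
  zero_smul x := by
    change (hP.homAddEquiv X).symm (hP.endo 0 ≫ hP.homAddEquiv X x) = 0
    have : hP.endo 0 = 0 := by
      simp only [endo, map_zero]
      rfl
    rw [this, zero_comp, map_zero]

lemma homAddEquiv_smul {X : A} (b : hP.EndAlgebra) (x : hP.HomModule X) :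
    hP.homAddEquiv X (b • x) = hP.endo b ≫ hP.homAddEquiv X x :=
  (hP.homAddEquiv X).apply_symm_apply _

lemma endo_surjective (a : P ⟶ P) : ∃ b : hP.EndAlgebra, hP.endo b = a :=
  ⟨hP.endEquiv.symm (MulOpposite.op a), by simp [endo]⟩

lemma endo_algebraMap (r : k) : hP.endo (algebraMap k hP.EndAlgebra r) = r • 𝟙 P := by
  simp only [endo, AlgEquiv.commutes]
  rfl

instance (X : A) : Module.Finite hP.EndAlgebra (hP.HomModule X) := by
  have := hP.finite X
  obtain ⟨s, hs⟩ := Module.Finite.fg_top (R := k) (M := P ⟶ X)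
  classical
  refine ⟨⟨s.image (hP.homAddEquiv X).symm, ?_⟩⟩
  rw [eq_top_iff]
  intro x _
  have hx : hP.homAddEquiv X x ∈ Submodule.span k (s : Set (P ⟶ X)) := hs ▸ Submodule.mem_top
  obtain ⟨y, hy⟩ : ∃ y, y = hP.homAddEquiv X x := ⟨_, rfl⟩
  rw [← hy] at hx
  obtain rfl : x = (hP.homAddEquiv X).symm y := by simp [hy]
  clear hy
  induction hx using Submodule.span_induction with
  | mem x hx => exact Submodule.subset_span (Finset.mem_coe.2 (Finset.mem_image_of_mem _ hx))
  | zero => simp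
  | add x y _ _ hx hy => rw [map_add]; exact Submodule.add_mem _ (hx trivial) (hy trivial)
  | smul r x _ hx =>
    have : (hP.homAddEquiv X).symm (r • x) =
        algebraMap k hP.EndAlgebra r • (hP.homAddEquiv X).symm x := by
      apply (hP.homAddEquiv X).injective
      simp [homAddEquiv_smul, endo_algebraMap]
    rw [this]
    exact Submodule.smul_mem _ _ (hx trivial)

/-- The morphism of modules `Hom(P, X) ⟶ Hom(P, Y)`. -/
def homMap {X Y : A} (f : X ⟶ Y) : hP.HomModule X →ₗ[hP.EndAlgebra] hP.HomModule Y where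
  toFun x := (hP.homAddEquiv Y).symm (hP.homAddEquiv X x ≫ f)
  map_add' x y := by simp
  map_smul' b x := by
    apply (hP.homAddEquiv Y).injective
    simp [homAddEquiv_smul]

lemma homAddEquiv_homMap {X Y : A} (f : X ⟶ Y) (x : hP.HomModule X) :
    hP.homAddEquiv Y (hP.homMap f x) = hP.homAddEquiv X x ≫ f :=
  (hP.homAddEquiv Y).apply_symm_apply _

/-- The functor `Hom(P, -)` to modules. -/
def homFunctor : A ⥤ FGModuleCat.{w} hP.EndAlgebra where
  obj X := FGModuleCat.of _ (hP.HomModule X)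
  map {X Y} f := ObjectProperty.homMk (ModuleCat.ofHom (hP.homMap f))
  map_id X := by
    ext x
    change hP.homMap (𝟙 X) x = x
    apply (hP.homAddEquiv X).injective
    rw [homAddEquiv_homMap, Category.comp_id]
  map_comp {X Y Z} f g := by
    ext x
    change hP.homMap (f ≫ g) x = hP.homMap g (hP.homMap f x)
    apply (hP.homAddEquiv Z).injective
    simp only [homAddEquiv_homMap, Category.assoc]

lemma homMap_add {X Y : A} (f g : X ⟶ Y) : hP.homMap (f + g) = hP.homMap f + hP.homMap g := by
  ext x
  apply (hP.homAddEquiv Y).injective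
  simp only [LinearMap.add_apply, homAddEquiv_homMap, map_add, Preadditive.comp_add]

lemma homMap_smul {X Y : A} (r : k) (f : X ⟶ Y) (x : hP.HomModule X) :
    hP.homMap (r • f) x = algebraMap k hP.EndAlgebra r • hP.homMap f x := by
  apply (hP.homAddEquiv Y).injective
  simp [homAddEquiv_homMap, homAddEquiv_smul, endo_algebraMap]

instance : hP.homFunctor.Additive where
  map_add {X Y f g} := by
    ext : 1
    exact hP.homMap_add f g

instance : hP.homFunctor.Linear k where
  map_smul {X Y} f r := by
    ext x
    exact hP.homMap_smul r f x

instance : hP.homFunctor.Faithful where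
  map_injective {X Y f g} h := by
    rw [← sub_eq_zero]
    refine hP.separator _ fun x => ?_
    have h0 : hP.homMap f = hP.homMap g := congrArg (fun t => t.hom.hom) h
    have h1 := hP.homAddEquiv_homMap f ((hP.homAddEquiv X).symm x)
    have h2 := hP.homAddEquiv_homMap g ((hP.homAddEquiv X).symm x)
    rw [h0, h2] at h1
    simp only [AddEquiv.apply_symm_apply] at h1
    rw [Preadditive.comp_sub, h1, sub_self]

lemma exists_homMap_eq {X Y : A} (φ : hP.HomModule X →ₗ[hP.EndAlgebra] hP.HomModule Y) :
    ∃ f : X ⟶ Y, hP.homMap f = φ := by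
  obtain ⟨f, hf⟩ := hP.exists_map_of_linear
    (((hP.homAddEquiv Y).toAddMonoidHom.comp φ.toAddMonoidHom).comp
      (hP.homAddEquiv X).symm.toAddMonoidHom) (by
    intro a h
    obtain ⟨b, rfl⟩ := hP.endo_surjective a
    have : (hP.homAddEquiv X).symm (hP.endo b ≫ h) = b • (hP.homAddEquiv X).symm h := by
      apply (hP.homAddEquiv X).injective
      simp [homAddEquiv_smul]
    change hP.homAddEquiv Y (φ ((hP.homAddEquiv X).symm (hP.endo b ≫ h))) =
      hP.endo b ≫ hP.homAddEquiv Y (φ ((hP.homAddEquiv X).symm h))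
    rw [this, map_smul, homAddEquiv_smul])
  refine ⟨f, ?_⟩
  ext x
  apply (hP.homAddEquiv Y).injective
  rw [homAddEquiv_homMap, ← hf]
  change hP.homAddEquiv Y (φ ((hP.homAddEquiv X).symm (hP.homAddEquiv X x))) = _
  rw [AddEquiv.symm_apply_apply]

instance : hP.homFunctor.Full where
  map_surjective {X Y} φ := by
    obtain ⟨f, hf⟩ := hP.exists_homMap_eq φ.hom.hom
    refine ⟨f, ?_⟩
    ext : 1
    exact hf

/-- Morphisms from `P` to a power of `P` are tuples of elements of `EndAlgebra`. -/
def powerEquiv (n : ℕ) : (Fin n → hP.EndAlgebra) ≃ₗ[hP.EndAlgebra]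
    hP.HomModule (⨁ fun _ : Fin n => P) :=
  LinearEquiv.ofBijective
    { toFun b := (hP.homAddEquiv _).symm (biproduct.lift fun i => hP.endo (b i))
      map_add' a b := by
        rw [← map_add]
        congr 1
        apply biproduct.hom_ext
        intro i
        rw [Preadditive.add_comp, biproduct.lift_π, biproduct.lift_π, biproduct.lift_π]
        simp only [endo, Pi.add_apply, map_add]
        rfl
      map_smul' a b := by
        apply (hP.homAddEquiv _).injective
        simp only [homAddEquiv_smul, RingHom.id_apply, AddEquiv.apply_symm_apply]
        apply biproduct.hom_ext
        intro i
        rw [Category.assoc, biproduct.lift_π, biproduct.lift_π]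
        simp [endo, End.mul_def] }
    ⟨by
      intro a b h
      have h' : biproduct.lift (fun i => hP.endo (a i)) =
        biproduct.lift (fun i => hP.endo (b i)) := (hP.homAddEquiv _).symm.injective h
      funext i
      have hi := congrArg (fun t => t ≫ biproduct.π (fun _ : Fin n => P) i) h'
      simp only [biproduct.lift_π] at hi
      exact hP.endEquiv.injective (MulOpposite.unop_injective hi), by
      intro x
      choose b hb using fun i => hP.endo_surjective
        (hP.homAddEquiv _ x ≫ biproduct.π (fun _ : Fin n => P) i)
      refine ⟨b, ?_⟩
      apply (hP.homAddEquiv _).injective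
      change hP.homAddEquiv _ ((hP.homAddEquiv _).symm _) = _
      rw [AddEquiv.apply_symm_apply]
      apply biproduct.hom_ext
      intro i
      rw [biproduct.lift_π, hb]⟩

/-- A finite presentation of V is realised by a morphism `a` between powers of P. Since Hom(P, -)
preserves its cokernel, P being projective, V is the image of that cokernel. -/
instance : hP.homFunctor.EssSurj where
  mem_essImage V := by
    obtain ⟨n, f, hf⟩ := Module.Finite.exists_fin' hP.EndAlgebra V
    -- Makes the module of relations finitely generated.
    have := IsNoetherianRing.of_finite k hP.EndAlgebra
    obtain ⟨m, g, hg⟩ := Module.Finite.exists_fin' hP.EndAlgebra (LinearMap.ker f)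
    obtain ⟨a, ha⟩ := hP.exists_homMap_eq ((hP.powerEquiv n).toLinearMap ∘ₗ
      (LinearMap.ker f).subtype ∘ₗ g ∘ₗ (hP.powerEquiv m).symm.toLinearMap)
    let ψ : (Fin n → hP.EndAlgebra) →ₗ[hP.EndAlgebra] hP.HomModule (cokernel a) :=
      hP.homMap (cokernel.π a) ∘ₗ (hP.powerEquiv n).toLinearMap
    have hψ : Function.Surjective ψ := by
      intro y
      obtain ⟨u, hu⟩ := hP.exists_lift (cokernel.π a) (hP.homAddEquiv _ y)
      obtain ⟨b, hb⟩ := (hP.powerEquiv n).surjective ((hP.homAddEquiv _).symm u)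
      refine ⟨b, (hP.homAddEquiv _).injective ?_⟩
      change hP.homAddEquiv _ (hP.homMap (cokernel.π a) (hP.powerEquiv n b)) = _
      rw [hb, homAddEquiv_homMap, AddEquiv.apply_symm_apply, hu]
    have hker : LinearMap.ker f = LinearMap.ker ψ := by
      ext x
      constructor
      · intro hx
        obtain ⟨z, hz⟩ := hg ⟨x, hx⟩
        have h1 : hP.homMap a (hP.powerEquiv m z) = hP.powerEquiv n x := by
          rw [ha]
          simp [hz]
        refine (hP.homAddEquiv _).injective ?_
        change hP.homAddEquiv _ (hP.homMap (cokernel.π a) (hP.powerEquiv n x)) = _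
        rw [← h1, homAddEquiv_homMap, homAddEquiv_homMap, Category.assoc, cokernel.condition,
          comp_zero, map_zero]
      · intro hx
        have hx' : hP.homAddEquiv _ (hP.powerEquiv n x) ≫ cokernel.π a = 0 := by
          have h0 : hP.homMap (cokernel.π a) (hP.powerEquiv n x) = 0 := hx
          rw [← homAddEquiv_homMap, h0, map_zero]
        have := hP.projective
        let u := (ShortComplex.exact_cokernel a).liftFromProjective _ hx'
        have hu : u ≫ a = hP.homAddEquiv _ (hP.powerEquiv n x) :=
          (ShortComplex.exact_cokernel a).liftFromProjective_comp _ hx'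
        have h1 : hP.homMap a ((hP.homAddEquiv _).symm u) = hP.powerEquiv n x := by
          apply (hP.homAddEquiv _).injective
          rw [homAddEquiv_homMap, AddEquiv.apply_symm_apply, hu]
        rw [ha] at h1
        have h2 := (hP.powerEquiv n).injective h1
        rw [← h2]
        exact Subtype.property _
    exact ⟨cokernel a, ⟨LinearEquiv.toFGModuleCatIso
      ((ψ.quotKerEquivOfSurjective hψ).symm ≪≫ₗ Submodule.quotEquivOfEq _ _ hker.symm ≪≫ₗ
        f.quotKerEquivOfSurjective hf)⟩⟩

end IsProjectiveGenerator

lemma IsProjectiveGenerator.isFiniteAbelian {k : Type w} [Field k] {A : Type u} [Category.{v} A]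
    [Abelian A] [Linear k A] {P : A} (hP : IsProjectiveGenerator k P) : IsFiniteAbelian k A where
  abelian := ⟨inferInstance, rfl⟩
  equiv_modules := by
    have : hP.homFunctor.IsEquivalence := { }
    exact ⟨hP.EndAlgebra, inferInstance, inferInstance, inferInstance,
      hP.homFunctor.asEquivalence, inferInstanceAs hP.homFunctor.Additive,
      inferInstanceAs (hP.homFunctor.Linear k)⟩

/-! ### Right adjoints of right exact functors -/

namespace IsProjectiveGenerator

variable {k : Type w} [Field k] {A : Type u} [Category.{v} A] [Abelian A] [Linear k A] {P : A}
  {A' : Type u₂} [Category.{v₂} A'] [Abelian A'] [Linear k A']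

lemma finite_hom (hP : IsProjectiveGenerator k P) (X Y : A) : Module.Finite k (X ⟶ Y) := by
  obtain ⟨n, π, _⟩ := hP.exists_epi X
  have := hP.finite Y
  let ℓ : (X ⟶ Y) →ₗ[k] (Fin n → (P ⟶ Y)) :=
    { toFun f i := biproduct.ι (fun _ : Fin n => P) i ≫ π ≫ f
      map_add' f g := by
        ext i
        simp
      map_smul' r f := by
        ext i
        simp }
  refine Module.Finite.of_injective ℓ ?_
  intro f g h
  rw [← cancel_epi π]
  apply biproduct.hom_ext'
  intro i
  exact congrFun h i

/-- An additive functor preserves the decomposition of the identity of a finite power. -/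
lemma power_hom_ext (F : A ⥤ A') [F.Additive] {n : ℕ} {Y : A'}
    {f g : F.obj (⨁ fun _ : Fin n => P) ⟶ Y}
    (h : ∀ i, F.map (biproduct.ι (fun _ : Fin n => P) i) ≫ f =
      F.map (biproduct.ι (fun _ : Fin n => P) i) ≫ g) : f = g := by
  have key (f : F.obj (⨁ fun _ : Fin n => P) ⟶ Y) :
      f = ∑ i, F.map (biproduct.π (fun _ : Fin n => P) i) ≫
        F.map (biproduct.ι (fun _ : Fin n => P) i) ≫ f := by
    conv_lhs => rw [← Category.id_comp f, ← CategoryTheory.Functor.map_id, ← biproduct.total,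
      Functor.map_sum, Preadditive.sum_comp]
    simp
  rw [key f, key g]
  simp only [h]

lemma exists_power_desc (F : A ⥤ A') [F.Additive] {n : ℕ} {Y : A'} (s : Fin n → (F.obj P ⟶ Y)) :
    ∃ q : F.obj (⨁ fun _ : Fin n => P) ⟶ Y,
      ∀ i, F.map (biproduct.ι (fun _ : Fin n => P) i) ≫ q = s i := by
  classical
  refine ⟨∑ i, F.map (biproduct.π (fun _ : Fin n => P) i) ≫ s i, fun i => ?_⟩
  rw [Preadditive.comp_sum, Finset.sum_eq_single i]
  · rw [← Category.assoc, ← F.map_comp, biproduct.ι_π_self, F.map_id, Category.id_comp]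
  · intro j _ hj
    rw [← Category.assoc, ← F.map_comp, biproduct.ι_π_ne _ hj.symm, F.map_zero, zero_comp]
  · simp

variable (F : A ⥤ A') [F.Additive] [F.Linear k] [PreservesFiniteColimits F]

/-- Right exact functors admit universal arrows, because morphisms out of a projective generator
detect everything. -/
lemma exists_universal (hP : IsProjectiveGenerator k P) {P' : A'}
    (hP' : IsProjectiveGenerator k P') (n : A') :
    ∃ (y : A) (ε : F.obj y ⟶ n), ∀ (x : A) (g : F.obj x ⟶ n), ∃! h : x ⟶ y, F.map h ≫ ε = g := by
  have := hP'.finite_hom (F.obj P) n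
  -- The representing object is given by generators and relations: one copy of P for each member of
  -- a family spanning Hom(F P, n), modulo the morphisms P ⟶ P^d whose image under F is killed by
  -- `q`.
  obtain ⟨d, s, hs⟩ := Module.Finite.exists_fin (R := k) (M := F.obj P ⟶ n)
  obtain ⟨q, hq⟩ := exists_power_desc F s
  let K : Submodule k (P ⟶ ⨁ fun _ : Fin d => P) :=
    { carrier := {h | F.map h ≫ q = 0}
      add_mem' {a b} ha hb := by
        simp only [Set.mem_ofPred_eq] at ha hb ⊢
        rw [F.map_add, Preadditive.add_comp, ha, hb, add_zero]
      zero_mem' := by simp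
      smul_mem' r a ha := by
        simp only [Set.mem_ofPred_eq] at ha ⊢
        rw [F.map_smul, Linear.smul_comp, ha, smul_zero] }
  have := hP.finite (⨁ fun _ : Fin d => P)
  obtain ⟨e, t, ht⟩ := Module.Finite.exists_fin (R := k) (M := K)
  let r : (⨁ fun _ : Fin e => P) ⟶ (⨁ fun _ : Fin d => P) := biproduct.desc fun i => (t i).1
  have hr : F.map r ≫ q = 0 := by
    apply power_hom_ext F
    intro i
    rw [← Category.assoc, ← F.map_comp, biproduct.ι_desc, comp_zero]
    exact (t i).2
  let ε : F.obj (cokernel r) ⟶ n := (PreservesCokernel.iso F r).hom ≫ cokernel.desc (F.map r) q hr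
  have hε : F.map (cokernel.π r) ≫ ε = q := by
    rw [← Category.assoc, PreservesCokernel.π_iso_hom, cokernel.π_desc]
  have hK (v : P ⟶ ⨁ fun _ : Fin d => P) (hv : F.map v ≫ q = 0) : v ≫ cokernel.π r = 0 := by
    have hmem : (⟨v, hv⟩ : K) ∈ Submodule.span k (Set.range t) := ht ▸ Submodule.mem_top
    obtain ⟨c, hc⟩ := (Submodule.mem_span_range_iff_exists_fun k).1 hmem
    have hv' : v = ∑ i, c i • (t i).1 := by
      rw [← show ((∑ i, c i • t i : K) : P ⟶ _) = v from congrArg Subtype.val hc]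
      simp
    rw [hv', Preadditive.sum_comp]
    refine Finset.sum_eq_zero fun i _ => ?_
    rw [Linear.smul_comp, ← show biproduct.ι (fun _ : Fin e => P) i ≫ r = (t i).1 from
      biproduct.ι_desc _ _, Category.assoc, cokernel.condition, comp_zero, smul_zero]
  -- Probing with P and lifting to P^d turns the hypothesis into membership in the relations `K`.
  have inj {x : A} (h : x ⟶ cokernel r) (hh : F.map h ≫ ε = 0) : h = 0 := by
    refine hP.separator h fun u => ?_
    obtain ⟨v, hv⟩ := hP.exists_lift (cokernel.π r) (u ≫ h)
    rw [← hv]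
    apply hK
    rw [← hε, ← Category.assoc, ← F.map_comp, hv, F.map_comp, Category.assoc, hh, comp_zero]
  have surj (g : F.obj P ⟶ n) : ∃ u : P ⟶ cokernel r, F.map u ≫ ε = g := by
    have hmem : g ∈ Submodule.span k (Set.range s) := hs ▸ Submodule.mem_top
    obtain ⟨c, hc⟩ := (Submodule.mem_span_range_iff_exists_fun k).1 hmem
    refine ⟨(∑ i, c i • biproduct.ι (fun _ : Fin d => P) i) ≫ cokernel.π r, ?_⟩
    rw [F.map_comp, Category.assoc, hε, ← hc, F.map_sum, Preadditive.sum_comp]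
    refine Finset.sum_congr rfl fun i _ => ?_
    rw [F.map_smul, Linear.smul_comp, hq]
  refine ⟨cokernel r, ε, fun x g => ?_⟩
  -- Existence is known for x = P. For general x it is built on a power of P covering x and descends
  -- by `inj`.
  obtain ⟨a, p, _⟩ := hP.exists_epi x
  choose u hu using fun i => surj (F.map (biproduct.ι (fun _ : Fin a => P) i ≫ p) ≫ g)
  let h₀ : (⨁ fun _ : Fin a => P) ⟶ cokernel r := biproduct.desc u
  have hh₀ : F.map h₀ ≫ ε = F.map p ≫ g := by
    apply power_hom_ext F
    intro i
    rw [← Category.assoc, ← F.map_comp, biproduct.ι_desc, hu, F.map_comp, Category.assoc]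
  have h0 : kernel.ι p ≫ h₀ = 0 := by
    apply inj
    rw [F.map_comp, Category.assoc, hh₀, ← Category.assoc, ← F.map_comp, kernel.condition,
      F.map_zero, zero_comp]
  refine ⟨Abelian.epiDesc p h₀ h0, ?_, fun h' hh' => ?_⟩
  · change F.map _ ≫ ε = g
    rw [← cancel_epi (F.map p), ← Category.assoc, ← F.map_comp, Abelian.comp_epiDesc, hh₀]
  · rw [← sub_eq_zero]
    apply inj
    rw [F.map_sub, Preadditive.sub_comp, hh', sub_eq_zero, ← cancel_epi (F.map p),
      ← Category.assoc, ← F.map_comp, Abelian.comp_epiDesc, hh₀]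

lemma isLeftAdjoint (hP : IsProjectiveGenerator k P) {P' : A'}
    (hP' : IsProjectiveGenerator k P') : F.IsLeftAdjoint := by
  choose y ε h using fun n => exists_universal F hP hP' n
  let e (x : A) (n : A') : (F.obj x ⟶ n) ≃ (x ⟶ y n) :=
    { toFun g := (h n x g).choose
      invFun f := F.map f ≫ ε n
      left_inv g := (h n x g).choose_spec.1
      right_inv f := ((h n x _).choose_spec.2 f rfl).symm }
  exact ⟨_, ⟨Adjunction.adjunctionOfEquivRight e (fun x' x n f g => by
    rw [← Equiv.eq_symm_apply]
    change _ = F.map (f ≫ e x n g) ≫ ε n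
    rw [F.map_comp, Category.assoc]
    congr 1
    exact ((e x n).symm_apply_apply g).symm)⟩⟩

end IsProjectiveGenerator

/-! ### Exactness of module functors -/

section Adjoint

variable {C : Type u₁} [Category.{v₁} C] [MonoidalCategory C]
  {M : Type u₂} [Category.{v₂} M] [MonoidalLeftAction C M]

/-- The action of `X` is right adjoint to the action of its dual. -/
def actionAdjunction (X Y : C) [ExactPairing X Y] : actionLeft M Y ⊣ actionLeft M X :=
  Adjunction.mkOfUnitCounit
    { unit := { app := fun d => actUnit X Y d
                naturality := fun _ _ f => actUnit_naturality X Y f }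
      counit := { app := fun d => actCounit X Y d
                  naturality := fun _ _ f => actCounit_naturality X Y f }
      left_triangle := by
        ext d
        change Y ⊴ₗ actUnit X Y d ≫ 𝟙 _ ≫ actCounit X Y (Y ⊙ₗ d) = 𝟙 _
        rw [Category.id_comp, actUnit_actCounit']
      right_triangle := by
        ext d
        change actUnit X Y (X ⊙ₗ d) ≫ 𝟙 _ ≫ X ⊴ₗ actCounit X Y d = 𝟙 _
        rw [Category.id_comp, actUnit_actCounit] }

end Adjoint

section Additive

variable (k : Type w) [Field k] {C : Type u₁} [Category.{v₁} C] [Preadditive C] [Linear k C]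
  [MonoidalCategory C] {M : Type u₂} [Category.{v₂} M] [Preadditive M] [Linear k M]
  [MonoidalLeftAction C M]

lemma actionLeft_additive [IsBilinearAction k C M] (X : C) : (actionLeft M X).Additive where
  map_add {_ _ f g} := IsBilinearAction.action_add k X f g

lemma actionRight_additive [IsBilinearAction k C M] (m : M) : (actionRight C m).Additive where
  map_add {_ _ f g} := IsBilinearAction.add_action k f g m

lemma actionRight_linear [IsBilinearAction k C M] (m : M) : (actionRight C m).Linear k where
  map_smul f r := IsBilinearAction.smul_action r f m

end Additive

section Exact

lemma IsFiniteAbelian.exists_projective_epi {k : Type w} [Field k] {C : Type u₁} [Category.{v₁} C]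
    [Abelian C] [Linear k C] (h : IsFiniteAbelian k C) (X : C) :
    ∃ (P : C) (π : P ⟶ X), Projective P ∧ Epi π := by
  obtain ⟨P, hP⟩ := h.exists_isProjectiveGenerator
  obtain ⟨n, π, hπ⟩ := hP.exists_epi X
  have := hP.projective
  refine ⟨_, π, ⟨fun f e _ => ?_⟩, hπ⟩
  choose u hu using fun i => hP.exists_lift e (biproduct.ι (fun _ : Fin n => P) i ≫ f)
  exact ⟨biproduct.desc u, biproduct.hom_ext' _ _ fun i => by
    rw [biproduct.ι_desc_assoc, hu]⟩

variable (k : Type w) [Field k] {C : Type u₁} [Category.{v₁} C] [Abelian C] [Linear k C]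
  [MonoidalCategory C] {M : Type u₂} [Category.{v₂} M] [Abelian M] [Linear k M]
  [MonoidalLeftAction C M]

/-- Right exactness in the first variable makes P ⊙ m ⟶ m epic, so P ⊙ f determines f by naturality.
-/
lemma actionLeft_faithful_of_epi [IsFiniteModuleCategory k C M] {P : C} (π : P ⟶ 𝟙_ C) [Epi π] :
    (actionLeft M P).Faithful := by
  have := actionLeft_additive k (M := M) P
  refine ⟨fun {m n f g} h => ?_⟩
  have := IsFiniteModuleCategory.rightExact_left k (C := C) m
  have : Epi (π ⊵ₗ m) := inferInstanceAs (Epi ((actionRight C m).map π))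
  rw [← cancel_epi (λₗ[C] m).hom, ← cancel_epi (π ⊵ₗ m)]
  have hf := action_exchange π f
  have hg := action_exchange π g
  simp only [unit_actionHomRight] at hf hg
  rw [← cancel_mono (λₗ[C] n).inv]
  simp only [Category.assoc]
  rw [← hf, ← hg]
  exact congrArg (· ≫ π ⊵ₗ n) h

lemma epi_action [IsFiniteModuleCategory k C M] (X : C) {m n : M} (f : m ⟶ n) [Epi f] :
    Epi (X ⊴ₗ f) :=
  have : PreservesFiniteColimits (actionLeft M X) := IsFiniteModuleCategory.rightExact_right k X
  inferInstanceAs (Epi ((actionLeft M X).map f))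

lemma action_zero [IsBilinearAction k C M] (X : C) (m n : M) : X ⊴ₗ (0 : m ⟶ n) = 0 :=
  have := actionLeft_additive k (M := M) X
  (actionLeft M X).map_zero m n

variable [RightRigidCategory C] [IsExactModuleCategory k C M]

/-- For a projective P covering 𝟙, the sequence P ⊙ S is exact with projective last term, hence
split, and F preserves it. By C-linearity its image is P ⊙ F(S), and the faithful functor P ⊙ -
reflects exactness. Only additivity of F is needed. -/
lemma map_shortExact_of_leftLinear (hC : IsFiniteAbelian k C) {M' : Type u₃} [Category.{v₃} M']
    [Abelian M'] [Linear k M'] [MonoidalLeftAction C M'] [IsFiniteModuleCategory k C M']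
    (F : M ⥤ M') [F.Additive] [F.LeftLinear C]
    (S : ShortComplex M) (hS : S.ShortExact) : (S.map F).ShortExact := by
  obtain ⟨P, π, hP, _⟩ := hC.exists_projective_epi (𝟙_ C)
  have := actionLeft_additive k (M := M) P
  have := actionLeft_additive k (M := M') P
  have := actionLeft_faithful_of_epi k (M := M') π
  have : PreservesFiniteColimits (actionLeft M P) :=
    IsFiniteModuleCategory.rightExact_right k P
  have : PreservesFiniteLimits (actionLeft M P) :=
    actionAdjunction (M := M) P Pᘁ |>.rightAdjoint_preservesLimits.{0, 0}.preservesFiniteLimits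
  have h1 : (S.map (actionLeft M P)).ShortExact := hS.map_of_exact _
  have : Projective (S.map (actionLeft M P)).X₃ :=
    IsExactModuleCategory.projective_action k P S.X₃ hP
  have h2 : ((S.map (actionLeft M P)).map F).ShortExact := (h1.splittingOfProjective.map F).shortExact
  refine ShortExact.reflects_shortExact_of_faithful (actionLeft M' P) ?_
  refine ShortComplex.shortExact_of_iso (ShortComplex.isoMk
    (Functor.LeftLinear.μₗIso F P S.X₁).symm (Functor.LeftLinear.μₗIso F P S.X₂).symm
    (Functor.LeftLinear.μₗIso F P S.X₃).symm ?_ ?_) h2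
  · exact (δₗ_naturality_right F P S.f).symm
  · exact (δₗ_naturality_right F P S.g).symm

/-- Additive module functors on an exact module category are exact. -/
lemma exact_of_leftLinear (hC : IsFiniteAbelian k C) {M' : Type u₃} [Category.{v₃} M']
    [Abelian M'] [Linear k M'] [MonoidalLeftAction C M'] [IsFiniteModuleCategory k C M']
    (F : M ⥤ M') [F.Additive] [F.LeftLinear C] :
    PreservesFiniteLimits F ∧ PreservesFiniteColimits F :=
  ((Functor.exact_tfae F).out 0 3).1 (map_shortExact_of_leftLinear k hC F)

end Exact

/-! ### The dual category is abelian -/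

namespace DualCategory

section Pointwise

variable {k : Type w} [Field k] {C : Type u₁} [Category.{v₁} C] [MonoidalCategory C]
  {M : Type u₂} [Category.{v₂} M] [Preadditive M] [Linear k M] [MonoidalLeftAction C M]
  {F G : DualCategory k C M}

/-- Factorization through a pointwise monomorphism. -/
lemma exists_lift {T : DualCategory k C M} (f : F ⟶ G) (hf : ∀ m, Mono (f.natTrans.app m))
    (h : T ⟶ G) (hl : ∀ m, ∃ l, l ≫ f.natTrans.app m = h.natTrans.app m) :
    ∃ t : T ⟶ F, t ≫ f = h := by
  choose l hl using hl
  refine ⟨⟨{ app := l, naturality := fun m n g => ?_ }, fun X m => ?_⟩, hom_ext_app hl⟩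
  · rw [← cancel_mono (f.natTrans.app n), Category.assoc, Category.assoc, hl,
      natTrans_naturality f g, ← Category.assoc, hl, natTrans_naturality h g]
  · rw [← cancel_mono (f.natTrans.app _), Category.assoc, Category.assoc, hl, ← f.comm,
      ← actionHomRight_comp_assoc, hl, h.comm]

lemma mono_of_mono_app (f : F ⟶ G) (hf : ∀ m, Mono (f.natTrans.app m)) : Mono f where
  right_cancellation a b h := hom_ext_app fun m => by
    have := hf m
    exact (cancel_mono (f.natTrans.app m)).1 (congrArg (fun t => t.natTrans.app m) h)

lemma epi_of_epi_app (f : F ⟶ G) (hf : ∀ m, Epi (f.natTrans.app m)) : Epi f where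
  left_cancellation a b h := hom_ext_app fun m => by
    have := hf m
    exact (cancel_epi (f.natTrans.app m)).1 (congrArg (fun t => t.natTrans.app m) h)

end Pointwise

section PointwiseExact

variable {k : Type w} [Field k] {C : Type u₁} [Category.{v₁} C] [Abelian C] [Linear k C]
  [MonoidalCategory C] {M : Type u₂} [Category.{v₂} M] [Abelian M] [Linear k M]
  [MonoidalLeftAction C M] [IsFiniteModuleCategory k C M] {F G : DualCategory k C M}

/-- Factorization through a pointwise epimorphism. -/
lemma exists_desc {T : DualCategory k C M} (f : F ⟶ G) (hf : ∀ m, Epi (f.natTrans.app m))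
    (h : F ⟶ T) (hl : ∀ m, ∃ l, f.natTrans.app m ≫ l = h.natTrans.app m) :
    ∃ t : G ⟶ T, f ≫ t = h := by
  choose l hl using hl
  refine ⟨⟨{ app := l, naturality := fun m n g => ?_ }, fun X m => ?_⟩, hom_ext_app hl⟩
  · rw [← cancel_epi (f.natTrans.app m), ← Category.assoc, ← natTrans_naturality f g,
      Category.assoc, hl, natTrans_naturality h g, ← Category.assoc, hl]
  · have := epi_action k X (f.natTrans.app m)
    rw [← cancel_epi (X ⊴ₗ f.natTrans.app m), ← actionHomRight_comp_assoc, hl, h.comm, ← hl,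
      reassoc_of% f.comm]

/-- A pointwise monomorphism that is pointwise a kernel is a kernel. -/
lemma nonempty_isLimit_kernelFork {K : DualCategory k C M} (f : F ⟶ G) (ι : K ⟶ F)
    (h : ∀ m, Mono (ι.natTrans.app m)) (w : ι ≫ f = 0)
    (hl : ∀ {m T : M} (h : T ⟶ F.toFunctor.obj m), h ≫ f.natTrans.app m = 0 →
        ∃ l, l ≫ ι.natTrans.app m = h) : Nonempty (IsLimit (KernelFork.ofι ι w)) := by
  have := mono_of_mono_app ι h
  choose l hl using fun {T : DualCategory k C M} (t : T ⟶ F) (ht : t ≫ f = 0) =>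
    exists_lift ι h t fun m => hl (t.natTrans.app m) (congrArg (fun t => t.natTrans.app m) ht)
  exact ⟨KernelFork.IsLimit.ofι ι w (fun t ht => l t ht) (fun t ht => hl t ht)
    (fun t ht s hs => by rw [← cancel_mono ι, hs, hl])⟩

/-- A pointwise epimorphism that is pointwise a cokernel is a cokernel. -/
lemma nonempty_isColimit_cokernelCofork {K : DualCategory k C M} (f : F ⟶ G) (π : G ⟶ K)
    (h : ∀ m, Epi (π.natTrans.app m)) (w : f ≫ π = 0)
    (hl : ∀ {m T : M} (h : G.toFunctor.obj m ⟶ T), f.natTrans.app m ≫ h = 0 →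
        ∃ l, π.natTrans.app m ≫ l = h) : Nonempty (IsColimit (CokernelCofork.ofπ π w)) := by
  have := epi_of_epi_app π h
  choose l hl using fun {T : DualCategory k C M} (t : G ⟶ T) (ht : f ≫ t = 0) =>
    exists_desc π h t fun m => hl (t.natTrans.app m) (congrArg (fun t => t.natTrans.app m) ht)
  exact ⟨CokernelCofork.IsColimit.ofπ π w (fun t ht => l t ht) (fun t ht => hl t ht)
    (fun t ht s hs => by rw [← cancel_epi π, hs, hl])⟩

end PointwiseExact

variable {k : Type w} [Field k] {C : Type u₁} [Category.{v₁} C] [Abelian C] [Linear k C]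
  [MonoidalCategory C] {M : Type u₂} [Category.{v₂} M] [Abelian M] [Linear k M]
  [MonoidalLeftAction C M] [RightRigidCategory C] [IsFiniteMultiTensorCategory k C]
  [IsExactModuleCategory k C M]

/-- An additive `k`-linear lax module functor as an object of the dual category. -/
abbrev ofLax (G : M ⥤ M) (h : G.LaxLeftLinear C) [G.Additive] [G.Linear k] :
    DualCategory k C M where
  toFunctor := G
  leftLinear := leftLinearOfLax G
  -- Exactness is automatic, so only an additive k-linear lax module functor has to be supplied.
  rightExact :=
    letI : G.LeftLinear C := leftLinearOfLax G
    (exact_of_leftLinear k (C := C) (IsFiniteMultiTensorCategory.finiteAbelian (k := k)) G).2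

/-- A functor with a jointly monomorphic family of natural transformations to objects of the
dual category and a compatible action. -/
@[reducible]
def ofJointlyMono {I : Type} (F : I → DualCategory k C M) (K : M ⥤ M)
    (ι : ∀ i, K ⟶ (F i).toFunctor)
    (hι : ∀ {T m : M} (a b : T ⟶ K.obj m), (∀ i, a ≫ (ι i).app m = b ≫ (ι i).app m) → a = b)
    (μ : ∀ (X : C) (m : M), X ⊙ₗ K.obj m ⟶ K.obj (X ⊙ₗ m))
    (hμ : ∀ X m i, μ X m ≫ (ι i).app (X ⊙ₗ m) = X ⊴ₗ (ι i).app m ≫ μₗ (F i).toFunctor X m) :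
    DualCategory k C M :=
  have : K.Additive := ⟨fun {m n f g} => hι _ _ fun i => by
    rw [Preadditive.add_comp, NatTrans.naturality, NatTrans.naturality, NatTrans.naturality,
      Functor.map_add, Preadditive.comp_add]⟩
  have : K.Linear k := ⟨fun {m n} f r => hι _ _ fun i => by
    rw [Linear.smul_comp, NatTrans.naturality, NatTrans.naturality,
      Functor.map_smul, Linear.comp_smul]⟩
  ofLax K
    { μₗ := μ
      μₗ_naturality_left := fun {X Y} g m => hι _ _ fun i => by
        rw [Category.assoc, Category.assoc, hμ, NatTrans.naturality, reassoc_of% hμ,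
          ← action_exchange_assoc, μₗ_naturality_left]
      μₗ_naturality_right := fun X {m n} g => hι _ _ fun i => by
        rw [Category.assoc, Category.assoc, hμ, NatTrans.naturality, reassoc_of% hμ,
          ← actionHomRight_comp_assoc, NatTrans.naturality, actionHomRight_comp_assoc,
          μₗ_naturality_right]
      μₗ_associativity := fun X Y m => hι _ _ fun i => by
        simp only [Category.assoc]
        rw [NatTrans.naturality, hμ, reassoc_of% hμ, ← actionHomRight_comp_assoc, hμ,
          μₗ_associativity, actionHomRight_comp_assoc, tensor_actionHomRight]
        simp
      μₗ_unitality := fun m => hι _ _ fun i => by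
        rw [Category.assoc, NatTrans.naturality, reassoc_of% hμ, ← μₗ_unitality,
          unit_actionHomRight]
        simp }

/-- A functor with a pointwise epimorphism from an object of the dual category and a compatible
action. -/
@[reducible]
def ofEpi (F : DualCategory k C M) (K : M ⥤ M) (π : F.toFunctor ⟶ K)
    (hπ : ∀ m, Epi (π.app m))
    (μ : ∀ (X : C) (m : M), X ⊙ₗ K.obj m ⟶ K.obj (X ⊙ₗ m))
    (hμ : ∀ X m, X ⊴ₗ π.app m ≫ μ X m = μₗ F.toFunctor X m ≫ π.app (X ⊙ₗ m)) :
    DualCategory k C M :=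
  have : K.Additive := ⟨fun {m n f g} => by
    have := hπ m
    rw [← cancel_epi (π.app m), Preadditive.comp_add, ← NatTrans.naturality,
      ← NatTrans.naturality, ← NatTrans.naturality, Functor.map_add, Preadditive.add_comp]⟩
  have : K.Linear k := ⟨fun {m n} f r => by
    have := hπ m
    rw [← cancel_epi (π.app m), Linear.comp_smul, ← NatTrans.naturality, ← NatTrans.naturality,
      Functor.map_smul, Linear.smul_comp]⟩
  have hX (X : C) (m : M) : Epi (X ⊴ₗ π.app m) := have := hπ m; epi_action k X _
  ofLax K
    { μₗ := μ
      μₗ_naturality_left := fun {X Y} g m => by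
        have := hX X m
        rw [← cancel_epi (X ⊴ₗ π.app m), reassoc_of% hμ, ← NatTrans.naturality,
          action_exchange_assoc, hμ, μₗ_naturality_left_assoc]
      μₗ_naturality_right := fun X {m n} g => by
        have := hX X m
        rw [← cancel_epi (X ⊴ₗ π.app m), reassoc_of% hμ, ← NatTrans.naturality,
          ← actionHomRight_comp_assoc, ← NatTrans.naturality, actionHomRight_comp_assoc, hμ,
          μₗ_naturality_right_assoc]
      μₗ_associativity := fun X Y m => by
        have := hX (X ⊗ Y) m
        have h1 : (X ⊗ Y) ⊴ₗ π.app m ≫ (αₗ X Y (K.obj m)).hom =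
            (αₗ X Y (F.toFunctor.obj m)).hom ≫ X ⊴ₗ Y ⊴ₗ π.app m := by
          rw [tensor_actionHomRight]
          simp
        rw [← cancel_epi ((X ⊗ Y) ⊴ₗ π.app m), reassoc_of% hμ, reassoc_of% h1,
          ← NatTrans.naturality, ← actionHomRight_comp_assoc, hμ, actionHomRight_comp_assoc, hμ,
          μₗ_associativity_assoc]
      μₗ_unitality := fun m => by
        have := hX (𝟙_ C) m
        rw [← cancel_epi (𝟙_ C ⊴ₗ π.app m), reassoc_of% hμ, ← NatTrans.naturality,
          unit_actionHomRight, ← μₗ_unitality_assoc]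
        simp }

/-! ### Kernels, cokernels and biproducts, all computed pointwise -/

variable {F G : DualCategory k C M}

lemma exists_kernel (f : F ⟶ G) : ∃ (K : DualCategory k C M) (ι : K ⟶ F),
    ∀ m, Mono (ι.natTrans.app m) ∧ ι.natTrans.app m ≫ f.natTrans.app m = 0 ∧
      ∀ {T : M} (h : T ⟶ F.toFunctor.obj m), h ≫ f.natTrans.app m = 0 →
        ∃ l, l ≫ ι.natTrans.app m = h := by
  let K : M ⥤ M :=
    { obj m := kernel (f.natTrans.app m)
      map {m n} g := kernel.map _ _ (F.toFunctor.map g) (G.toFunctor.map g)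
        (natTrans_naturality f g).symm
      map_id m := by
        rw [← cancel_mono (kernel.ι _)]
        simp
      map_comp g h := by
        rw [← cancel_mono (kernel.ι _)]
        simp }
  let ι : K ⟶ F.toFunctor :=
    { app m := kernel.ι (f.natTrans.app m)
      naturality m n g := kernel.lift_ι _ _ _ }
  have hι (m : M) : Mono (ι.app m) := inferInstanceAs (Mono (kernel.ι (f.natTrans.app m)))
  have hw (m : M) : ι.app m ≫ f.natTrans.app m = 0 := kernel.condition _
  have hl {T m : M} (h : T ⟶ F.toFunctor.obj m) (w : h ≫ f.natTrans.app m = 0) :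
      ∃ l, l ≫ ι.app m = h := ⟨kernel.lift _ h w, kernel.lift_ι _ _ _⟩
  -- The module structure of the kernel is the restriction of that of F; its axioms follow because
  -- the inclusion is monic.
  choose μ hμ using fun (X : C) (m : M) => hl (X ⊴ₗ ι.app m ≫ μₗ F.toFunctor X m) (by
    rw [Category.assoc, ← f.comm, ← actionHomRight_comp_assoc, hw, action_zero k, zero_comp])
  refine ⟨ofJointlyMono (fun _ : Unit => F) K (fun _ => ι)
    (fun {T m} a b h => (cancel_mono (ι.app m)).1 (h ())) μ (fun X m _ => hμ X m),
    ⟨ι, fun X m => (hμ X m).symm⟩, fun m => ⟨hι m, hw m, hl⟩⟩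

lemma exists_cokernel (f : F ⟶ G) : ∃ (K : DualCategory k C M) (π : G ⟶ K),
    ∀ m, Epi (π.natTrans.app m) ∧ f.natTrans.app m ≫ π.natTrans.app m = 0 ∧
      ∀ {T : M} (h : G.toFunctor.obj m ⟶ T), f.natTrans.app m ≫ h = 0 →
        ∃ l, π.natTrans.app m ≫ l = h := by
  let K : M ⥤ M :=
    { obj m := cokernel (f.natTrans.app m)
      map {m n} g := cokernel.map _ _ (F.toFunctor.map g) (G.toFunctor.map g)
        (natTrans_naturality f g).symm
      map_id m := by
        rw [← cancel_epi (cokernel.π _)]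
        simp
      map_comp g h := by
        rw [← cancel_epi (cokernel.π _)]
        simp }
  let π : G.toFunctor ⟶ K :=
    { app m := cokernel.π (f.natTrans.app m)
      naturality m n g := (cokernel.π_desc _ _ _).symm }
  have hπ (m : M) : Epi (π.app m) := inferInstanceAs (Epi (cokernel.π (f.natTrans.app m)))
  have hw (m : M) : f.natTrans.app m ≫ π.app m = 0 := cokernel.condition _
  -- The action of X preserves the pointwise cokernels, so the structure of G descends to X ⊙ K.
  have hX (X : C) {T m : M} (h : X ⊙ₗ G.toFunctor.obj m ⟶ T) (w : X ⊴ₗ f.natTrans.app m ≫ h = 0) :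
      ∃ l, X ⊴ₗ π.app m ≫ l = h := by
    have : PreservesFiniteColimits (actionLeft M X) := IsFiniteModuleCategory.rightExact_right k X
    have := actionLeft_additive k (M := M) X
    refine ⟨(PreservesCokernel.iso (actionLeft M X) (f.natTrans.app m)).hom ≫
      cokernel.desc _ h w, ?_⟩
    have h1 := PreservesCokernel.π_iso_hom (actionLeft M X) (f.natTrans.app m)
    exact (Category.assoc _ _ _).symm.trans
      ((congrArg (· ≫ cokernel.desc _ h w) h1).trans (cokernel.π_desc _ _ _))
  choose μ hμ using fun (X : C) (m : M) => hX X (μₗ G.toFunctor X m ≫ π.app (X ⊙ₗ m)) (by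
    rw [reassoc_of% f.comm, hw, comp_zero])
  exact ⟨ofEpi G K π hπ μ hμ, ⟨π, hμ⟩, fun m => ⟨hπ m, hw m, fun h w =>
    ⟨cokernel.desc _ h w, cokernel.π_desc _ _ _⟩⟩⟩

/-- The kernel of a monomorphism vanishes, and kernels are pointwise. -/
lemma mono_app_of_mono (f : F ⟶ G) [Mono f] (m : M) : Mono (f.natTrans.app m) := by
  obtain ⟨K, ι, hι⟩ := exists_kernel f
  have h : ι = 0 := by
    rw [← cancel_mono f, zero_comp]
    exact hom_ext_app fun m => (hι m).2.1
  refine Preadditive.mono_of_cancel_zero _ fun {T} g hg => ?_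
  obtain ⟨l, rfl⟩ := (hι m).2.2 g hg
  rw [show ι.natTrans.app m = 0 from congrArg (fun t => t.natTrans.app m) h, comp_zero]

lemma epi_app_of_epi (f : F ⟶ G) [Epi f] (m : M) : Epi (f.natTrans.app m) := by
  obtain ⟨K, π, hπ⟩ := exists_cokernel f
  have h : π = 0 := by
    rw [← cancel_epi f, comp_zero]
    exact hom_ext_app fun m => (hπ m).2.1
  refine Preadditive.epi_of_cancel_zero _ fun {T} g hg => ?_
  obtain ⟨l, rfl⟩ := (hπ m).2.2 g hg
  rw [show π.natTrans.app m = 0 from congrArg (fun t => t.natTrans.app m) h, zero_comp]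

instance : HasKernels (DualCategory k C M) where
  has_limit f := by
    obtain ⟨K, ι, hι⟩ := exists_kernel f
    obtain ⟨hK⟩ := nonempty_isLimit_kernelFork f ι (fun m => (hι m).1)
      (hom_ext_app fun m => (hι m).2.1) fun {m} {T} h hh => (hι m).2.2 h hh
    exact ⟨⟨_, hK⟩⟩

instance : HasCokernels (DualCategory k C M) where
  has_colimit f := by
    obtain ⟨K, π, hπ⟩ := exists_cokernel f
    obtain ⟨hK⟩ := nonempty_isColimit_cokernelCofork f π (fun m => (hπ m).1)
      (hom_ext_app fun m => (hπ m).2.1) fun {m} {T} h hh => (hπ m).2.2 h hh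
    exact ⟨⟨_, hK⟩⟩

/-- A monomorphism is pointwise monic, hence pointwise the kernel of its cokernel, and pointwise
kernels are kernels. -/
instance : IsNormalMonoCategory (DualCategory k C M) where
  normalMonoOfMono f _ := by
    obtain ⟨K, π, hπ⟩ := exists_cokernel f
    have hf := mono_app_of_mono f
    obtain ⟨hK⟩ := nonempty_isLimit_kernelFork π f hf (hom_ext_app fun m => (hπ m).2.1)
      fun {m} {T} h hh => by
        obtain ⟨l, hl⟩ := (hπ m).2.2 (cokernel.π (f.natTrans.app m)) (cokernel.condition _)
        have h0 : h ≫ cokernel.π (f.natTrans.app m) = 0 := by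
          rw [← hl, ← Category.assoc, hh, zero_comp]
        exact ⟨Abelian.monoLift (f.natTrans.app m) h h0, Abelian.monoLift_comp _ _ _⟩
    exact ⟨⟨K, π, _, hK⟩⟩

instance : IsNormalEpiCategory (DualCategory k C M) where
  normalEpiOfEpi f _ := by
    obtain ⟨K, ι, hι⟩ := exists_kernel f
    have hf := epi_app_of_epi f
    obtain ⟨hK⟩ := nonempty_isColimit_cokernelCofork ι f hf (hom_ext_app fun m => (hι m).2.1)
      fun {m} {T} h hh => by
        obtain ⟨l, hl⟩ := (hι m).2.2 (kernel.ι (f.natTrans.app m)) (kernel.condition _)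
        have h0 : kernel.ι (f.natTrans.app m) ≫ h = 0 := by
          rw [← hl, Category.assoc, hh, comp_zero]
        exact ⟨Abelian.epiDesc (f.natTrans.app m) h h0, Abelian.comp_epiDesc _ _ _⟩
    exact ⟨⟨K, ι, _, hK⟩⟩

instance : HasZeroObject (DualCategory k C M) := by
  obtain ⟨K, ι, hι⟩ := exists_kernel (𝟙 (unit : DualCategory k C M))
  refine ⟨K, (IsZero.iff_id_eq_zero K).2 (hom_ext_app fun m => ?_)⟩
  have := (hι m).1
  have h : ι.natTrans.app m = 0 := (Category.comp_id _).symm.trans (hι m).2.1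
  rw [← cancel_mono (ι.natTrans.app m), h]
  simp

instance : HasBinaryBiproducts (DualCategory k C M) where
  has_binary_biproduct F G := by
    let K : M ⥤ M := F.toFunctor ⊞ G.toFunctor
    let p : K ⟶ F.toFunctor := biprod.fst
    let q : K ⟶ G.toFunctor := biprod.snd
    let i : F.toFunctor ⟶ K := biprod.inl
    let j : G.toFunctor ⟶ K := biprod.inr
    have ip (m : M) : i.app m ≫ p.app m = 𝟙 _ := NatTrans.congr_app biprod.inl_fst m
    have iq (m : M) : i.app m ≫ q.app m = 0 := NatTrans.congr_app biprod.inl_snd m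
    have jp (m : M) : j.app m ≫ p.app m = 0 := NatTrans.congr_app biprod.inr_fst m
    have jq (m : M) : j.app m ≫ q.app m = 𝟙 _ := NatTrans.congr_app biprod.inr_snd m
    have tot (m : M) : p.app m ≫ i.app m + q.app m ≫ j.app m = 𝟙 _ :=
      NatTrans.congr_app (biprod.total (X := F.toFunctor) (Y := G.toFunctor)) m
    have hext {T m : M} (a b : T ⟶ K.obj m) (h1 : a ≫ p.app m = b ≫ p.app m)
        (h2 : a ≫ q.app m = b ≫ q.app m) : a = b := by
      rw [← Category.comp_id a, ← Category.comp_id b, ← tot, Preadditive.comp_add,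
        Preadditive.comp_add, reassoc_of% h1, reassoc_of% h2]
    let FG : Bool → DualCategory k C M := fun b => cond b F G
    let μ (X : C) (m : M) : X ⊙ₗ K.obj m ⟶ K.obj (X ⊙ₗ m) :=
      X ⊴ₗ p.app m ≫ μₗ F.toFunctor X m ≫ i.app _ + X ⊴ₗ q.app m ≫ μₗ G.toFunctor X m ≫ j.app _
    have hp (X : C) (m : M) : μ X m ≫ p.app _ = X ⊴ₗ p.app m ≫ μₗ F.toFunctor X m := by
      simp [μ, ip, jp]
    have hq (X : C) (m : M) : μ X m ≫ q.app _ = X ⊴ₗ q.app m ≫ μₗ G.toFunctor X m := by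
      simp [μ, iq, jq]
    let B : DualCategory k C M := ofJointlyMono FG K (fun b => match b with
      | true => p
      | false => q) (fun a b h => hext a b (h true) (h false)) μ (fun X m b => match b with
      | true => hp X m
      | false => hq X m)
    have hi (X : C) (m : M) : X ⊴ₗ i.app m ≫ μ X m = μₗ F.toFunctor X m ≫ i.app _ := by
      apply hext
      · rw [Category.assoc, Category.assoc, hp, ip, ← actionHomRight_comp_assoc, ip]
        simp
      · rw [Category.assoc, Category.assoc, hq, iq, ← actionHomRight_comp_assoc, iq,
          action_zero k]
        simp
    have hj (X : C) (m : M) : X ⊴ₗ j.app m ≫ μ X m = μₗ G.toFunctor X m ≫ j.app _ := by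
      apply hext
      · rw [Category.assoc, Category.assoc, hp, jp, ← actionHomRight_comp_assoc, jp,
          action_zero k]
        simp
      · rw [Category.assoc, Category.assoc, hq, jq, ← actionHomRight_comp_assoc, jq]
        simp
    let bic : BinaryBicone F G :=
      { pt := B
        fst := ⟨p, fun X m => (hp X m).symm⟩
        snd := ⟨q, fun X m => (hq X m).symm⟩
        inl := ⟨i, hi⟩
        inr := ⟨j, hj⟩
        inl_fst := hom_ext_app ip
        inl_snd := hom_ext_app iq
        inr_fst := hom_ext_app jp
        inr_snd := hom_ext_app jq }
    exact hasBinaryBiproduct_of_total bic (hom_ext_app tot)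

instance : Abelian (DualCategory k C M) where
  has_finite_products := hasFiniteProducts_of_has_binary_and_terminal

end DualCategory

/-! ### A projective generator of the dual category -/

lemma rightAdjoint_linear {k : Type w} [Field k] {A : Type u₁} [Category.{v₁} A] [Preadditive A]
    [Linear k A] {B : Type u₂} [Category.{v₂} B] [Preadditive B] [Linear k B] {F : A ⥤ B}
    {G : B ⥤ A} (adj : F ⊣ G) [F.Additive] [F.Linear k] [G.Additive] : G.Linear k where
  map_smul f r := (adj.homEquiv _ _).symm.injective (by
    simp [Adjunction.homEquiv_counit, Functor.map_smul])

/-! ### The module functor representing F ↦ Hom(n, F m) -/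

namespace InternalHom

variable {C : Type u₁} [Category.{v₁} C] [MonoidalCategory C]
  {M : Type u₂} [Category.{v₂} M] [MonoidalLeftAction C M] (H : InternalHom C M) (m n : M)

/-- The functor `iHom(m, -) ⊙ₗ n`. -/
def homAction : M ⥤ M where
  obj m' := H.hom m m' ⊙ₗ n
  map f := H.post m f ⊵ₗ n
  map_id m' := by simp [post]
  map_comp f g := by simp [post_comp]

/-- The module structure of the functor `iHom(m, -) ⊙ₗ n`. -/
def homActionStr (X : C) (m' : M) : X ⊙ₗ (H.hom m m' ⊙ₗ n) ⟶ H.hom m (X ⊙ₗ m') ⊙ₗ n :=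
  (αₗ X (H.hom m m') n).inv ≫ H.leftStr X m m' ⊵ₗ n

/-- The functor `iHom(m, -) ⊙ₗ n` is a module functor. -/
@[reducible]
def homActionLax : (H.homAction m n).LaxLeftLinear C where
  μₗ X m' := H.homActionStr m n X m'
  μₗ_naturality_left {X X'} x m' := by
    change x ⊵ₗ (H.hom m m' ⊙ₗ n) ≫ homActionStr _ _ _ _ _ =
      homActionStr _ _ _ _ _ ≫ H.post m (x ⊵ₗ m') ⊵ₗ n
    rw [homActionStr, homActionStr, Category.assoc, ← comp_actionHomLeft, leftStr_post_left]
    simp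
  μₗ_naturality_right X {p q} f := by
    change X ⊴ₗ (H.post m f ⊵ₗ n) ≫ homActionStr _ _ _ _ _ =
      homActionStr _ _ _ _ _ ≫ H.post m (X ⊴ₗ f) ⊵ₗ n
    rw [homActionStr, homActionStr, Category.assoc, ← comp_actionHomLeft, leftStr_post]
    simp
  μₗ_associativity X Y m' := by
    change homActionStr _ _ _ _ _ ≫ H.post m (αₗ X Y m').hom ⊵ₗ n =
      (αₗ X Y (H.hom m m' ⊙ₗ n)).hom ≫ X ⊴ₗ homActionStr _ _ _ _ _ ≫ homActionStr _ _ _ _ _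
    have h : H.leftStr (X ⊗ Y) m m' ≫ H.post m (αₗ X Y m').hom =
      (α_ X Y (H.hom m m')).hom ≫ X ◁ H.leftStr Y m m' ≫ H.leftStr X m (Y ⊙ₗ m') :=
      μₗ_associativity (H.functor m) X Y m'
    have h2 : (αₗ (X ⊗ Y) (H.hom m m') n).inv ≫ (α_ X Y (H.hom m m')).hom ⊵ₗ n ≫
        (αₗ X (Y ⊗ H.hom m m') n).hom =
          (αₗ X Y (H.hom m m' ⊙ₗ n)).hom ≫ X ⊴ₗ (αₗ Y (H.hom m m') n).inv := by
      rw [← cancel_mono (X ⊴ₗ (αₗ Y (H.hom m m') n).hom)]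
      simp [associator_actionHom]
    simp only [homActionStr, Category.assoc]
    rw [← comp_actionHomLeft, h]
    simp [reassoc_of% h2]
  μₗ_unitality m' := by
    change (λₗ (H.hom m m' ⊙ₗ n)).hom = homActionStr _ _ _ _ _ ≫ H.post m (λₗ m').hom ⊵ₗ n
    have h : (λ_ (H.hom m m')).hom = H.leftStr (𝟙_ C) m m' ≫ H.post m (λₗ m').hom :=
      μₗ_unitality (C := C) (H.functor m) m'
    rw [homActionStr, Category.assoc, ← comp_actionHomLeft, ← h]
    simp

/-- The canonical morphism `n ⟶ iHom(m, m) ⊙ₗ n`. -/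
def homActionUnit : n ⟶ H.hom m m ⊙ₗ n := (λₗ n).inv ≫ H.curry (λₗ m).hom ⊵ₗ n

/-- Co-Yoneda: iHom(m, m') ⊙ n is generated by the copy of n at m, under the action of iHom(m, m')
followed by evaluation. -/
lemma homActionUnit_ev (m' : M) : H.hom m m' ⊴ₗ H.homActionUnit m n ≫
    H.homActionStr m n (H.hom m m') m ≫ H.post m (H.ev m m') ⊵ₗ n = 𝟙 _ := by
  have h : (ρ_ (H.hom m m')).inv ≫ H.hom m m' ◁ H.curry (λₗ m).hom ≫ H.leftStr _ m m ≫
      H.post m (H.ev m m') = 𝟙 _ := by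
    rw [reassoc_of% @curry_leftStr, curry_post, comp_curry, ← curry_ev]
    congr 1
    rw [tensor_unit_action, inv_hom_actionHomLeft_assoc]
  have h' := congrArg (fun t => t ⊵ₗ n) h
  simp only [comp_actionHomLeft, id_actionHomLeft] at h'
  rw [← h', homActionUnit, homActionStr]
  simp only [Category.assoc, actionHomRight_comp, whiskerLeft_actionHomLeft]
  rw [← cancel_epi ((ρ_ (H.hom m m')).hom ⊵ₗ n), hom_inv_actionHomLeft_assoc,
    ← tensor_unit_action]
  simp

section

variable {m n} (F : M ⥤ M) [F.LeftLinear C]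

/-- The morphism `iHom(m, m') ⊙ₗ n ⟶ F m'` given by a morphism `n ⟶ F m`. -/
def homActionDesc (g : n ⟶ F.obj m) (m' : M) : H.hom m m' ⊙ₗ n ⟶ F.obj m' :=
  H.hom m m' ⊴ₗ g ≫ μₗ F _ m ≫ F.map (H.ev m m')

lemma homActionDesc_naturality (g : n ⟶ F.obj m) {p q : M} (f : p ⟶ q) :
    H.post m f ⊵ₗ n ≫ H.homActionDesc F g q = H.homActionDesc F g p ≫ F.map f := by
  have h : H.post m f ⊵ₗ m ≫ H.ev m q = H.ev m p ≫ f := by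
    rw [show H.post m f = H.curry (H.ev m p ≫ f) by
      rw [← H.curry_post, H.curry_ev, Category.id_comp], H.curry_action_ev]
  rw [homActionDesc, ← action_exchange_assoc, μₗ_naturality_left_assoc, ← F.map_comp, h]
  simp [homActionDesc]

lemma homActionDesc_action (g : n ⟶ F.obj m) (X : C) (m' : M) :
    X ⊴ₗ H.homActionDesc F g m' ≫ μₗ F X m' =
      H.homActionStr m n X m' ≫ H.homActionDesc F g (X ⊙ₗ m') := by
  have h : H.leftStr X m m' ⊵ₗ m ≫ H.ev m (X ⊙ₗ m') =
      (αₗ X (H.hom m m') m).hom ≫ X ⊴ₗ H.ev m m' := H.curry_action_ev _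
  rw [homActionStr, homActionDesc, homActionDesc, Category.assoc, ← action_exchange_assoc,
    μₗ_naturality_left_assoc, ← F.map_comp, h, F.map_comp,
    μₗ_associativity_assoc, tensor_actionHomRight]
  simp

lemma homActionUnit_desc (g : n ⟶ F.obj m) :
    H.homActionUnit m n ≫ H.homActionDesc F g m = g := by
  rw [homActionUnit, homActionDesc, Category.assoc, ← action_exchange_assoc,
    μₗ_naturality_left_assoc, ← F.map_comp, H.curry_action_ev, ← μₗ_unitality]
  simp

/-- C-linearity for X = iHom(m, m') and naturality along the evaluation recover the whole
transformation from its restriction to n. -/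
lemma homActionDesc_unit (φ : ∀ m' : M, H.hom m m' ⊙ₗ n ⟶ F.obj m')
    (hφ : ∀ {p q : M} (f : p ⟶ q), H.post m f ⊵ₗ n ≫ φ q = φ p ≫ F.map f)
    (hμ : ∀ (X : C) (m' : M), X ⊴ₗ φ m' ≫ μₗ F X m' = H.homActionStr m n X m' ≫ φ (X ⊙ₗ m'))
    (m' : M) : H.homActionDesc F (H.homActionUnit m n ≫ φ m) m' = φ m' := by
  have h := H.homActionUnit_ev m n m'
  rw [homActionDesc, actionHomRight_comp_assoc, reassoc_of% hμ, ← hφ, reassoc_of% h]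

end

section Linear

variable {k : Type w} [Field k] [Preadditive C] [Linear k C] [Preadditive M] [Linear k M]

lemma functor_additive [IsBilinearAction k C M] : (H.functor m).Additive :=
  have := actionRight_additive k (C := C) m
  (H.adj m).right_adjoint_additive

lemma functor_linear [IsBilinearAction k C M] : (H.functor m).Linear k :=
  have := actionRight_additive k (C := C) m
  have := actionRight_linear k (C := C) m
  have := H.functor_additive (k := k) m
  rightAdjoint_linear (H.adj m)

lemma homAction_additive [IsBilinearAction k C M] : (H.homAction m n).Additive where
  map_add {p q f g} := by
    have := H.functor_additive (k := k) m
    change (H.functor m).map (f + g) ⊵ₗ n = (H.functor m).map f ⊵ₗ n + (H.functor m).map g ⊵ₗ n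
    rw [Functor.map_add, IsBilinearAction.add_action k]

lemma homAction_linear [IsBilinearAction k C M] : (H.homAction m n).Linear k where
  map_smul {p q} f r := by
    have := H.functor_additive (k := k) m
    have := H.functor_linear (k := k) m
    change (H.functor m).map (r • f) ⊵ₗ n = r • (H.functor m).map f ⊵ₗ n
    rw [Functor.map_smul, IsBilinearAction.smul_action]

end Linear

/-- Every morphism P ⟶ m' factors through the evaluation, and P is a separator. -/
lemma epi_ev {k : Type w} [Field k] [Preadditive M] [Linear k M] {P : M} (hP : IsProjectiveGenerator k P) (m' : M) : Epi (H.ev P m') :=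
  Preadditive.epi_of_cancel_zero _ fun h hh => hP.separator h fun g => by
    rw [← cancel_epi (λₗ[C] P).hom, ← Category.assoc, ← H.curry_action_ev ((λₗ[C] P).hom ≫ g),
      Category.assoc, hh, comp_zero, comp_zero]

end InternalHom

namespace DualCategory

variable {k : Type w} [Field k] {C : Type u₁} [Category.{v₁} C] [Abelian C] [Linear k C]
  [MonoidalCategory C] {M : Type u₂} [Category.{v₂} M] [Abelian M] [Linear k M]
  [MonoidalLeftAction C M] [RightRigidCategory C] [IsFiniteMultiTensorCategory k C]
  [IsExactModuleCategory k C M] (H : InternalHom C M) (m n : M)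

variable (k) in
/-- The functor `iHom(m, -) ⊙ₗ n` as an object of the dual category. -/
def homActionObj : DualCategory k C M :=
  have := H.homAction_additive (k := k) m n
  have := H.homAction_linear (k := k) m n
  ofLax (H.homAction m n) (H.homActionLax m n)

variable {m n} {F : DualCategory k C M}

/-- The morphism from `iHom(m, -) ⊙ₗ n` given by a morphism `n ⟶ F m`. -/
def ofElem (g : n ⟶ F.toFunctor.obj m) : homActionObj k H m n ⟶ F where
  natTrans :=
    { app m' := H.homActionDesc F.toFunctor g m'
      naturality _ _ f := H.homActionDesc_naturality F.toFunctor g f }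
  comm X m' := H.homActionDesc_action F.toFunctor g X m'

/-- The morphism `n ⟶ F m` corresponding to a morphism from `iHom(m, -) ⊙ₗ n`. -/
def elem (φ : homActionObj k H m n ⟶ F) : n ⟶ F.toFunctor.obj m :=
  H.homActionUnit m n ≫ φ.natTrans.app m

lemma elem_ofElem (g : n ⟶ F.toFunctor.obj m) : elem H (ofElem H g) = g :=
  H.homActionUnit_desc F.toFunctor g

lemma ofElem_elem (φ : homActionObj k H m n ⟶ F) : ofElem H (elem H φ) = φ :=
  hom_ext_app fun m' => H.homActionDesc_unit F.toFunctor (fun m' => φ.natTrans.app m')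
    (fun f => natTrans_naturality φ f) φ.comm m'

lemma elem_comp {G : DualCategory k C M} (φ : homActionObj k H m n ⟶ F) (f : F ⟶ G) :
    elem H (φ ≫ f) = elem H φ ≫ f.natTrans.app m := (Category.assoc _ _ _).symm

lemma elem_injective {φ ψ : homActionObj k H m n ⟶ F} (h : elem H φ = elem H ψ) : φ = ψ := by
  rw [← ofElem_elem H φ, h, ofElem_elem]

/-- Everything is read off from Hom(iHom(P, -) ⊙ P, F) ≅ Hom(P, F P). Projectivity uses that
epimorphisms of the dual category are pointwise. -/
lemma isProjectiveGenerator_homActionObj {P : M} (hP : IsProjectiveGenerator k P) :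
    IsProjectiveGenerator k (homActionObj k H P P) where
  projective :=
    { factors := fun {E G} f e _ => by
        have := epi_app_of_epi e P
        obtain ⟨g, hg⟩ := hP.exists_lift (e.natTrans.app P) (elem H f)
        exact ⟨ofElem H g, elem_injective H (by rw [elem_comp, elem_ofElem, hg])⟩ }
  separator {F G} f h := by
    have h0 : f.natTrans.app P = 0 := hP.separator _ fun g => by
      have := congrArg (elem H) (h (ofElem H g))
      rw [elem_comp, elem_ofElem] at this
      rw [this]
      exact comp_zero
    refine hom_ext_app fun m => ?_
    have := H.epi_ev hP m
    -- Vanishing at P spreads to iHom(P, m) ⊙ P by C-linearity, and then to m along F(ev), which is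
    -- epic by right exactness.
    have hz : f.natTrans.app (H.hom P m ⊙ₗ P) = 0 := by
      rw [← cancel_epi (μₗ F.toFunctor (H.hom P m) P), ← f.comm, h0, action_zero k, zero_comp,
        comp_zero]
    rw [← cancel_epi (F.toFunctor.map (H.ev P m)), natTrans_naturality f, hz, zero_comp]
    exact comp_zero.symm
  finite F := by
    have := hP.finite (F.toFunctor.obj P)
    let ℓ : (homActionObj k H P P ⟶ F) →ₗ[k] (P ⟶ F.toFunctor.obj P) :=
      { toFun φ := elem H φ
        map_add' φ ψ := Preadditive.comp_add _ _ _ _ _ _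
        map_smul' r φ := Linear.comp_smul _ _ _ _ _ _ }
    exact Module.Finite.of_injective ℓ fun φ ψ h => elem_injective H h

lemma isFiniteAbelian (H : InternalHom C M) : IsFiniteAbelian k (DualCategory k C M) := by
  obtain ⟨P, hP⟩ := (IsFiniteModuleCategory.finiteAbelian (k := k) (C := C)
    (M := M)).exists_isProjectiveGenerator
  exact (isProjectiveGenerator_homActionObj H hP).isFiniteAbelian

end DualCategory

/-! ### The dual category is rigid -/

namespace DualCategory

section Monoidal

variable {k : Type w} [Field k] {C : Type u₁} [Category.{v₁} C] [Preadditive C] [Linear k C]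
  [MonoidalCategory C] {M : Type u₂} [Category.{v₂} M] [Preadditive M] [Linear k M]
  [MonoidalLeftAction C M] [IsBilinearAction k C M]

instance : MonoidalPreadditive (DualCategory k C M) where
  whiskerLeft_zero := hom_ext_app fun _ => rfl
  zero_whiskerRight {F _ _} := hom_ext_app fun _ => F.toFunctor.map_zero _ _
  whiskerLeft_add _ _ := hom_ext_app fun _ => rfl
  add_whiskerRight {F _ _} _ _ := hom_ext_app fun _ => F.toFunctor.map_add

instance : MonoidalLinear k (DualCategory k C M) where
  whiskerLeft_smul _ _ _ _ _ := hom_ext_app fun _ => rfl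
  smul_whiskerRight r {_ _} f F := hom_ext_app fun m => F.toFunctor.map_smul r (f.natTrans.app m)

end Monoidal

section Adjoint

variable {k : Type w} [Field k] {C : Type u₁} [Category.{v₁} C]
  [MonoidalCategory C] {M : Type u₂} [Category.{v₂} M] [Preadditive M] [Linear k M]
  [MonoidalLeftAction C M]

/-- An adjunction between objects of the dual category whose right adjoint carries the induced
module structure is an exact pairing. -/
@[reducible]
def exactPairingOfAdjunction (F G : DualCategory k C M) (adj : F.toFunctor ⊣ G.toFunctor)
    (h : ∀ (X : C) (m : M), μₗ G.toFunctor X m = adj.homEquiv _ _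
      (δₗ F.toFunctor X (G.toFunctor.obj m) ≫ X ⊴ₗ adj.counit.app m)) : ExactPairing F G :=
  let u (m : M) : m ⟶ G.toFunctor.obj (F.toFunctor.obj m) := adj.unit.app m
  let e (m : M) : F.toFunctor.obj (G.toFunctor.obj m) ⟶ m := adj.counit.app m
  have e_naturality {m n : M} (f : m ⟶ n) :
      F.toFunctor.map (G.toFunctor.map f) ≫ e n = e m ≫ f := adj.counit.naturality f
  have left_triangle (m : M) : F.toFunctor.map (u m) ≫ e (F.toFunctor.obj m) = 𝟙 _ :=
    adj.left_triangle_components m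
  have right_triangle (m : M) : u (G.toFunctor.obj m) ≫ G.toFunctor.map (e m) = 𝟙 _ :=
    adj.right_triangle_components m
  have map_e_injective {m n : M} {a b : m ⟶ G.toFunctor.obj n}
      (hab : F.toFunctor.map a ≫ e n = F.toFunctor.map b ≫ e n) : a = b :=
    (adj.homEquiv m n).symm.injective
      ((adj.homEquiv_counit _ _ _).trans (hab.trans (adj.homEquiv_counit _ _ _).symm))
  have map_e (X : C) (m : M) : F.toFunctor.map (μₗ G.toFunctor X m) ≫ e (X ⊙ₗ m) =
      δₗ F.toFunctor X (G.toFunctor.obj m) ≫ X ⊴ₗ e m := by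
    rw [h]
    exact (adj.homEquiv_counit _ _ _).symm.trans (Equiv.symm_apply_apply _ _)
  { coevaluation' :=
      { natTrans := adj.unit
        comm X m := by
          change X ⊴ₗ u m ≫ μₗ G.toFunctor X (F.toFunctor.obj m) ≫
            G.toFunctor.map (μₗ F.toFunctor X m) = 𝟙 _ ≫ u (X ⊙ₗ m)
          -- Both sides are compared after transposition to F, where `map_e` removes the structure
          -- morphism of G.
          apply map_e_injective
          rw [Category.id_comp, left_triangle]
          simp only [Functor.map_comp, Category.assoc]
          rw [e_naturality, reassoc_of% map_e, δₗ_naturality_right_assoc,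
            ← actionHomRight_comp_assoc, left_triangle]
          simp }
    evaluation' :=
      { natTrans := adj.counit
        comm X m := by
          change X ⊴ₗ e m ≫ 𝟙 _ = (μₗ F.toFunctor X (G.toFunctor.obj m) ≫
            F.toFunctor.map (μₗ G.toFunctor X m)) ≫ e (X ⊙ₗ m)
          rw [Category.assoc, map_e]
          simp }
    coevaluation_evaluation' := hom_ext_app fun m => by
      change u (G.toFunctor.obj m) ≫ 𝟙 _ ≫ G.toFunctor.map (e m) = 𝟙 _ ≫ 𝟙 _
      rw [Category.id_comp, Category.id_comp, right_triangle]
    evaluation_coevaluation' := hom_ext_app fun m => by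
      change F.toFunctor.map (u m) ≫ 𝟙 _ ≫ e (F.toFunctor.obj m) = 𝟙 _ ≫ 𝟙 _
      rw [Category.id_comp, Category.id_comp, left_triangle] }

end Adjoint

lemma isLeftAdjoint {k : Type w} [Field k] {C : Type u₁} [Category.{v₁} C] [Abelian C]
    [Linear k C] [MonoidalCategory C] {M : Type u₂} [Category.{v₂} M] [Abelian M] [Linear k M]
    [MonoidalLeftAction C M] [IsFiniteModuleCategory k C M] (F : DualCategory k C M) : F.toFunctor.IsLeftAdjoint := by
  obtain ⟨P, hP⟩ := (IsFiniteModuleCategory.finiteAbelian (k := k) (C := C)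
    (M := M)).exists_isProjectiveGenerator
  exact hP.isLeftAdjoint F.toFunctor hP

variable {k : Type w} [Field k] {C : Type u₁} [Category.{v₁} C] [Abelian C] [Linear k C]
  [MonoidalCategory C] {M : Type u₂} [Category.{v₂} M] [Abelian M] [Linear k M]
  [MonoidalLeftAction C M] [RightRigidCategory C] [IsFiniteMultiTensorCategory k C]
  [IsExactModuleCategory k C M]

/-- The right adjoint as an object of the dual category. -/
def rightAdjointObj (F : DualCategory k C M) : DualCategory k C M :=
  have := F.isLeftAdjoint
  have adj := Adjunction.ofIsLeftAdjoint F.toFunctor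
  have := adj.right_adjoint_additive
  have := rightAdjoint_linear (k := k) adj
  ofLax F.toFunctor.rightAdjoint (rightAdjointLax (Adjunction.ofIsLeftAdjoint F.toFunctor))

instance (F : DualCategory k C M) : HasRightDual F where
  rightDual := rightAdjointObj F
  exact :=
    have := F.isLeftAdjoint
    exactPairingOfAdjunction F (rightAdjointObj F) (Adjunction.ofIsLeftAdjoint F.toFunctor)
      fun _ _ => rfl

instance : RightRigidCategory (DualCategory k C M) where

/-- A nondegenerate pairing on the module category makes right duals left duals. -/
@[reducible]
def rigidCategory {p : PivotalStructure C} (P : ModulePairing p M) :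
    RigidCategory (DualCategory k C M) where
  -- The exact pairing of F^* with F^** is transported along F ≅ F^**, so that F^* also becomes a
  -- left dual of F.
  leftDual F :=
    { leftDual := dualObj F
      exact := exactPairingCongrRight (doubleDualIso P F (dualObj F) (dualObj (dualObj F))) }

lemma isFiniteMultiTensorCategory {p : PivotalStructure C} (P : ModulePairing p M)
    (H : InternalHom C M) : IsFiniteMultiTensorCategory k (DualCategory k C M) where
  finiteAbelian := isFiniteAbelian H
  rigid := ⟨rigidCategory P⟩

end DualCategory

/-- The hypotheses only assert that some abelian structure induces the given preadditive one;
substituting along this equality makes the previous results applicable. -/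
lemma isFiniteMultiTensorCategory_dualCategory {k : Type w} [Field k] {C : Type u₁}
    [Category.{v₁} C] [iC : Preadditive C] [Linear k C] [MonoidalCategory C]
    [hC : IsFiniteMultiTensorCategory k C] [RightRigidCategory C] {p : PivotalStructure C}
    {M : Type u₂} [Category.{v₂} M] [iM : Preadditive M] [Linear k M] [MonoidalLeftAction C M]
    [hM : IsExactModuleCategory k C M] (P : ModulePairing p M) (H : InternalHom C M) :
    IsFiniteMultiTensorCategory k (DualCategory k C M) := by
  obtain ⟨aC, eC⟩ := hC.finiteAbelian.abelian
  obtain ⟨aM, eM⟩ := hM.finiteAbelian.abelian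
  replace eC : aC.toPreadditive = iC := eC
  replace eM : aM.toPreadditive = iM := eM
  subst eC eM
  exact DualCategory.isFiniteMultiTensorCategory P H

end TensorCat

end

theorem mainTheorem5 {k : Type w} [Field k] [IsAlgClosed k]
    {C : Type u₁} [Category.{v₁} C] [Preadditive C] [Linear k C] [MonoidalCategory C]
    [IsFiniteTensorCategory k C] [RightRigidCategory C] (p : PivotalStructure C)
    {M : Type u₂} [Category.{v₂} M] [Preadditive M] [Linear k M] [MonoidalLeftAction C M]
    [IsExactModuleCategory k C M]
    {H : InternalHom C M} {S : RelativeSerreFunctor H} {T : S.TwistedStructure}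
    (pM : ModulePivotalStructure p T) :
    IsFiniteMultiTensorCategory k (DualCategory k C M) ∧
    ∀ [RightRigidCategory (DualCategory k C M)],
      ∃ q : PivotalStructure (DualCategory k C M), ∀ F : DualCategory k C M,
        ∃ θ : F.toFunctor ⋙ S.functor ≅ S.functor ⋙ (dualObj (dualObj F)).toFunctor,
          F.IsSerreComparison S θ ∧
          ∀ m : M, (q.iso F).hom.natTrans.app m =
            pM.iso.hom.app (F.toFunctor.obj m) ≫ θ.hom.app m ≫
              (dualObj (dualObj F)).toFunctor.map (pM.iso.inv.app m) := by
  -- The second half holds for an arbitrary choice of duals, unrelated to the adjoints that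
  -- establish rigidity in the first.
  exact ⟨isFiniteMultiTensorCategory_dualCategory pM.pairing H,
    DualCategory.exists_pivotalStructure pM⟩
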